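/- Let $d\geqslant 3$. For smooth functions $\varrho, a_1,\dots,a_{d-2}$ on $\mathbb{R}^d$ let $P(\varrho,[\boldsymbol a])$ be the Nambu--Poisson bi-vector $$P(\varrho,[\boldsymbol a])(f,g)=\varrho\cdot\det\Bigl(\frac{\partial(f,g,a_1,\dots,a_{d-2})}{\partial(x^1,\dots,x^d)}\Bigr).$$ Graphs and orientation. Let $\gamma$ be a real linear combination of graphs on the vertices $0,\dots,n-1$ with $2n-2$ ordered edges. For contents $T_0,\dots,T_{n-1}$ of the vertices, each a scalar function or a bi-vector, and for functions $f_1,\dots,f_s$ (here $s=0$ or $2$), put $$\mathrm{Or}(\gamma)(T_0\otimes\dots\otimes T_{n-1})(f_1,\dots,f_s)=\sum\pm\ (\text{value of the directed graph}).$$ The sum, extended linearly over the graphs of $\gamma$, is over all ways to direct the edges and to issue exactly one arrow from the vertices to each of $s$ new sinks containing $f_1,\dots,f_s$. Every arrow carries a summation index $i\in\{1,\dots,d\}$ and acts by $\partial/\partial x^i$ on the content of its head; a scalar must issue no arrows; a bi-vector $P=(P^{ij})$, where $P(f,g)=\sum_{i,j}P^{ij}\,\partial_if\,\partial_jg$,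 must issue exactly two, in the order inherited from the global ordering of arrows (sink arrows first, then the edges), whose indices select the component $P^{ij}$; all other directed graphs contribute $0$. The sign is that of the permutation which takes the global ordering of arrows to the ordering grouped by tails. Put $Q^\gamma(P)=\mathrm{Or}(\gamma)(P\otimes\dots\otimes P)$, with $s=2$. The tetrahedron $\gamma_3$ is the complete graph on $4$ vertices with edges ordered $01,02,03,12,13,23$. The pentagon-wheel cocycle is $\gamma_5=W+\tfrac52\Pi$, where $W$ is the wheel with ordered edges $12,23,34,45,51,01,02,03,04,05$ and $\Pi$ is the prism with a diagonal, with ordered edges $01,12,02,34,45,35,03,14,25,04$. A differential polynomial in $\varrho$ and $\boldsymbol a$ is a polynomial with constant real coefficients in finitely many partial derivatives of $\varrho,a_1,\dots,a_{d-2}$; it is one universal expression for all $\varrho$ and $\boldsymbol a$. Theorem. Let $(\gamma,d)$ be one of $(\gamma_3,3)$, $(\gamma_3,4)$, $(\gamma_5,3)$. For $P=P(\varrho,[\boldsymbol a])$ put $$\dot a_i=\mathrm{Or}(\gamma)(a_i\otimes P\otimes\dots\otimes P)+\mathrm{Or}(\gamma)(P\otimes a_i\otimes P\otimes\dots\otimes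 P)+\dots+\mathrm{Or}(\gamma)(P\otimes\dots\otimes P\otimes a_i).$$ Then each $\dot a_i$ is a differential polynomial in $\varrho$ and $\boldsymbol a$, and there is a differential polynomial $\dot\varrho$ in $\varrho$ and $\boldsymbol a$ such that, for all smooth $\varrho,\boldsymbol a,f,g$, one has $$\dot\varrho=\frac{\bigl(Q^\gamma(P)-\sum_{i=1}^{d-2}P(\varrho,[a_1],\dots,[\dot a_i],\dots,[a_{d-2}])\bigr)(f,g)}{\det\bigl(\partial(f,g,a_1,\dots,a_{d-2})/\partial(x^1,\dots,x^d)\bigr)}$$ at every point where the denominator is nonzero, and the Leibniz rule $$Q^\gamma(P)=P(\dot\varrho,[\boldsymbol a])+\sum_{i=1}^{d-2}P(\varrho,[a_1],\dots,[\dot a_i],\dots,[a_{d-2}])$$ holds everywhere on $\mathbb{R}^d$. Hence the flow $\dot P=Q^\gamma(P)$ preserves the class of Nambu--Poisson brackets over $\mathbb{R}^d$, i.e. there exist evolutions $\dot\varrho=R([\varrho],[\boldsymbol a])$, $\dot a_i=A_i([\varrho],[\boldsymbol a])$ by differential polynomials for which this Leibniz rule holds for all smooth $\varrho$ and $\boldsymbol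 a$. -/

import Mathlib

open scoped ContDiff

noncomputable section

namespace NambuFlow

/-! ### Functions on `ℝ^d` and their partial derivatives -/

/-- Scalar functions on `ℝ^d`, with the Cartesian coordinates `x 0, …, x (d-1)`. Smoothness is
imposed where it is needed, as `ContDiff ℝ ∞`. -/
abbrev Fn (d : ℕ) : Type := (Fin d → ℝ) → ℝ

/-- `∂f / ∂x^i`. -/
def partialD {d : ℕ} (i : Fin d) (f : Fn d) : Fn d :=
  fun x => fderiv ℝ f x (Pi.single i 1)

/-- `∂^r f / ∂x^{i₁} ⋯ ∂x^{i_r}` for the list `[i₁, …, i_r]`. -/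
def iterPartial {d : ℕ} (l : List (Fin d)) (f : Fn d) : Fn d :=
  l.foldr partialD f

/-- `∂^α f` for a multi-index `α`. -/
def multiPartial {d : ℕ} (α : Fin d → ℕ) (f : Fn d) : Fn d :=
  (List.finRange d).foldr (fun i h => (partialD i)^[α i] h) f

/-- The coordinate function `x^i`. -/
def coord {d : ℕ} (i : Fin d) : Fn d := fun x => x i

/-- The Jacobian determinant `det (∂(F_1, …, F_d) / ∂(x^1, …, x^d))`. -/
def jacobianDet {d : ℕ} (F : Fin d → Fn d) : Fn d :=
  fun x => Matrix.det (Matrix.of fun r c : Fin d => partialD c (F r) x)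

/-! ### Nambu-determinant brackets

The dimension is written `d = k + 2`, where `k = d - 2` is the number of Casimirs. -/

/-- `det (∂(f, g, a_1, …, a_{d-2}) / ∂(x^1, …, x^d))`. -/
def nambuJacobian {k : ℕ} (a : Fin k → Fn (k + 2)) (f g : Fn (k + 2)) : Fn (k + 2) :=
  jacobianDet (Matrix.vecCons f (Matrix.vecCons g a))

/-- The Nambu bracket `P(ϱ, [a])(f, g) = ϱ · det (∂(f, g, a_1, …, a_{d-2}) / ∂(x^1, …, x^d))`. -/
def nambuBracket {k : ℕ} (ϱ : Fn (k + 2)) (a : Fin k → Fn (k + 2)) (f g : Fn (k + 2)) :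
    Fn (k + 2) :=
  fun x => ϱ x * nambuJacobian a f g x

/-- The components of a bi-vector `P = ½ P^{ij} ∂_i ∧ ∂_j`, so that
`P(f, g) = P^{ij} ∂_i f ∂_j g`. -/
abbrev Bivector (d : ℕ) : Type := Fin d → Fin d → Fn d

/-- The Nambu bi-vector, `P^{ij} = {x^i, x^j}`. -/
def nambuBivector {k : ℕ} (ϱ : Fn (k + 2)) (a : Fin k → Fn (k + 2)) : Bivector (k + 2) :=
  fun i j => nambuBracket ϱ a (coord i) (coord j)

/-! ### Graphs and the edge orientation morphism -/

/-- An undirected graph on the vertices `0, …, n-1` together with an ordering of its edges,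
given by the ordered list of edges (as unordered pairs: each edge gets both directions below). -/
abbrev OrderedGraph (n : ℕ) : Type := List (Fin n × Fin n)

/-- A formal linear combination of edge-ordered graphs on `n` vertices. -/
abbrev GraphSum (n : ℕ) : Type := List (ℝ × OrderedGraph n)

/-- The content of a vertex: a `0`-vector (scalar function) or a bi-vector. -/
inductive Content (d : ℕ) : Type
  | scalar (a : Fn d) : Content d
  | bivector (P : Bivector d) : Content d

/-- The component of the content of a vertex that is selected by the indices on the ordered list
of the arrows issued from this vertex: a scalar issues no arrow, a bi-vector issues exactly two
(Left ≺ Right), and all other lists contribute zero. -/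
def Content.coeff {d : ℕ} : Content d → List (Fin d) → Fn d
  | .scalar a, [] => a
  | .bivector P, [i, j] => P i j
  | _, _ => fun _ => 0

section Orientation

variable {n s : ℕ} (E : OrderedGraph n)

/-- The tails of all arrows. The graph with ordered edges `E` is enlarged by `s` sinks. Its
arrows are ordered as follows: first the arrows to the sinks `0, …, s-1`, where the arrow to the
`j`-th sink is issued from the vertex `att j`; then the edges of `E`, directed as `dir` says. -/
def tail (att : Fin s → Fin n) (dir : Fin E.length → Bool) :
    Fin (s + E.length) → Fin n :=
  Fin.append att (fun e => if dir e then (E.get e).1 else (E.get e).2)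

/-- The heads of all arrows: vertices of the graph (`Sum.inl`) or sinks (`Sum.inr`). -/
def head (dir : Fin E.length → Bool) : Fin (s + E.length) → Fin n ⊕ Fin s :=
  Fin.append (fun j => Sum.inr j)
    (fun e => Sum.inl (if dir e then (E.get e).2 else (E.get e).1))

/-- The arrows issued from the vertex `v`, in the order inherited from the global one. -/
def outgoing (att : Fin s → Fin n) (dir : Fin E.length → Bool) (v : Fin n) :
    List (Fin (s + E.length)) :=
  (List.finRange _).filter (fun e => tail E att dir e = v)

/-- The arrows that head to the vertex or sink `w`. -/
def incoming (dir : Fin E.length → Bool) (w : Fin n ⊕ Fin s) : List (Fin (s + E.length)) :=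
  (List.finRange _).filter (fun e => head E dir e = w)

/-- The sign of the permutation that takes the global ordering of arrows to the concatenation of
the lists `outgoing 0, outgoing 1, …, outgoing (n-1)`: a pair of arrows `e < e'` is an inversion
exactly when the tail of `e'` precedes the tail of `e`. -/
def orientationSign (att : Fin s → Fin n) (dir : Fin E.length → Bool) : ℝ :=
  (-1) ^ (Finset.univ.filter
    (fun p : Fin (s + E.length) × Fin (s + E.length) =>
      p.1 < p.2 ∧ tail E att dir p.2 < tail E att dir p.1)).card

/-- The polydifferential expression of a directed graph: every arrow `e` carries a summation index
`i e`, which selects a component of the content of its tail and acts as `∂ / ∂x^{i e}` on the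
content of its head (of a vertex `T v`, or of a sink `f j`). -/
def directedGraphValue {d : ℕ} (att : Fin s → Fin n) (dir : Fin E.length → Bool)
    (T : Fin n → Content d) (f : Fin s → Fn d) : Fn d :=
  fun x => ∑ i : Fin (s + E.length) → Fin d,
    (∏ v : Fin n, iterPartial ((incoming (s := s) E dir (Sum.inl v)).map i)
        ((T v).coeff ((outgoing E att dir v).map i)) x) *
      ∏ j : Fin s, iterPartial ((incoming E dir (Sum.inr j)).map i) (f j) x

/-- `Or(Γ)(T_0 ⊗ ⋯ ⊗ T_{n-1})` for one edge-ordered graph, evaluated at the arguments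
`f_0, …, f_{s-1}`: the signed sum over all ways to direct the edges and to issue
exactly one arrow to each sink. -/
def orientGraph {d : ℕ} (T : Fin n → Content d) (f : Fin s → Fn d) : Fn d :=
  fun x => ∑ att : Fin s → Fin n, ∑ dir : Fin E.length → Bool,
    orientationSign E att dir * directedGraphValue E att dir T f x

end Orientation

/-- `Or(γ)(T_0 ⊗ ⋯ ⊗ T_{n-1})(f_0, …, f_{s-1})` for a linear combination `γ` of graphs. -/
def orient {n s d : ℕ} (γ : GraphSum n) (T : Fin n → Content d) (f : Fin s → Fn d) : Fn d :=
  fun x => (γ.map (fun t => t.1 * orientGraph t.2 T f x)).sum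

/-- The graph flow `Q^γ(P) = Or(γ)(P ⊗ ⋯ ⊗ P)`, evaluated at `f` and `g`. -/
def graphFlow {n d : ℕ} (γ : GraphSum n) (P : Bivector d) (f g : Fn d) : Fn d :=
  orient γ (fun _ => Content.bivector P) ![f, g]

/-- The tetrahedron `γ₃`. -/
def gamma3 : GraphSum 4 :=
  [(1, [(0, 1), (0, 2), (0, 3), (1, 2), (1, 3), (2, 3)])]

/-- The pentagon-wheel cocycle `γ₅`: the wheel with hub `0` and rim `1 2 3 4 5`, plus `5/2` times
the triangular prism (with triangles `0 1 2` and `3 4 5`) with one added diagonal `0 4`. -/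
def gamma5 : GraphSum 6 :=
  [(1, [(1, 2), (2, 3), (3, 4), (4, 5), (5, 1), (0, 1), (0, 2), (0, 3), (0, 4), (0, 5)]),
   (5 / 2, [(0, 1), (1, 2), (0, 2), (3, 4), (4, 5), (3, 5), (0, 3), (1, 4), (2, 5), (0, 4)])]

/-! ### Differential polynomials in `ϱ` and `a_1, …, a_{d-2}` -/

/-- Differential polynomials: polynomials, with constant coefficients, in the jet variables
`(none, α)`, which stands for `∂^α ϱ`, and `(some i, α)`, which stands for `∂^α a_i`. -/
abbrev DiffPoly (k : ℕ) : Type := MvPolynomial (Option (Fin k) × (Fin (k + 2) → ℕ)) ℝ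

/-- The value of a differential polynomial at given `ϱ` and `a`. -/
def DiffPoly.value {k : ℕ} (R : DiffPoly k) (ϱ : Fn (k + 2)) (a : Fin k → Fn (k + 2)) :
    Fn (k + 2) :=
  fun x => MvPolynomial.eval (fun j => multiPartial j.2 (j.1.elim ϱ a) x) R

/-! ### Evolution of the Nambu structure -/

/-- `Σ_i P(ϱ, [a_1], …, [ȧ_i], …, [a_{d-2}])(f, g)`. -/
def casimirTerms {k : ℕ} (ϱ : Fn (k + 2)) (a adot : Fin k → Fn (k + 2)) (f g : Fn (k + 2)) :
    Fn (k + 2) :=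
  fun x => ∑ i : Fin k, nambuBracket ϱ (Function.update a i (adot i)) f g x

/-- The flow `Ṗ = Q(P)` on bi-vectors over `ℝ^{k+2}` is matched, on Nambu bi-vectors, by the
evolution `ϱ̇ = R([ϱ], [a])`, `ȧ_i = A_i([ϱ], [a])`, through the Leibniz rule
`Q(P) = P(ϱ̇, [a]) + Σ_i P(ϱ, [a_1], …, [ȧ_i], …, [a_{d-2}])`. -/
def LeibnizRule {k : ℕ} (Q : Bivector (k + 2) → Fn (k + 2) → Fn (k + 2) → Fn (k + 2))
    (R : DiffPoly k) (A : Fin k → DiffPoly k) : Prop :=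
  ∀ (ϱ : Fn (k + 2)) (a : Fin k → Fn (k + 2)) (f g : Fn (k + 2)),
    ContDiff ℝ ∞ ϱ → (∀ i, ContDiff ℝ ∞ (a i)) → ContDiff ℝ ∞ f → ContDiff ℝ ∞ g →
    ∀ x, Q (nambuBivector ϱ a) f g x =
      nambuBracket (R.value ϱ a) a f g x +
        casimirTerms ϱ a (fun i => (A i).value ϱ a) f g x

/-- The class of Nambu–Poisson brackets over `ℝ^{k+2}` is preserved by the flow `Ṗ = Q(P)`. -/
def PreservesNambuClass (k : ℕ)
    (Q : Bivector (k + 2) → Fn (k + 2) → Fn (k + 2) → Fn (k + 2)) : Prop :=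
  ∃ (R : DiffPoly k) (A : Fin k → DiffPoly k), LeibnizRule Q R A

/-- The velocity of the Casimir `a_i` given by the graph cocycle:
`ȧ_i = Or(γ)(a_i ⊗ P ⊗ ⋯ ⊗ P) + Or(γ)(P ⊗ a_i ⊗ ⋯ ⊗ P) + ⋯ + Or(γ)(P ⊗ ⋯ ⊗ P ⊗ a_i)`. -/
def casimirVelocity {n k : ℕ} (γ : GraphSum n) (ϱ : Fn (k + 2)) (a : Fin k → Fn (k + 2))
    (i : Fin k) : Fn (k + 2) :=
  fun x => ∑ v : Fin n,
    orient γ (Function.update (fun _ => Content.bivector (nambuBivector ϱ a)) v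
      (Content.scalar (a i))) ![] x

/-- The fraction `(Q^γ(P) - Σ_i P(ϱ, [a_1], …, [ȧ_i], …, [a_{d-2}]))(f, g)` over
`det (∂(f, g, a_1, …, a_{d-2}) / ∂(x^1, …, x^d))`; meaningful where the Jacobian is nonzero. -/
def densityVelocityFraction {n k : ℕ} (γ : GraphSum n) (ϱ : Fn (k + 2))
    (a : Fin k → Fn (k + 2)) (f g : Fn (k + 2)) : Fn (k + 2) :=
  fun x =>
    (graphFlow γ (nambuBivector ϱ a) f g x - casimirTerms ϱ a (casimirVelocity γ ϱ a) f g x) /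
      nambuJacobian a f g x

/-- Over `ℝ^{k+2}`, the formulas for `ȧ_i` and `ϱ̇` in terms of `γ` are given by differential
polynomials `A_i` and `R` (for all smooth `ϱ`, `a` and independently of the arguments `f`, `g` of
the fraction), and the Leibniz rule holds for `Q^γ` with these velocities. -/
def GraphFormulasHold {n : ℕ} (k : ℕ) (γ : GraphSum n) : Prop :=
  ∃ (R : DiffPoly k) (A : Fin k → DiffPoly k),
    (∀ (ϱ : Fn (k + 2)) (a : Fin k → Fn (k + 2)),
      ContDiff ℝ ∞ ϱ → (∀ i, ContDiff ℝ ∞ (a i)) →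
      (∀ i x, casimirVelocity γ ϱ a i x = (A i).value ϱ a x) ∧
      ∀ f g : Fn (k + 2), ContDiff ℝ ∞ f → ContDiff ℝ ∞ g →
        ∀ x, nambuJacobian a f g x ≠ 0 →
          densityVelocityFraction γ ϱ a f g x = R.value ϱ a x) ∧
    LeibnizRule (graphFlow γ) R A

end NambuFlow

end

noncomputable section

set_option linter.unusedSectionVars false

namespace NambuFlow

open MvPolynomial

/-! The Nambu bi-vector `P` is Poisson and every `a_l` is its Casimir, `P(a_l, ·) = 0`. The heart of
the proof is that for a graph cocycle with flow `Q` one has `Q(a, ·) + P(ȧ, ·) = 0` for each Casimir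
`a` (`sum_der_mul_flowComponent`): the velocity `ȧ` keeps `a` a Casimir to first order.

To see this, evaluate the differential of the cocycle with `a` in one vertex, `P` in all others, and
one sink, summing over the position of `a`. The differential consists of all vertex splittings minus
twice the graphs with an attached leaf. In the sum over all splittings of a vertex, every other
arrow sees the two halves only through the product of their contents, by the Leibniz rule. The new
edge between the halves then produces the Jacobiator if both halves hold `P`
(`orientForm_eq_zero_of_jacobi`), and the vector `P(a, ·)` if one of them holds `a`
(`orientForm_eq_zero_of_casimir`); both vanish. As the differential is zero, the leaf graphs sum to
zero as well. A leaf holding `a` acts as a second sink and gives `Q(a, ·)`; a leaf holding `P` must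
send one arrow to the sink and one into the graph, which gives `P(ȧ, ·)`.

Contracting `Σ_i P(ϱ, [a_1], …, [ȧ_i], …)` with `a_l` gives `-P(ȧ_l, ·)` too, because a determinant
with a repeated row vanishes. Hence the difference `V` of `Q` and this sum annihilates all `d - 2`
Casimirs, and linear algebra gives `V^{ij} N^{kl} = V^{kl} N^{ij}` for the Nambu determinant `N`.
All this is done in the ring of differential polynomials, where `N^{01}` is prime (a variable for `d
= 3`, a 2 by 2 minor for `d = 4`) and does not divide `N^{02}`. So `N^{01}` divides `V^{01}`, and
the quotient is the differential polynomial `ϱ̇` (`exists_densityPoly`). Substituting smooth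
functions is a homomorphism of differential rings, so the identity passes to all of them, including
points where the Jacobian vanishes.

The signed sums over directed graphs are handled as determinants (`orientForm`): rows are arrows,
columns are the two slots of each bi-vector, and entries are symbols of partial derivatives acting
on the head. The Leibniz formula enumerates assignments of arrows to slots, and each admissible
directed graph on `n` bi-vectors is met `2^n` times (`orientGraph_eq`). That the two combinations of
graphs are cocycles is a finite computation with explicit relabellings. -/

/-! ### Differential rings and iterated derivations -/

/-- A real commutative algebra with `d` commuting derivations. -/
class DiffRing (d : ℕ) (R : Type*) [CommRing R] [Algebra ℝ R] where
  /-- The derivations. -/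
  der : Fin d → Derivation ℝ R R
  der_comm : ∀ i j r, der i (der j r) = der j (der i r)

section JetEval

variable {d : ℕ} {R : Type*} [CommRing R] [Algebra ℝ R] [DiffRing d R]

instance : LeftCommutative fun (i : Fin d) (r : R) => DiffRing.der i r :=
  ⟨fun i j r => DiffRing.der_comm i j r⟩

/-- The iterated derivative along a multiset of directions. -/
def iterDer (M : Multiset (Fin d)) (r : R) : R :=
  M.foldr (fun i r => DiffRing.der i r) r

@[simp] theorem iterDer_zero (r : R) : iterDer (0 : Multiset (Fin d)) r = r := rfl

@[simp] theorem iterDer_cons (i : Fin d) (M : Multiset (Fin d)) (r : R) :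
    iterDer (i ::ₘ M) r = DiffRing.der i (iterDer M r) :=
  Multiset.foldr_cons _ _ _ _

theorem iterDer_der (i : Fin d) (M : Multiset (Fin d)) (r : R) :
    iterDer M (DiffRing.der i r) = DiffRing.der i (iterDer M r) := by
  induction M using Multiset.induction_on with
  | empty => simp
  | cons j M ih => rw [iterDer_cons, ih, iterDer_cons, DiffRing.der_comm]

theorem iterDer_coe (l : List (Fin d)) (r : R) :
    iterDer (l : Multiset (Fin d)) r = l.foldr (fun i r => DiffRing.der i r) r :=
  Multiset.coe_foldr _ _ _

theorem iterDer_add (M : Multiset (Fin d)) (r r' : R) :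
    iterDer M (r + r') = iterDer M r + iterDer M r' := by
  induction M using Multiset.induction_on with
  | empty => simp
  | cons j M ih => simp [ih]

theorem iterDer_smul (M : Multiset (Fin d)) (c : ℝ) (r : R) :
    iterDer M (c • r) = c • iterDer M r := by
  induction M using Multiset.induction_on with
  | empty => simp
  | cons j M ih => simp [ih]

/-! ### Symbols of multi-differential operators and their evaluation. -/

variable {H : Type*} [Fintype H] [DecidableEq H]

/-- The polynomial ring in the symbols of `∂ / ∂x^i` acting on the content of a holder `h`. -/
abbrev Symb (H : Type*) (d : ℕ) : Type _ := MvPolynomial (H × Fin d) ℝ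

/-- The directions, with multiplicity, in which the content of `h` is differentiated. -/
def directions (h : H) (M : Multiset (H × Fin d)) : Multiset (Fin d) :=
  (M.filter fun e => e.1 = h).map Prod.snd

/-- Apply a symbol to contents: a monomial goes to the product of the derivatives of the contents
that it prescribes. -/
def jetEval (T : H → R) : Symb H d →ₗ[ℝ] R :=
  (basisMonomials (H × Fin d) ℝ).constr ℝ
    fun s => ∏ h, iterDer (directions h (Finsupp.toMultiset s)) (T h)

theorem jetEval_monomial (T : H → R) (s : H × Fin d →₀ ℕ) (c : ℝ) :
    jetEval T (monomial s c) =
      c • ∏ h, iterDer (directions h (Finsupp.toMultiset s)) (T h) := by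
  have h1 : monomial s c = c • (basisMonomials (H × Fin d) ℝ) s := by
    rw [coe_basisMonomials, smul_monomial, smul_eq_mul, mul_one]
  rw [h1, map_smul, jetEval, Module.Basis.constr_basis]

theorem jetEval_C (T : H → R) (c : ℝ) : jetEval (d := d) T (C c) = c • ∏ h, T h := by
  rw [C_apply, jetEval_monomial]
  simp [directions]

/-- As the derivations commute, the extra one may be applied first, to the content itself. The
inductions on symbols strip variables by this rule. -/
theorem jetEval_X_mul (T : H → R) (h : H) (i : Fin d) (p : Symb H d) :
    jetEval T (X (h, i) * p) = jetEval (Function.update T h (DiffRing.der i (T h))) p := by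
  induction p using MvPolynomial.induction_on' with
  | add p q hp hq => rw [mul_add, map_add, map_add, hp, hq]
  | monomial s c =>
    rw [X, monomial_mul, one_mul, jetEval_monomial, jetEval_monomial]
    congr 1
    refine Finset.prod_congr rfl fun h' _ => ?_
    rw [Finsupp.toMultiset_add, Finsupp.toMultiset_single, one_smul]
    by_cases hh : h' = h
    · subst hh
      simp [directions, iterDer_der]
    · have : ¬ h = h' := fun e => hh e.symm
      simp [directions, hh, this]

/-- The value of a symbol as a linear function of the content of one holder. -/
def jetEvalAt (T : H → R) (h : H) (p : Symb H d) : R →ₗ[ℝ] R where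
  toFun r := jetEval (Function.update T h r) p
  map_add' r r' := by
    induction p using MvPolynomial.induction_on' with
    | add p q hp hq => simp only [map_add, hp, hq]; ring
    | monomial s c =>
      simp only [jetEval_monomial, ← Finset.mul_prod_erase _ _ (Finset.mem_univ h),
        Function.update_self, iterDer_add, add_mul, smul_add]
      congr 3 <;>
        exact Finset.prod_congr rfl fun h' hh => by
          rw [Function.update_of_ne (Finset.ne_of_mem_erase hh),
            Function.update_of_ne (Finset.ne_of_mem_erase hh)]
  map_smul' a r := by
    induction p using MvPolynomial.induction_on' with
    | add p q hp hq => simp only [map_add, hp, hq, smul_add]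
    | monomial s c =>
      simp only [jetEval_monomial, ← Finset.mul_prod_erase _ _ (Finset.mem_univ h),
        Function.update_self, iterDer_smul, RingHom.id_apply]
      rw [smul_comm a c, smul_mul_assoc]
      congr 3
      exact Finset.prod_congr rfl fun h' hh => by
          rw [Function.update_of_ne (Finset.ne_of_mem_erase hh),
            Function.update_of_ne (Finset.ne_of_mem_erase hh)]

theorem jetEvalAt_apply (T : H → R) (h : H) (p : Symb H d) (r : R) :
    jetEvalAt T h p r = jetEval (Function.update T h r) p := rfl

/-- The edges of a directed graph with chosen indices have such a product as their symbol: one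
variable for the head of each edge. -/
theorem jetEval_prod_X {ι : Type*} [Fintype ι] (T : H → R) (k : ι → H × Fin d) :
    jetEval T (∏ e, X (k e)) =
      ∏ h, iterDer (directions h (Finset.univ.val.map k)) (T h) := by
  have h1 : (∏ e, (X (k e) : Symb H d)) = monomial (∑ e, Finsupp.single (k e) 1) 1 := by
    rw [monomial_sum_one]; rfl
  rw [h1, jetEval_monomial, one_smul, map_sum]
  simp only [Finsupp.toMultiset_single, one_smul]
  have h2 : ∑ e, ({k e} : Multiset (H × Fin d)) = Finset.univ.val.map k := by
    rw [Finset.sum, ← Multiset.sum_map_singleton (Finset.univ.val.map k), Multiset.map_map]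
    rfl
  rw [h2]

/-- Application of symbols commutes with homomorphisms of differential rings. -/
theorem map_jetEval {R' : Type*} [CommRing R'] [Algebra ℝ R'] [DiffRing d R'] (f : R →ₐ[ℝ] R')
    (hf : ∀ (i : Fin d) r, f (DiffRing.der i r) = DiffRing.der i (f r)) (T : H → R)
    (p : Symb H d) : f (jetEval T p) = jetEval (f ∘ T) p := by
  have hM : ∀ (M : Multiset (Fin d)) r, f (iterDer M r) = iterDer M (f r) := by
    intro M r
    induction M using Multiset.induction_on with
    | empty => simp
    | cons j M ih => simp [ih, hf]
  induction p using MvPolynomial.induction_on' with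
  | add p q hp hq => simp only [map_add, hp, hq]
  | monomial s c => simp only [jetEval_monomial, map_smul, map_prod, hM, Function.comp]

/-- The derivation acts on the value of a symbol by the Leibniz rule. -/
theorem der_jetEval (T : H → R) (i : Fin d) (p : Symb H d) :
    DiffRing.der i (jetEval T p) = jetEval T ((∑ h, X (h, i)) * p) := by
  induction p using MvPolynomial.induction_on generalizing T with
  | C c =>
    have hprod : ∀ s : Finset H, DiffRing.der i (∏ h ∈ s, T h) =
        ∑ h ∈ s, (∏ g ∈ s.erase h, T g) * DiffRing.der i (T h) := by
      intro s
      induction s using Finset.induction_on with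
      | empty => simp
      | insert a s ha ih =>
        rw [Finset.prod_insert ha, Derivation.leibniz, ih, Finset.sum_insert ha,
          Finset.erase_insert ha, smul_eq_mul, smul_eq_mul, add_comm, Finset.mul_sum]
        congr 1
        refine Finset.sum_congr rfl fun h hh => ?_
        have hne : a ≠ h := fun e => ha (e ▸ hh)
        rw [Finset.erase_insert_of_ne hne, Finset.prod_insert (fun h' => ha (Finset.mem_of_mem_erase h')),
          mul_assoc]
    rw [Finset.sum_mul, map_sum, jetEval_C, Derivation.map_smul, hprod, Finset.smul_sum]
    refine Finset.sum_congr rfl fun h _ => ?_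
    rw [jetEval_X_mul, jetEval_C, ← Finset.prod_erase_mul _ _ (Finset.mem_univ h),
      Function.update_self]
    congr 2
    exact Finset.prod_congr rfl fun h' hh => by
      rw [Function.update_of_ne (Finset.ne_of_mem_erase hh)]
  | add p q hp hq => simp only [mul_add, map_add, hp, hq]
  | mul_X p k hp =>
    obtain ⟨h, j⟩ := k
    rw [mul_comm p, jetEval_X_mul, hp, mul_left_comm, jetEval_X_mul]

/-- Renaming the holders by an equivalence. -/
theorem jetEval_rename_equiv {H' : Type*} [Fintype H'] [DecidableEq H'] (e : H' ≃ H) (T : H → R)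
    (p : Symb H' d) : jetEval T (rename (Prod.map e id) p) = jetEval (T ∘ e) p := by
  induction p using MvPolynomial.induction_on generalizing T with
  | C c =>
    rw [rename_C, jetEval_C, jetEval_C]
    congr 1
    exact (Equiv.prod_comp e T).symm
  | add p q hp hq => simp only [map_add, hp, hq]
  | mul_X p k hp =>
    obtain ⟨h, i⟩ := k
    rw [map_mul, rename_X, mul_comm, Prod.map_apply, id, jetEval_X_mul, hp, mul_comm,
      jetEval_X_mul]
    rw [Function.update_comp_eq_of_injective _ e.injective]
    rfl

/-- A holder that does not occur in a symbol contributes its content as a factor. -/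
theorem jetEval_rename_of_injective {H' : Type*} [Fintype H'] [DecidableEq H'] {ι : H' → H}
    (hι : Function.Injective ι) {q : H} (hq : ∀ h, h ∈ Set.range ι ↔ h ≠ q) (T : H → R)
    (p : Symb H' d) : jetEval T (rename (Prod.map ι id) p) = jetEval (T ∘ ι) p * T q := by
  have hqι : ∀ h, q ≠ ι h := fun h e => (hq q).1 ⟨h, e.symm⟩ rfl
  induction p using MvPolynomial.induction_on generalizing T with
  | C c =>
    rw [rename_C, jetEval_C, jetEval_C, smul_mul_assoc,
      ← Finset.prod_erase_mul _ _ (Finset.mem_univ q)]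
    congr 2
    have h1 : Finset.univ.erase q = Finset.univ.map ⟨ι, hι⟩ := by
      ext h
      have := hq h
      simp only [Set.mem_range] at this
      simp [this]
    rw [h1, Finset.prod_map]
    rfl
  | add p q hp hq => simp only [map_add, hp, hq, add_mul]
  | mul_X p k hp =>
    obtain ⟨h, i⟩ := k
    rw [map_mul, rename_X, mul_comm, Prod.map_apply, id, jetEval_X_mul, hp, mul_comm p,
      jetEval_X_mul, Function.update_comp_eq_of_injective _ hι, Function.update_of_ne (hqι h)]
    rfl

/-- The symbols in which the holders `b` and `b'` are differentiated only jointly. -/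
def jointHom (b b' : H) : Symb H d →ₐ[ℝ] Symb H d :=
  aeval fun k => if k.1 = b ∨ k.1 = b' then X (b, k.2) + X (b', k.2) else X k

/-- This is the Leibniz rule: differentiating two factors jointly is differentiating their product,
which is stored at `b` while `b'` holds `1`. -/
theorem jetEval_jointHom {b b' : H} (hb : b ≠ b') (T : H → R) (p : Symb H d) :
    jetEval T (jointHom b b' p) =
      jetEval (Function.update (Function.update T b (T b * T b')) b' 1)
        (rename (fun k => if k.1 = b' then (b, k.2) else k) p) := by
  induction p using MvPolynomial.induction_on generalizing T with
  | C c =>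
    rw [rename_C, algHom_C, algebraMap_eq, jetEval_C, jetEval_C]
    congr 1
    rw [← Finset.mul_prod_erase _ _ (Finset.mem_univ b'),
      ← Finset.mul_prod_erase _ _ (Finset.mem_erase.2 ⟨hb, Finset.mem_univ b⟩),
      ← Finset.mul_prod_erase _ _ (Finset.mem_univ b'),
      ← Finset.mul_prod_erase _ _ (Finset.mem_erase.2 ⟨hb, Finset.mem_univ b⟩)]
    rw [Function.update_self, one_mul, Function.update_of_ne hb, Function.update_self,
      mul_left_comm, mul_assoc]
    congr 2
    refine Finset.prod_congr rfl fun h hh => ?_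
    simp only [Finset.mem_erase] at hh
    rw [Function.update_of_ne hh.2.1, Function.update_of_ne hh.1]
  | add p q hp hq => simp only [map_add, hp, hq]
  | mul_X p k hp =>
    obtain ⟨h, i⟩ := k
    rw [mul_comm p, map_mul (jointHom b b'), map_mul (rename _), rename_X]
    by_cases hh : h = b ∨ h = b'
    · have e1 : jointHom b b' (X (h, i) : Symb H d) = X (b, i) + X (b', i) := by
        simp [jointHom, hh]
      have e2 : (if h = b' then (b, i) else (h, i)) = (b, i) := by
        rcases hh with rfl | rfl <;> simp
      rw [e1, e2, add_mul, map_add, jetEval_X_mul, jetEval_X_mul, jetEval_X_mul, hp, hp,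
        Function.update_self, Function.update_of_ne hb.symm, Function.update_self,
        Function.update_of_ne hb, Function.update_of_ne hb, Function.update_self]
      have e3 : ∀ r s : R, Function.update (Function.update (Function.update T b r) b s) b' 1 =
          Function.update (Function.update T b' 1) b s := by
        intro r s; rw [Function.update_idem, Function.update_comm hb]
      have e4 : ∀ r s : R, Function.update (Function.update (Function.update T b' r) b s) b' 1 =
          Function.update (Function.update T b' 1) b s := by
        intro r s; rw [Function.update_comm hb.symm, Function.update_idem,
          Function.update_comm hb]
      have e5 : ∀ r s : R, Function.update (Function.update (Function.update T b r) b' 1) b s =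
          Function.update (Function.update T b' 1) b s := by
        intro r s; rw [Function.update_comm hb, Function.update_idem]
      -- The value is additive in the content of `b`, so the two Leibniz terms recombine into the
      -- derivative of the product.
      rw [e3, e4, e5, ← jetEvalAt_apply, ← jetEvalAt_apply, ← jetEvalAt_apply, ← map_add]
      congr 1
      rw [Derivation.leibniz, smul_eq_mul, smul_eq_mul]; ring
    · have hh1 : h ≠ b := fun e => hh (Or.inl e)
      have hh2 : h ≠ b' := fun e => hh (Or.inr e)
      have e1 : jointHom b b' (X (h, i) : Symb H d) = X (h, i) := by
        simp [jointHom, hh]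
      have e2 : (if h = b' then (b, i) else (h, i)) = (h, i) := by simp [hh2]
      rw [e1, e2, jetEval_X_mul, jetEval_X_mul, hp, Function.update_of_ne hh1.symm,
        Function.update_of_ne hh2.symm, Function.update_of_ne hh2, Function.update_of_ne hh1,
        Function.update_comm hh1, Function.update_comm hh2]

/-- Symbols in which `b` and `b'` are differentiated jointly only see the product of contents. -/
theorem jetEval_eq_of_mem_range {b b' : H} (hb : b ≠ b') {T : H → R} {p : Symb H d}
    (hp : p ∈ (jointHom (d := d) b b').range) :
    jetEval T p = jetEvalAt (Function.update T b' 1) b p (T b * T b') := by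
  obtain ⟨q, rfl⟩ := hp
  change jetEval T (jointHom b b' q) = jetEval _ (jointHom b b' q)
  -- The pairs `T b`, `T b'` and `T b * T b'`, `1` have the same product, so both sides reduce to
  -- the same value.
  rw [jetEval_jointHom hb, jetEval_jointHom hb]
  rw [Function.update_self, Function.update_of_ne hb.symm, Function.update_self, mul_one,
    Function.update_idem, Function.update_comm hb, Function.update_comm hb, Function.update_idem]

end JetEval

/-! ### The orientation morphism as a sum of determinants -/

section OrientForm

variable {n d : ℕ} {Q : Type*} {R : Type*} [CommRing R] [Algebra ℝ R]

/-- The symbol of an arrow, as a function of its tail (a bi-vector) and of its index. -/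
abbrev SymbRow (n : ℕ) (Q : Type*) (d : ℕ) : Type _ := Fin n → Fin d → Symb (Fin n ⊕ Q) d

/-- The contents of the holders, when the slots of the bi-vectors carry the indices `idx`. -/
def contents (P : Fin d → Fin d → R) (φ : Q → R) (idx : Fin n × Fin 2 → Fin d) :
    Fin n ⊕ Q → R :=
  Sum.elim (fun b => P (idx (b, 0)) (idx (b, 1))) φ

/-- The matrix of the symbols of the arrows (rows) issued from the slots (columns). -/
def rowMatrix (ρ : Fin n × Fin 2 → SymbRow n Q d) (idx : Fin n × Fin 2 → Fin d) :
    Matrix (Fin n × Fin 2) (Fin n × Fin 2) (Symb (Fin n ⊕ Q) d) :=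
  Matrix.of fun e t => ρ e t.1 (idx t)

/-- An edge, which may be directed either way. -/
def edgeRow [DecidableEq Q] (u w : Fin n ⊕ Q) : SymbRow n Q d := fun b i =>
  (if Sum.inl b = u then X (w, i) else 0) + (if Sum.inl b = w then X (u, i) else 0)

/-- An arrow to a sink, which contributes the component of a constant covector. -/
def constRow (ξ : Fin d → ℝ) : SymbRow n Q d := fun _ i => C (ξ i)

/-- An arrow to the scalar `q`, from any bi-vector. -/
def scalarRow (q : Q) : SymbRow n Q d := fun _ i => X (Sum.inr q, i)

theorem edgeRow_comm [DecidableEq Q] (u w : Fin n ⊕ Q) :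
    (edgeRow u w : SymbRow n Q d) = edgeRow w u := by
  funext b i
  rw [edgeRow, edgeRow, add_comm]

/-- The cofactor omits row `e` and column `t`. The row is replaced directly, the column after
transposing. -/
theorem adjugate_eq_of_eq {S A : Type*} [Fintype S] [DecidableEq S] [CommRing A]
    {M M' : Matrix S S A} {e t : S} (h : ∀ e' t', e' ≠ e → t' ≠ t → M e' t' = M' e' t') :
    M.adjugate t e = M'.adjugate t e := by
  have h1 : M.adjugate t e = (M.updateRow e (M' e)).adjugate t e := by
    rw [Matrix.adjugate_apply, Matrix.adjugate_apply, Matrix.updateRow_idem]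
  rw [h1, ← Matrix.transpose_apply (Matrix.adjugate _), ← Matrix.transpose_apply M'.adjugate,
    Matrix.adjugate_transpose, Matrix.adjugate_transpose, Matrix.adjugate_apply,
    Matrix.adjugate_apply]
  congr 1
  ext t' e'
  by_cases ht : t' = t
  · subst ht; simp
  · rw [Matrix.updateRow_ne ht, Matrix.updateRow_ne ht, Matrix.transpose_apply,
      Matrix.transpose_apply]
    by_cases he : e' = e
    · subst he; simp
    · rw [Matrix.updateRow_ne he, h _ _ he ht]

theorem det_mem {S K A : Type*} [Fintype S] [DecidableEq S] [CommRing K] [CommRing A] [Algebra K A]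
    (B : Subalgebra K A) {M : Matrix S S A} (h : ∀ e t, M e t ∈ B) : M.det ∈ B := by
  rw [Matrix.det_apply]
  exact B.sum_mem fun σ _ => by
    rw [Units.smul_def]
    exact B.zsmul_mem (B.prod_mem fun i _ => h _ _) _

/-- The functions `S → K` fall into fibres on which only the value at `t` varies. In the
applications this isolates the contraction over the index carried by the distinguished edge. -/
theorem sum_eq_zero_of_sum_update {S K A : Type*} [Fintype S] [DecidableEq S] [Fintype K]
    [DecidableEq K] [AddCommMonoid A] (G : (S → K) → A) (t : S)
    (h : ∀ idx, ∑ k, G (Function.update idx t k) = 0) : ∑ idx, G idx = 0 := by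
  rw [← (Equiv.funSplitAt t K).symm.sum_comp, Fintype.sum_prod_type, Finset.sum_comm]
  refine Finset.sum_eq_zero fun y _ => ?_
  rcases isEmpty_or_nonempty K with hK | ⟨⟨k₀⟩⟩
  · simp
  · rw [← h ((Equiv.funSplitAt t K).symm (k₀, y))]
    refine Finset.sum_congr rfl fun k _ => congrArg G ?_
    funext s
    by_cases hs : s = t
    · subst hs; simp [Equiv.funSplitAt, Equiv.piSplitAt]
    · simp [Equiv.funSplitAt, Equiv.piSplitAt, hs]

variable [Fintype Q] [DecidableEq Q] [DiffRing d R]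

/-- The signed sum over all ways to issue the arrows `ρ` from the slots of the bi-vectors. -/
def orientForm (P : Fin d → Fin d → R) (φ : Q → R) (ρ : Fin n × Fin 2 → SymbRow n Q d) : R :=
  ∑ idx : Fin n × Fin 2 → Fin d, jetEval (contents P φ idx) (rowMatrix ρ idx).det

variable (P : Fin d → Fin d → R) (φ : Q → R)

theorem map_orientForm {R' : Type*} [CommRing R'] [Algebra ℝ R'] [DiffRing d R'] (f : R →ₐ[ℝ] R')
    (hf : ∀ (i : Fin d) r, f (DiffRing.der i r) = DiffRing.der i (f r))
    (ρ : Fin n × Fin 2 → SymbRow n Q d) :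
    f (orientForm P φ ρ) = orientForm (fun i j => f (P i j)) (f ∘ φ) ρ := by
  rw [orientForm, map_sum, orientForm]
  refine Finset.sum_congr rfl fun idx _ => ?_
  rw [map_jetEval f hf]
  congr 2
  funext h
  cases h <;> rfl

theorem rowMatrix_update (ρ : Fin n × Fin 2 → SymbRow n Q d) (e : Fin n × Fin 2)
    (r : SymbRow n Q d) (idx : Fin n × Fin 2 → Fin d) :
    rowMatrix (Function.update ρ e r) idx =
      (rowMatrix ρ idx).updateRow e fun t => r t.1 (idx t) := by
  ext1 e' t
  by_cases h : e' = e
  · subst h; simp [rowMatrix]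
  · simp [rowMatrix, h]

theorem orientForm_update_add (ρ : Fin n × Fin 2 → SymbRow n Q d) (e : Fin n × Fin 2)
    (r r' : SymbRow n Q d) :
    orientForm P φ (Function.update ρ e (r + r')) =
      orientForm P φ (Function.update ρ e r) + orientForm P φ (Function.update ρ e r') := by
  simp only [orientForm, ← Finset.sum_add_distrib, ← map_add, rowMatrix_update]
  refine Finset.sum_congr rfl fun idx _ => ?_
  rw [← Matrix.det_updateRow_add]
  rfl

theorem orientForm_update_smul (ρ : Fin n × Fin 2 → SymbRow n Q d) (e : Fin n × Fin 2) (c : ℝ)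
    (r : SymbRow n Q d) :
    orientForm P φ (Function.update ρ e (c • r)) =
      c • orientForm P φ (Function.update ρ e r) := by
  simp only [orientForm, Finset.smul_sum, ← map_smul, rowMatrix_update]
  refine Finset.sum_congr rfl fun idx _ => ?_
  rw [smul_eq_C_mul (Matrix.det _), ← Matrix.det_updateRow_smul]
  simp only [smul_eq_C_mul, Pi.smul_apply]
  rfl

theorem orientForm_comp_perm (ρ : Fin n × Fin 2 → SymbRow n Q d)
    (σ : Equiv.Perm (Fin n × Fin 2)) :
    orientForm P φ (ρ ∘ σ) = ((Equiv.Perm.sign σ : ℤ) : ℝ) • orientForm P φ ρ := by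
  simp only [orientForm, Finset.smul_sum, ← map_smul]
  refine Finset.sum_congr rfl fun idx _ => ?_
  congr 1
  have h : rowMatrix (ρ ∘ σ) idx = (rowMatrix ρ idx).submatrix σ id := rfl
  rw [h, Matrix.det_permute, Int.cast_smul_eq_zsmul, zsmul_eq_mul]

/-- Renaming the bi-vectors. -/
def permRow (τ : Equiv.Perm (Fin n)) (r : SymbRow n Q d) : SymbRow n Q d := fun b i =>
  rename (Prod.map (Sum.map τ id) id) (r (τ.symm b) i)

theorem permRow_edgeRow (τ : Equiv.Perm (Fin n)) (u w : Fin n ⊕ Q) :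
    permRow τ (edgeRow u w : SymbRow n Q d) = edgeRow (Sum.map τ id u) (Sum.map τ id w) := by
  have h : ∀ (b : Fin n) (u : Fin n ⊕ Q),
      (Sum.inl (τ.symm b) = u) = (Sum.inl b = Sum.map τ id u) := by
    intro b u
    rcases u with u | u
    · simp [Equiv.symm_apply_eq]
    · simp
  funext b i
  simp only [permRow, edgeRow, map_add, apply_ite (rename (Prod.map (Sum.map τ id) id)), rename_X,
    map_zero, Prod.map_apply, id, h]

theorem permRow_constRow (τ : Equiv.Perm (Fin n)) (ξ : Fin d → ℝ) :
    permRow τ (constRow ξ : SymbRow n Q d) = constRow ξ := by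
  funext b i
  simp [permRow, constRow]

/-- A permutation of the bi-vectors moves both of their slots, so it permutes the columns with sign
`(sign τ)² = 1`. Hence bi-vectors are even and relabelling them costs no sign. -/
theorem orientForm_permRow (τ : Equiv.Perm (Fin n)) (ρ : Fin n × Fin 2 → SymbRow n Q d) :
    orientForm P φ (fun e => permRow τ (ρ e)) = orientForm P φ ρ := by
  let τ' : Equiv.Perm (Fin n × Fin 2) := Equiv.prodCongrLeft fun _ => τ
  have hsign : Equiv.Perm.sign τ' = 1 := by
    rw [Equiv.Perm.sign_prodCongrLeft]
    simp
  rw [orientForm, orientForm]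
  refine Fintype.sum_equiv (τ'.symm.arrowCongr (Equiv.refl _)) _ _ fun idx => ?_
  have h1 : rowMatrix (fun e => permRow τ (ρ e)) idx =
      ((rowMatrix ρ (τ'.symm.arrowCongr (Equiv.refl _) idx)).map
        (rename (Prod.map (Sum.map τ id) id))).submatrix id τ'.symm := by
    ext1 e t
    obtain ⟨b, j⟩ := t
    simp [rowMatrix, permRow, τ', Equiv.prodCongrLeft]
  rw [h1, Matrix.det_permute', Equiv.Perm.sign_symm, hsign]
  simp only [Units.val_one, Int.cast_one, one_mul]
  have h2 := jetEval_rename_equiv (R := R) (d := d) (Equiv.sumCongr τ (Equiv.refl Q))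
    (contents P φ idx) (rowMatrix ρ (τ'.symm.arrowCongr (Equiv.refl _) idx)).det
  have h3 : contents P φ idx ∘ (Equiv.sumCongr τ (Equiv.refl Q)) =
      contents P φ (τ'.symm.arrowCongr (Equiv.refl _) idx) := by
    funext h
    rcases h with b | q
    · simp [contents, τ', Equiv.prodCongrLeft]
    · simp [contents]
  rw [h3] at h2
  rw [← h2, AlgHom.map_det]
  rfl

end OrientForm

/-! ### Vanishing by the Casimir property and by the Jacobi identity. -/

section Vanishing

variable {n d : ℕ} {Q : Type*} {R : Type*} [CommRing R] [Algebra ℝ R] [Fintype Q] [DecidableEq Q]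
  [DiffRing d R] {P : Fin d → Fin d → R} {φ : Q → R} {ρ : Fin n × Fin 2 → SymbRow n Q d}

theorem adjugate_rowMatrix_mem {B B' : Fin n ⊕ Q} {e : Fin n × Fin 2}
    (hρ : ∀ e', e' ≠ e → ∀ b i, ρ e' b i ∈ (jointHom (d := d) B B').range)
    (idx : Fin n × Fin 2 → Fin d) (t : Fin n × Fin 2) :
    (rowMatrix ρ idx).adjugate t e ∈ (jointHom (d := d) B B').range := by
  rw [Matrix.adjugate_apply]
  refine det_mem _ fun e' t' => ?_
  by_cases h : e' = e
  · subst h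
    rw [Matrix.updateRow_self, Pi.single_apply]
    split_ifs
    · exact one_mem _
    · exact zero_mem _
  · rw [Matrix.updateRow_ne h]
    exact hρ _ h _ _

theorem adjugate_rowMatrix_update (e t : Fin n × Fin 2) (idx : Fin n × Fin 2 → Fin d) (k : Fin d) :
    (rowMatrix ρ (Function.update idx t k)).adjugate t e = (rowMatrix ρ idx).adjugate t e :=
  adjugate_eq_of_eq fun e' t' _ ht => by simp [rowMatrix, Function.update_of_ne ht]

theorem update_contents_congr {b : Fin n} {B' : Fin n ⊕ Q} {idx idx' : Fin n × Fin 2 → Fin d}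
    (h : ∀ a j, a ≠ b → Sum.inl a ≠ B' → idx (a, j) = idx' (a, j)) (r : R) :
    Function.update (Function.update (contents P φ idx) B' 1) (Sum.inl b) r =
      Function.update (Function.update (contents P φ idx') B' 1) (Sum.inl b) r := by
  funext g
  simp only [Function.update_apply]
  split_ifs with h1 h2
  · rfl
  · rfl
  · rcases g with a | q
    · have h3 : a ≠ b := fun e => h1 (congrArg _ e)
      simp only [contents, Sum.elim_inl, h a _ h3 h2]
    · rfl

/-- An edge between a Poisson bi-vector and its Casimir contributes zero, if all other arrows
see only their product. -/
theorem orientForm_eq_zero_of_casimir (hP : ∀ i j, P j i = -P i j) {b : Fin n} {q : Q}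
    (hφ : ∀ j, ∑ i, P i j * DiffRing.der i (φ q) = 0) {e : Fin n × Fin 2}
    (he : ρ e = edgeRow (Sum.inl b) (Sum.inr q))
    (hρ : ∀ e', e' ≠ e → ∀ b' i,
      ρ e' b' i ∈ (jointHom (d := d) (Sum.inl b : Fin n ⊕ Q) (Sum.inr q)).range) :
    orientForm P φ ρ = 0 := by
  have hbq : (Sum.inl b : Fin n ⊕ Q) ≠ Sum.inr q := Sum.inl_ne_inr
  have hdet : ∀ idx, jetEval (contents P φ idx) (rowMatrix ρ idx).det =
      ∑ j, jetEvalAt (Function.update (contents P φ idx) (Sum.inr q) 1) (Sum.inl b)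
        ((rowMatrix ρ idx).adjugate (b, j) e)
        (P (idx (b, 0)) (idx (b, 1)) * DiffRing.der (idx (b, j)) (φ q)) := by
    intro idx
    -- Expand along the row of the distinguished edge. Since a scalar issues no arrow, only the two
    -- columns of `b` survive.
    rw [Matrix.det_eq_sum_mul_adjugate_row _ e, map_sum, Fintype.sum_prod_type,
      Finset.sum_eq_single b]
    · refine Finset.sum_congr rfl fun j _ => ?_
      have h1 : rowMatrix ρ idx e (b, j) = X (Sum.inr q, idx (b, j)) := by
        simp [rowMatrix, he, edgeRow]
      rw [h1, jetEval_X_mul, jetEval_eq_of_mem_range hbq (adjugate_rowMatrix_mem hρ idx _),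
        Function.update_idem, Function.update_of_ne hbq, Function.update_self]
      rfl
    · intro b' _ hb'
      refine Finset.sum_eq_zero fun j _ => ?_
      have h1 : rowMatrix ρ idx e (b', j) = 0 := by
        simp [rowMatrix, he, edgeRow, hb']
      rw [h1, zero_mul, map_zero]
    · simp
  rw [orientForm]
  simp_rw [hdet]
  rw [Finset.sum_comm]
  refine Finset.sum_eq_zero fun j _ => ?_
  -- The cofactor omits the column `(b, j)`, and the content of `b` is overwritten by the product.
  -- So the index at `(b, j)` occurs only in that product, and summing over it gives the contraction
  -- of `P` with the differential of the Casimir.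
  refine sum_eq_zero_of_sum_update _ (b, j) fun idx => ?_
  have hT : ∀ k r, jetEvalAt (Function.update (contents P φ (Function.update idx (b, j) k))
      (Sum.inr q) 1) (Sum.inl b) ((rowMatrix ρ idx).adjugate (b, j) e) r =
      jetEvalAt (Function.update (contents P φ idx) (Sum.inr q) 1) (Sum.inl b)
        ((rowMatrix ρ idx).adjugate (b, j) e) r := by
    intro k r
    rw [jetEvalAt_apply, jetEvalAt_apply]
    rw [update_contents_congr (idx' := idx) fun a j' h1 _ => by
      rw [Function.update_of_ne fun h => h1 (congrArg Prod.fst h)]]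
  simp_rw [adjugate_rowMatrix_update, hT]
  rw [← map_sum]
  have h0 : ∑ k, P (Function.update idx (b, j) k (b, 0)) (Function.update idx (b, j) k (b, 1)) *
      DiffRing.der (Function.update idx (b, j) k (b, j)) (φ q) = 0 := by
    fin_cases j
    · simpa using hφ (idx (b, 1))
    · have := hφ (idx (b, 0))
      simp only [hP (idx (b, 0)), neg_mul, Finset.sum_neg_distrib, neg_eq_zero] at this ⊢
      simpa [hP (idx (b, 0))] using this
  rw [h0, map_zero]

/-- Outside row `e`, the columns of `b` and `b'` depend on their indices in the same way. A
permutation of these four slots therefore only permutes the columns of the cofactor, at the cost of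
its sign. It serves to move the tail of the distinguished edge to a fixed slot. -/
theorem sum_jetEvalAt_adjugate_comp {b b' : Fin n} {e : Fin n × Fin 2}
    (hρ : ∀ e', e' ≠ e → ρ e' b = ρ e' b') (σ : Equiv.Perm (Fin n × Fin 2))
    (hσ : ∀ t, t.1 ≠ b → t.1 ≠ b' → σ t = t)
    (W : (Fin n × Fin 2 → Fin d) → R) (t : Fin n × Fin 2) :
    ∑ idx, jetEvalAt (Function.update (contents P φ idx) (Sum.inl b') 1) (Sum.inl b)
        ((rowMatrix ρ idx).adjugate t e) (W idx) =
      ((Equiv.Perm.sign σ : ℤ) : ℝ) •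
        ∑ idx, jetEvalAt (Function.update (contents P φ idx) (Sum.inl b') 1) (Sum.inl b)
          ((rowMatrix ρ idx).adjugate (σ t) e) (W (idx ∘ σ)) := by
  rw [Finset.smul_sum]
  symm
  refine Fintype.sum_equiv (σ.symm.arrowCongr (Equiv.refl _)) _ _ fun idx => ?_
  have h0 : σ.symm.arrowCongr (Equiv.refl _) idx = idx ∘ σ := rfl
  rw [h0]
  have hσ' : ∀ t, (σ t).1 = t.1 ∨ ((σ t).1 = b ∨ (σ t).1 = b') ∧ (t.1 = b ∨ t.1 = b') := by
    intro t
    by_cases h1 : t.1 = b ∨ t.1 = b'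
    · by_cases h2 : (σ t).1 = b ∨ (σ t).1 = b'
      · exact Or.inr ⟨h2, h1⟩
      · push Not at h2
        left
        rw [σ.injective (hσ _ h2.1 h2.2)]
    · push Not at h1
      left
      rw [hσ t h1.1 h1.2]
  have hentry : ∀ e' t', e' ≠ e → ρ e' t'.1 = ρ e' (σ t').1 := by
    intro e' t' he'
    rcases hσ' t' with h | ⟨h1, h2⟩
    · rw [h]
    · rcases h1 with h1 | h1 <;> rcases h2 with h2 | h2 <;> rw [h1, h2] <;>
        first | exact hρ e' he' | exact (hρ e' he').symm
  have hadj : (rowMatrix ρ (idx ∘ σ)).adjugate t e =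
      ((Equiv.Perm.sign σ : ℤ) : ℝ) • (rowMatrix ρ idx).adjugate (σ t) e := by
    have h1 : (rowMatrix ρ (idx ∘ σ)).updateRow e (Pi.single t 1) =
        ((rowMatrix ρ idx).updateRow e (Pi.single (σ t) 1)).submatrix id σ := by
      ext1 e' t'
      by_cases he' : e' = e
      · subst he'; simp [Pi.single_apply]
      · rw [Matrix.updateRow_ne he', Matrix.submatrix_apply, id, Matrix.updateRow_ne he']
        simp [rowMatrix, hentry e' t' he']
    rw [Matrix.adjugate_apply, h1, Matrix.det_permute', Matrix.adjugate_apply,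
      Int.cast_smul_eq_zsmul, zsmul_eq_mul]
  rw [hadj, jetEvalAt_apply, jetEvalAt_apply, map_smul]
  rw [update_contents_congr (idx := idx ∘ σ) (idx' := idx) fun a j h1 h2 => by
    rw [Function.comp_apply, hσ (a, j) h1 fun h => h2 (congrArg _ h)]]

set_option maxHeartbeats 400000 in
/-- An edge between two copies of a Poisson bi-vector contributes zero, if all other arrows see
only their product: this is the Jacobi identity. -/
theorem orientForm_eq_zero_of_jacobi (hP : ∀ i j, P j i = -P i j)
    (hJ : ∀ i j l, ∑ k, (P k i * DiffRing.der k (P j l) + P k j * DiffRing.der k (P l i) +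
      P k l * DiffRing.der k (P i j)) = 0)
    {b b' : Fin n} (hb : b ≠ b') {e : Fin n × Fin 2}
    (he : ρ e = edgeRow (Sum.inl b) (Sum.inl b'))
    (hρ : ∀ e', e' ≠ e → ∀ c i,
      ρ e' c i ∈ (jointHom (d := d) (Sum.inl b : Fin n ⊕ Q) (Sum.inl b')).range)
    (hρ' : ∀ e', e' ≠ e → ρ e' b = ρ e' b') :
    orientForm P φ ρ = 0 := by
  have hbb : (Sum.inl b : Fin n ⊕ Q) ≠ Sum.inl b' := fun h => hb (Sum.inl_injective h)
  let L := fun (idx : Fin n × Fin 2 → Fin d) (t : Fin n × Fin 2) =>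
    jetEvalAt (Function.update (contents P φ idx) (Sum.inl b') 1) (Sum.inl b)
        ((rowMatrix ρ idx).adjugate t e)
  let W : (Fin n × Fin 2 → Fin d) → R := fun idx =>
    P (idx (b, 0)) (idx (b, 1)) * DiffRing.der (idx (b, 0)) (P (idx (b', 0)) (idx (b', 1)))
  -- The edge leaves one of the four slots of `b` and `b'` and differentiates the other bi-vector;
  -- the remaining arrows act through `L` on the product.
  have hdet : ∀ idx, jetEval (contents P φ idx) (rowMatrix ρ idx).det =
      (∑ j, L idx (b, j) (P (idx (b, 0)) (idx (b, 1)) *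
        DiffRing.der (idx (b, j)) (P (idx (b', 0)) (idx (b', 1))))) +
      ∑ j, L idx (b', j) (DiffRing.der (idx (b', j)) (P (idx (b, 0)) (idx (b, 1))) *
        P (idx (b', 0)) (idx (b', 1))) := by
    intro idx
    rw [Matrix.det_eq_sum_mul_adjugate_row _ e, map_sum, Fintype.sum_prod_type,
      ← Finset.add_sum_erase _ _ (Finset.mem_univ b),
      ← Finset.add_sum_erase _ _ (Finset.mem_erase.2 ⟨hb.symm, Finset.mem_univ b'⟩), ← add_assoc]
    have h3 : ∀ c ∈ (Finset.univ.erase b).erase b', ∑ j, (jetEval (contents P φ idx))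
        (rowMatrix ρ idx e (c, j) * (rowMatrix ρ idx).adjugate (c, j) e) = 0 := by
      intro c hc
      simp only [Finset.mem_erase] at hc
      refine Finset.sum_eq_zero fun j _ => ?_
      have h1 : rowMatrix ρ idx e (c, j) = 0 := by
        simp [rowMatrix, he, edgeRow, hc.1, hc.2.1]
      rw [h1, zero_mul, map_zero]
    rw [Finset.sum_eq_zero h3, add_zero]
    congr 1
    · refine Finset.sum_congr rfl fun j _ => ?_
      have h1 : rowMatrix ρ idx e (b, j) = X (Sum.inl b', idx (b, j)) := by
        simp [rowMatrix, he, edgeRow, hb]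
      rw [h1, jetEval_X_mul, jetEval_eq_of_mem_range hbb (adjugate_rowMatrix_mem hρ idx _),
        Function.update_idem, Function.update_of_ne hbb, Function.update_self]
      rfl
    · refine Finset.sum_congr rfl fun j _ => ?_
      have h1 : rowMatrix ρ idx e (b', j) = X (Sum.inl b, idx (b', j)) := by
        simp [rowMatrix, he, edgeRow, hb.symm]
      rw [h1, jetEval_X_mul, jetEval_eq_of_mem_range hbb (adjugate_rowMatrix_mem hρ idx _),
        Function.update_self, Function.update_of_ne hbb.symm, Function.update_comm hbb,
        jetEvalAt_apply, Function.update_idem]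
      rfl
  have hfix : ∀ j j' k k' : Fin 2, ∀ c c' a a' : Fin n, (c = b ∨ c = b') → (c' = b ∨ c' = b') →
      (a = b ∨ a = b') → (a' = b ∨ a' = b') → ∀ t : Fin n × Fin 2, t.1 ≠ b → t.1 ≠ b' →
      (Equiv.swap (c, j) (c', j') * Equiv.swap (a, k) (a', k')) t = t := by
    intro j j' k k' c c' a a' hc hc' ha ha' t h1 h2
    have h3 : ∀ (c : Fin n) (j : Fin 2), (c = b ∨ c = b') → t ≠ (c, j) := by
      rintro c j (rfl | rfl) rfl
      · exact h1 rfl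
      · exact h2 rfl
    rw [Equiv.Perm.mul_apply, Equiv.swap_apply_of_ne_of_ne (h3 _ _ ha) (h3 _ _ ha'),
      Equiv.swap_apply_of_ne_of_ne (h3 _ _ hc) (h3 _ _ hc')]
  have hs2 : ∀ {x y z w : Fin n × Fin 2}, x ≠ y → z ≠ w →
      Equiv.Perm.sign (Equiv.swap x y * Equiv.swap z w) = 1 := by
    intro x y z w h1 h2
    rw [Equiv.Perm.sign_mul, Equiv.Perm.sign_swap h1, Equiv.Perm.sign_swap h2]; rfl
  -- Exchanging the slots of `b` is odd, which cancels against the antisymmetry of `P`.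
  have t00 : ∑ idx, L idx (b, 1) (P (idx (b, 0)) (idx (b, 1)) *
        DiffRing.der (idx (b, 1)) (P (idx (b', 0)) (idx (b', 1)))) =
      ∑ idx, L idx (b, 0) (W idx) := by
    have h := sum_jetEvalAt_adjugate_comp (P := P) (φ := φ) (e := e) hρ'
      (Equiv.swap (b, 0) (b, 1)) (fun t h1 _ => Equiv.swap_apply_of_ne_of_ne
        (fun h => h1 (by rw [h])) (fun h => h1 (by rw [h])))
      (fun idx => P (idx (b, 0)) (idx (b, 1)) *
        DiffRing.der (idx (b, 1)) (P (idx (b', 0)) (idx (b', 1)))) (b, 1)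
    rw [h, Equiv.Perm.sign_swap (by simp), Finset.smul_sum]
    refine Finset.sum_congr rfl fun idx _ => ?_
    have e1 : Equiv.swap (b, (0 : Fin 2)) (b, 1) (b', 0) = (b', 0) :=
      Equiv.swap_apply_of_ne_of_ne (by simp [hb.symm]) (by simp [hb.symm])
    have e2 : Equiv.swap (b, (0 : Fin 2)) (b, 1) (b', 1) = (b', 1) :=
      Equiv.swap_apply_of_ne_of_ne (by simp [hb.symm]) (by simp [hb.symm])
    simp only [Function.comp, Equiv.swap_apply_left, Equiv.swap_apply_right, e1, e2]
    rw [hP (idx (b, 0)) (idx (b, 1)), neg_mul, map_neg]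
    simp [L, W]
  -- Exchanging the two bi-vectors is a product of two transpositions, hence even.
  have t10 : ∑ idx, L idx (b', 0) (DiffRing.der (idx (b', 0)) (P (idx (b, 0)) (idx (b, 1))) *
        P (idx (b', 0)) (idx (b', 1))) = ∑ idx, L idx (b, 0) (W idx) := by
    have h := sum_jetEvalAt_adjugate_comp (P := P) (φ := φ) (e := e) hρ'
      (Equiv.swap (b, 0) (b', 0) * Equiv.swap (b, 1) (b', 1))
      (hfix _ _ _ _ _ _ _ _ (Or.inl rfl) (Or.inr rfl) (Or.inl rfl) (Or.inr rfl))
      (fun idx => DiffRing.der (idx (b', 0)) (P (idx (b, 0)) (idx (b, 1))) *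
        P (idx (b', 0)) (idx (b', 1))) (b', 0)
    rw [h, hs2 (by simp [hb]) (by simp [hb])]
    simp only [Units.val_one, Int.cast_one, one_smul]
    refine Finset.sum_congr rfl fun idx _ => ?_
    simp [Equiv.swap_apply_def, L, W, hb, hb.symm, mul_comm]
  have t11 : ∑ idx, L idx (b', 1) (DiffRing.der (idx (b', 1)) (P (idx (b, 0)) (idx (b, 1))) *
        P (idx (b', 0)) (idx (b', 1))) = ∑ idx, L idx (b, 0) (W idx) := by
    have h := sum_jetEvalAt_adjugate_comp (P := P) (φ := φ) (e := e) hρ'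
      (Equiv.swap (b, 0) (b', 1) * Equiv.swap (b, 1) (b', 0))
      (hfix _ _ _ _ _ _ _ _ (Or.inl rfl) (Or.inr rfl) (Or.inl rfl) (Or.inr rfl))
      (fun idx => DiffRing.der (idx (b', 1)) (P (idx (b, 0)) (idx (b, 1))) *
        P (idx (b', 0)) (idx (b', 1))) (b', 1)
    rw [h, hs2 (by simp [hb]) (by simp [hb])]
    simp only [Units.val_one, Int.cast_one, one_smul]
    refine Finset.sum_congr rfl fun idx _ => ?_
    have e1 : P (idx (b', 1)) (idx (b', 0)) = -P (idx (b', 0)) (idx (b', 1)) := hP _ _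
    have e2 : P (idx (b, 1)) (idx (b, 0)) = -P (idx (b, 0)) (idx (b, 1)) := hP _ _
    simp [Equiv.swap_apply_def, L, W, hb, hb.symm, e1, e2, mul_comm]
  have hW : ∑ idx, L idx (b, 0) (W idx) = 0 := by
    -- The even 3-cycle of the slots left free when the edge occupies `(b, 0)`. It generates the
    -- three cyclic terms of the Jacobiator.
    let c : Equiv.Perm (Fin n × Fin 2) :=
      Equiv.swap (b, 1) (b', 0) * Equiv.swap (b', 0) (b', 1)
    have hc : Equiv.Perm.sign c = 1 := hs2 (by simp [hb]) (by simp)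
    have hcyc : ∀ W' : (Fin n × Fin 2 → Fin d) → R, ∑ idx, L idx (b, 0) (W' idx) =
        ∑ idx, L idx (b, 0) (W' (idx ∘ c)) := by
      intro W'
      have h := sum_jetEvalAt_adjugate_comp (P := P) (φ := φ) (e := e) hρ' c
        (hfix _ _ _ _ _ _ _ _ (Or.inl rfl) (Or.inr rfl) (Or.inr rfl) (Or.inr rfl)) W' (b, 0)
      have e1 : c (b, 0) = (b, 0) := by
        simp [c, Equiv.swap_apply_def, hb]
      rw [hc, e1] at h
      simpa only [Units.val_one, Int.cast_one, one_smul] using h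
    have h1 := hcyc W
    have h2 : ∑ idx, L idx (b, 0) (W (idx ∘ c)) = ∑ idx, L idx (b, 0) (W ((idx ∘ c) ∘ c)) :=
      hcyc fun idx => W (idx ∘ c)
    have h3 : ∑ idx, L idx (b, 0) (W idx + W (idx ∘ c) + W ((idx ∘ c) ∘ c)) = 0 := by
      refine sum_eq_zero_of_sum_update _ (b, 0) fun idx => ?_
      have hT : ∀ k, L (Function.update idx (b, 0) k) (b, 0) = L idx (b, 0) := by
        intro k
        refine LinearMap.ext fun r => ?_
        simp only [L, adjugate_rowMatrix_update, jetEvalAt_apply]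
        rw [update_contents_congr (idx' := idx) fun a j h1 _ => by
          rw [Function.update_of_ne fun h => h1 (congrArg Prod.fst h)]]
      simp_rw [hT]
      rw [← map_sum]
      have h0 := hJ (idx (b, 1)) (idx (b', 0)) (idx (b', 1))
      rw [← map_zero (L idx (b, 0)), ← h0]
      congr 1
      refine Finset.sum_congr rfl fun k _ => ?_
      simp [W, c, Equiv.swap_apply_def, hb, hb.symm]
    simp only [map_add, Finset.sum_add_distrib] at h3
    rw [← h2, ← h1] at h3
    -- The three rotated sums are equal, and together they contain the Jacobiator.
    have h5 : (3 : ℝ) • ∑ idx, L idx (b, 0) (W idx) = 0 := by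
      rw [← h3, show (3 : ℝ) = 1 + 1 + 1 by norm_num, add_smul, add_smul, one_smul]
    exact (smul_eq_zero.1 h5).resolve_left (by norm_num)
  rw [orientForm]
  simp_rw [hdet, Fin.sum_univ_two, Finset.sum_add_distrib]
  rw [t00, t10, t11]
  change ∑ idx, L idx (b, 0) (W idx) + _ + _ = _
  rw [hW]; simp

end Vanishing

/-! ### Lists of arrows -/

section Lists

variable {n d : ℕ} {Q : Type*} {R : Type*} [CommRing R] [Algebra ℝ R] [Fintype Q] [DecidableEq Q]
  [DiffRing d R]

/-- The arrows of an ordered list, indexed by the slots in lexicographic order. -/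
def listRows (l : List (SymbRow n Q d)) (e : Fin n × Fin 2) : SymbRow n Q d :=
  l.getD (finProdFinEquiv e : Fin (n * 2)) 0

/-- The zero row is a mere placeholder: in this form, linearity in one entry of the list is
linearity of the determinant in one row. -/
theorem listRows_append_cons (l l' : List (SymbRow n Q d)) (r : SymbRow n Q d)
    (h : l.length < n * 2) : listRows (l ++ r :: l') =
      Function.update (listRows (l ++ 0 :: l')) (finProdFinEquiv.symm ⟨l.length, h⟩) r := by
  funext e
  by_cases he : e = finProdFinEquiv.symm ⟨l.length, h⟩
  · subst he
    rw [Function.update_self, listRows, Equiv.apply_symm_apply]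
    simp
  · rw [Function.update_of_ne he]
    have h1 : ((finProdFinEquiv e : Fin (n * 2)) : ℕ) ≠ l.length := by
      intro h2
      apply he
      rw [Equiv.eq_symm_apply]
      exact Fin.ext h2
    simp only [listRows, List.getD_eq_getElem?_getD, List.getElem?_append]
    split_ifs with h2
    · rfl
    · obtain ⟨m, hm⟩ : ∃ m, ((finProdFinEquiv e : Fin (n * 2)) : ℕ) - l.length = m + 1 :=
        ⟨(finProdFinEquiv e : Fin (n * 2)) - l.length - 1, by omega⟩
      rw [hm, List.getElem?_cons_succ, List.getElem?_cons_succ]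

theorem listRows_swap (l l' : List (SymbRow n Q d)) (r r' : SymbRow n Q d)
    (h : l.length + 1 < n * 2) : listRows (l ++ r' :: r :: l') = listRows (l ++ r :: r' :: l') ∘
      Equiv.swap (finProdFinEquiv.symm ⟨l.length, by omega⟩)
        (finProdFinEquiv.symm ⟨l.length + 1, h⟩) := by
  funext e
  obtain ⟨k, rfl⟩ := finProdFinEquiv.symm.surjective e
  have hsw : Equiv.swap (finProdFinEquiv.symm (⟨l.length, by omega⟩ : Fin (n * 2)))
      (finProdFinEquiv.symm ⟨l.length + 1, h⟩) (finProdFinEquiv.symm k) =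
      finProdFinEquiv.symm (Equiv.swap ⟨l.length, by omega⟩ ⟨l.length + 1, h⟩ k) := by
    simp only [Equiv.swap_apply_def, EmbeddingLike.apply_eq_iff_eq]
    split_ifs <;> rfl
  rw [Function.comp_apply, hsw]
  simp only [listRows, Equiv.apply_symm_apply]
  by_cases h1 : k = ⟨l.length, by omega⟩
  · subst h1; simp
  · by_cases h2 : k = ⟨l.length + 1, h⟩
    · subst h2; simp
    · rw [Equiv.swap_apply_of_ne_of_ne h1 h2]
      simp only [List.getD_eq_getElem?_getD, List.getElem?_append]
      split_ifs with h3
      · rfl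
      · have h1' : (k : ℕ) ≠ l.length := fun e => h1 (Fin.ext e)
        have h2' : (k : ℕ) ≠ l.length + 1 := fun e => h2 (Fin.ext e)
        obtain ⟨m, hm⟩ : ∃ m, (k : ℕ) - l.length = m + 2 := ⟨k - l.length - 2, by omega⟩
        rw [hm, List.getElem?_cons_succ, List.getElem?_cons_succ, List.getElem?_cons_succ,
          List.getElem?_cons_succ]

variable (P : Fin d → Fin d → R) (φ : Q → R)

/-- The value of the orientation morphism on an ordered list of arrows. -/
def orientList (l : List (SymbRow n Q d)) : R := orientForm P φ (listRows l)

theorem map_orientList {R' : Type*} [CommRing R'] [Algebra ℝ R'] [DiffRing d R'] (f : R →ₐ[ℝ] R')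
    (hf : ∀ (i : Fin d) r, f (DiffRing.der i r) = DiffRing.der i (f r))
    (l : List (SymbRow n Q d)) :
    f (orientList P φ l) = orientList (fun i j => f (P i j)) (f ∘ φ) l :=
  map_orientForm P φ f hf _

/-- The orientation morphism is linear in each arrow. -/
def orientListAt (l l' : List (SymbRow n Q d)) (h : l.length < n * 2) :
    SymbRow n Q d →ₗ[ℝ] R where
  toFun r := orientList P φ (l ++ r :: l')
  map_add' r r' := by
    change orientForm P φ _ = orientForm P φ _ + orientForm P φ _
    rw [listRows_append_cons l l' _ h, listRows_append_cons l l' r h,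
      listRows_append_cons l l' r' h, orientForm_update_add]
  map_smul' c r := by
    change orientForm P φ _ = c • orientForm P φ _
    rw [listRows_append_cons l l' _ h, listRows_append_cons l l' r h, orientForm_update_smul]

theorem orientListAt_apply (l l' : List (SymbRow n Q d)) (h : l.length < n * 2)
    (r : SymbRow n Q d) : orientListAt P φ l l' h r = orientList P φ (l ++ r :: l') := rfl

theorem orientList_swap (l l' : List (SymbRow n Q d)) (r r' : SymbRow n Q d)
    (h : l.length + 1 < n * 2) :
    orientList P φ (l ++ r' :: r :: l') = -orientList P φ (l ++ r :: r' :: l') := by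
  rw [orientList, listRows_swap l l' r r' h, orientForm_comp_perm, Equiv.Perm.sign_swap]
  · simp [orientList]
  · exact finProdFinEquiv.symm.injective.ne (by simp)

theorem orientList_move (l l' : List (SymbRow n Q d)) (r : SymbRow n Q d)
    (h : l.length + l'.length < n * 2) :
    orientList P φ (l ++ r :: l') = (-1) ^ l'.length * orientList P φ (l ++ l' ++ [r]) := by
  induction l' generalizing l with
  | nil => simp
  | cons x l' ih =>
    have h1 := ih (l ++ [x]) (by simp at h ⊢; omega)
    simp only [List.append_assoc, List.cons_append, List.nil_append] at h1 ⊢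
    rw [orientList_swap P φ l l' x r (by simp at h; omega), h1, List.length_cons, pow_succ]
    ring

/-- Each of the two arrows passes `l.length + 1` others, so the total number of transpositions is
even. -/
theorem orientList_move_two (l : List (SymbRow n Q d)) (r r' : SymbRow n Q d)
    (h : l.length + 1 < n * 2) :
    orientList P φ (r :: r' :: l) = orientList P φ (l ++ [r, r']) := by
  have h1 := orientList_move P φ [] (r' :: l) r (by simp; omega)
  have h2 := orientList_move P φ [] (l ++ [r]) r' (by simp; omega)
  simp only [List.nil_append, List.cons_append, List.append_assoc, List.length_cons,
    List.length_append, List.length_nil] at h1 h2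
  rw [h1, h2, ← mul_assoc, ← pow_add]
  rw [show l.length + 1 + (l.length + (0 + 1)) = 2 * (l.length + 1) by ring, pow_mul]
  simp

theorem orientList_permRow (τ : Equiv.Perm (Fin n)) (l : List (SymbRow n Q d)) :
    orientList P φ (l.map (permRow τ)) = orientList P φ l := by
  rw [orientList, orientList, ← orientForm_permRow P φ τ (listRows l)]
  congr 1
  funext e
  have h0 : permRow τ (0 : SymbRow n Q d) = 0 := by
    funext b i; simp [permRow]
  have h1 := List.getD_map (l := l) (d := 0) (n := (finProdFinEquiv e : Fin (n * 2))) (permRow τ)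
  rw [h0] at h1
  exact h1

/-- The arrow to the scalar evaluates to its differential. -/
theorem orientForm_scalarRow (a : R) (e : Fin n × Fin 2) (ρ : Fin n × Fin 2 → SymbRow n Empty d)
    (ρ' : Fin n × Fin 2 → SymbRow n Unit d)
    (hρ : ∀ e', e' ≠ e → ∀ b i,
      ρ' e' b i = rename (Prod.map (Sum.map id Empty.elim) id) (ρ e' b i))
    (he : ρ' e = scalarRow ()) :
    orientForm P (fun _ => a) ρ' = ∑ i, DiffRing.der i a *
      orientForm P Empty.elim (Function.update ρ e (constRow (Pi.single i 1))) := by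
  let ι : Fin n ⊕ Empty → Fin n ⊕ Unit := Sum.map id Empty.elim
  have hι : Function.Injective ι := by
    rintro (x | x) (y | y) h
    · simpa [ι] using h
    · exact y.elim
    · exact x.elim
    · exact x.elim
  have hq : ∀ h, h ∈ Set.range ι ↔ h ≠ Sum.inr () := by
    rintro (x | x)
    · exact iff_of_true ⟨Sum.inl x, rfl⟩ Sum.inl_ne_inr
    · simp [ι]
  simp only [orientForm, Finset.mul_sum]
  rw [Finset.sum_comm]
  refine Finset.sum_congr rfl fun idx _ => ?_
  -- The row of the scalar is a combination of constant rows with coefficients `X (Sum.inr (), i)`,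
  -- and the determinant is linear in it.
  have hdet : (rowMatrix ρ' idx).det = ∑ i, X (Sum.inr (), i) * rename (Prod.map ι id)
      (rowMatrix (Function.update ρ e (constRow (Pi.single i 1))) idx).det := by
    have h1 : ∀ i, rename (Prod.map ι id)
        (rowMatrix (Function.update ρ e (constRow (Pi.single i 1))) idx).det =
        ((rowMatrix ρ' idx).updateRow e fun t => C ((Pi.single i 1 : Fin d → ℝ) (idx t))).det := by
      intro i
      rw [AlgHom.map_det]
      congr 1
      ext1 e' t
      by_cases h : e' = e
      · subst h; simp [rowMatrix, constRow]
      · rw [Matrix.updateRow_ne h]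
        simp [rowMatrix, h, hρ e' h, ι]
    simp_rw [h1, ← Matrix.det_updateRow_smul]
    have h2 := Matrix.detRowAlternating (R := Symb (Fin n ⊕ Unit) d) (n := Fin n × Fin 2)
      |>.map_update_sum Finset.univ e
        (fun i : Fin d => (X (Sum.inr (), i) : Symb (Fin n ⊕ Unit) d) •
          fun t => (C ((Pi.single i 1 : Fin d → ℝ) (idx t)) : Symb (Fin n ⊕ Unit) d))
        (rowMatrix ρ' idx)
    have h3 : (∑ i : Fin d, (X (Sum.inr (), i) : Symb (Fin n ⊕ Unit) d) •
        fun t => (C ((Pi.single i 1 : Fin d → ℝ) (idx t)) : Symb (Fin n ⊕ Unit) d)) =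
        rowMatrix ρ' idx e := by
      funext t
      simp [rowMatrix, he, scalarRow, Pi.single_apply, apply_ite]
    refine Eq.trans ?_ h2
    rw [h3]
    exact congrArg _ (Function.update_eq_self e _).symm
  rw [hdet, map_sum]
  refine Finset.sum_congr rfl fun i _ => ?_
  -- No other arrow heads to the scalar, so its derivative comes out as a factor.
  rw [jetEval_X_mul, jetEval_rename_of_injective hι hq, Function.update_self, mul_comm]
  congr 2
  congr 1
  funext h
  rcases h with b | q
  · exact Function.update_of_ne Sum.inl_ne_inr _ _
  · exact q.elim

/-- A bi-vector that is joined to the graph by a single edge, and to the sink. -/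
theorem orientForm_last (ξ : Fin d → ℝ) (ρ : Fin n × Fin 2 → SymbRow n Q d)
    (ρ' : Fin (n + 1) × Fin 2 → SymbRow (n + 1) Q d)
    (h1 : ∀ b j c i, ρ' (Fin.castSucc b, j) (Fin.castSucc c) i =
      rename (Prod.map (Sum.map Fin.castSucc id) id) (ρ (b, j) c i))
    (h2 : ∀ b j i, ρ' (Fin.castSucc b, j) (Fin.last n) i = 0)
    (h3 : ρ' (Fin.last n, 0) = constRow ξ)
    (h4 : ∀ i, ρ' (Fin.last n, 1) (Fin.last n) i = ∑ h, X (Sum.map Fin.castSucc id h, i)) :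
    orientForm P φ ρ' =
      ∑ i, ∑ j, P i j * (ξ i • DiffRing.der j (orientForm P φ ρ) -
        ξ j • DiffRing.der i (orientForm P φ ρ)) := by
  let ι : Fin n ⊕ Q → Fin (n + 1) ⊕ Q := Sum.map Fin.castSucc id
  have hι : Function.Injective ι :=
    Sum.map_injective.2 ⟨Fin.castSucc_injective n, Function.injective_id⟩
  have hq : ∀ h, h ∈ Set.range ι ↔ h ≠ Sum.inl (Fin.last n) := by
    rintro (x | x)
    · induction x using Fin.lastCases with
      | last => simp [ι, Fin.castSucc_ne_last]
      | cast x => exact iff_of_true ⟨Sum.inl x, rfl⟩ (by simp [Fin.castSucc_ne_last])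
    · exact iff_of_true ⟨Sum.inr x, rfl⟩ Sum.inr_ne_inl
  let κ : (Fin n × Fin 2) ⊕ Fin 2 → Fin (n + 1) × Fin 2 :=
    Sum.elim (fun t => (Fin.castSucc t.1, t.2)) (fun j => (Fin.last n, j))
  have hκ : Function.Bijective κ := by
    constructor
    · rintro (⟨x, j⟩ | j) (⟨y, k⟩ | k) h <;>
        simp_all [κ, Fin.castSucc_ne_last, (Fin.castSucc_ne_last _).symm]
    · rintro ⟨x, j⟩
      induction x using Fin.lastCases with
      | last => exact ⟨Sum.inr j, rfl⟩
      | cast x => exact ⟨Sum.inl (x, j), rfl⟩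
  let K : (Fin n × Fin 2) ⊕ Fin 2 ≃ Fin (n + 1) × Fin 2 := Equiv.ofBijective κ hκ
  have hdet : ∀ idx, (rowMatrix ρ' idx).det =
      rename (Prod.map ι id) (rowMatrix ρ (fun t => idx (K (Sum.inl t)))).det *
        (C (ξ (idx (Fin.last n, 0))) * (∑ h, X (ι h, idx (Fin.last n, 1))) -
          C (ξ (idx (Fin.last n, 1))) * (∑ h, X (ι h, idx (Fin.last n, 0)))) := by
    intro idx
    -- None of the earlier arrows can leave the last bi-vector, so the last two both must. The
    -- matrix is block triangular, with a 2 by 2 block for this bi-vector.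
    rw [← Matrix.det_submatrix_equiv_self K, ← Matrix.fromBlocks_toBlocks
      ((rowMatrix ρ' idx).submatrix K K)]
    have hz : ((rowMatrix ρ' idx).submatrix K K).toBlocks₁₂ = 0 := by
      ext1 ⟨b, j⟩ k
      exact h2 _ _ _
    rw [hz, Matrix.det_fromBlocks_zero₁₂, AlgHom.map_det, Matrix.det_fin_two]
    congr 1
    · congr 1
      ext1 ⟨b, j⟩ ⟨c, k⟩
      exact h1 _ _ _ _
    · have e1 : ∀ k, ((rowMatrix ρ' idx).submatrix K K).toBlocks₂₂ 0 k =
          C (ξ (idx (Fin.last n, k))) := by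
        intro k
        change ρ' (Fin.last n, 0) (Fin.last n) (idx (Fin.last n, k)) = _
        rw [h3]; rfl
      have e2 : ∀ k, ((rowMatrix ρ' idx).submatrix K K).toBlocks₂₂ 1 k =
          ∑ h, X (ι h, idx (Fin.last n, k)) := fun k => h4 _
      rw [e1, e1, e2, e2]
  have hval : ∀ idx, jetEval (contents P φ idx) (rowMatrix ρ' idx).det =
      P (idx (Fin.last n, 0)) (idx (Fin.last n, 1)) *
        (ξ (idx (Fin.last n, 0)) • DiffRing.der (idx (Fin.last n, 1))
          (jetEval (contents P φ fun t => idx (K (Sum.inl t)))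
            (rowMatrix ρ (fun t => idx (K (Sum.inl t)))).det) -
        ξ (idx (Fin.last n, 1)) • DiffRing.der (idx (Fin.last n, 0))
          (jetEval (contents P φ fun t => idx (K (Sum.inl t)))
            (rowMatrix ρ (fun t => idx (K (Sum.inl t)))).det)) := by
    intro idx
    have e0 : ∀ i, ∑ h, (X (ι h, i) : Symb (Fin (n + 1) ⊕ Q) d) =
        rename (Prod.map ι id) (∑ h, X (h, i)) := by
      intro i; simp
    have e3 : contents P φ idx ∘ ι = contents P φ fun t => idx (K (Sum.inl t)) := by
      funext h
      rcases h with b | q <;> rfl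
    -- The sum of the variables over all holders is the symbol of the derivative of the whole
    -- remaining expression, by `der_jetEval`.
    rw [hdet, mul_sub, mul_left_comm, mul_left_comm _ (C _), ← smul_eq_C_mul, ← smul_eq_C_mul,
      map_sub, map_smul, map_smul, e0, e0, ← map_mul, ← map_mul,
      jetEval_rename_of_injective hι hq, jetEval_rename_of_injective hι hq, e3, mul_comm _ (∑ h, _),
      ← der_jetEval, mul_comm _ (∑ h, _), ← der_jetEval]
    rw [← smul_mul_assoc, ← smul_mul_assoc, ← sub_mul, mul_comm]
    rfl
  rw [orientForm]
  simp_rw [hval]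
  rw [← (K.symm.arrowCongr (Equiv.refl (Fin d))).symm.sum_comp]
  simp only [Equiv.arrowCongr, Equiv.symm_symm, Equiv.coe_fn_symm_mk, Equiv.coe_refl,
    Function.comp_def]
  rw [← (Equiv.sumArrowEquivProdArrow _ _ _).symm.sum_comp, Fintype.sum_prod_type, Finset.sum_comm,
    ← (finTwoArrowEquiv _).symm.sum_comp, Fintype.sum_prod_type]
  refine Finset.sum_congr rfl fun i _ => Finset.sum_congr rfl fun j _ => ?_
  have e0 : K.symm (Fin.last n, 0) = Sum.inr 0 := K.symm_apply_eq.2 rfl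
  have e1 : K.symm (Fin.last n, 1) = Sum.inr 1 := K.symm_apply_eq.2 rfl
  simp only [Equiv.refl_symm, Equiv.coe_refl, id, e0, e1, Equiv.symm_apply_apply, orientForm,
    map_sum, Finset.smul_sum, ← Finset.sum_sub_distrib, Finset.mul_sum]
  rfl

end Lists

/-! ### Graphs with one Casimir -/

section Graphs

variable {n d N : ℕ} {Q : Type*} {R : Type*} [CommRing R] [Algebra ℝ R] [Fintype Q]
  [DecidableEq Q] [DiffRing d R]

/-- The arrows of the edges of a graph, with vertices in the roles `W`. -/
def graphRows (W : Fin N → Fin n ⊕ Q) (E : OrderedGraph N) : List (SymbRow n Q d) :=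
  E.map fun e => edgeRow (W e.1) (W e.2)

/-- The vertex `u` carries the Casimir, all other vertices carry the bi-vector. -/
def roleEquiv (u : Fin (n + 1)) : Fin (n + 1) ≃ Fin n ⊕ Unit :=
  (finSuccEquiv' u).trans (Equiv.optionEquivSumPUnit (Fin n))

@[simp] theorem roleEquiv_self (u : Fin (n + 1)) : roleEquiv u u = Sum.inr () := by
  simp [roleEquiv]

@[simp] theorem roleEquiv_succAbove (u : Fin (n + 1)) (b : Fin n) :
    roleEquiv u (u.succAbove b) = Sum.inl b := by
  simp [roleEquiv]

theorem roleEquiv_castSucc_castSucc (v w : Fin (n + 1)) :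
    roleEquiv v.castSucc w.castSucc = Sum.map Fin.castSucc id (roleEquiv v w) := by
  rcases Fin.eq_self_or_eq_succAbove v w with rfl | ⟨b, rfl⟩
  · simp
  · rw [← Fin.castSucc_succAbove_castSucc, roleEquiv_succAbove, roleEquiv_succAbove]
    rfl

theorem roleEquiv_castSucc_last (v : Fin (n + 1)) :
    roleEquiv v.castSucc (Fin.last (n + 1)) = Sum.inl (Fin.last n) := by
  have h : v.castSucc.succAbove (Fin.last n) = Fin.last (n + 1) := by
    rw [Fin.succAbove_of_le_castSucc _ _ (Fin.castSucc_le_castSucc_iff.2 (Fin.le_last v)),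
      Fin.succ_last]
  rw [← h, roleEquiv_succAbove]

theorem roleEquiv_last_castSucc (w : Fin n) :
    roleEquiv (Fin.last n) w.castSucc = Sum.inl w := by
  rw [← Fin.succAbove_last_apply, roleEquiv_succAbove]

variable (P : Fin d → Fin d → R) (a : R) (ξ : Fin d → ℝ)

/-- The sum over all ways to put the Casimir into one vertex of a graph and the bi-vector into all
others, with one sink. -/
def casimirSum (Γ : OrderedGraph (n + 1)) : R :=
  ∑ u, orientList P (fun _ : Unit => a) (constRow ξ :: graphRows (roleEquiv u) Γ)

/-- A function of edge-ordered graphs that only depends on the orientation of the graph. -/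
structure IsGraphInvariant {N : ℕ} (M : ℕ) (Z : OrderedGraph N → R) : Prop where
  swap : ∀ l l' e e', (l ++ e :: e' :: l').length = M → Z (l ++ e' :: e :: l') = -Z (l ++ e :: e' :: l')
  flip : ∀ l l' e, Z (l ++ e.swap :: l') = Z (l ++ e :: l')
  relabel : ∀ (σ : Equiv.Perm (Fin N)) Γ, Z (Γ.map (Prod.map σ σ)) = Z Γ

/-- Edges are odd, as rows of a determinant, and undirected; vertices are even. These are the sign
rules of the graph complex. The strict bound leaves room for the arrow to the sink. -/
theorem isGraphInvariant_casimirSum {M : ℕ} (hM : M < n * 2) :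
    IsGraphInvariant M (casimirSum (n := n) P a ξ) where
  swap l l' e e' h := by
    rw [casimirSum, casimirSum, ← Finset.sum_neg_distrib]
    refine Finset.sum_congr rfl fun u _ => ?_
    simp only [graphRows, List.map_append, List.map_cons, ← List.cons_append]
    exact orientList_swap _ _ _ _ _ _ (by simp at h ⊢; omega)
  flip l l' e := by
    rw [casimirSum, casimirSum]
    refine Finset.sum_congr rfl fun u _ => ?_
    simp only [graphRows, List.map_append, List.map_cons, Prod.fst_swap, Prod.snd_swap]
    rw [edgeRow_comm]
  relabel σ Γ := by
    rw [casimirSum, casimirSum]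
    symm
    refine Fintype.sum_equiv σ _ _ fun u => ?_
    -- The relabelling takes the Casimir vertex `u` to `σ u`, so it induces a permutation of the
    -- bi-vectors, which is even on slots.
    have h1 : ∀ b, ∃ b', roleEquiv (σ u) (σ ((roleEquiv u).symm (Sum.inl b))) = Sum.inl b' := by
      intro b
      rcases h : roleEquiv (σ u) (σ ((roleEquiv u).symm (Sum.inl b))) with b' | q
      · exact ⟨b', rfl⟩
      · rw [← roleEquiv_self (σ u), EmbeddingLike.apply_eq_iff_eq, EmbeddingLike.apply_eq_iff_eq,
          Equiv.symm_apply_eq, roleEquiv_self] at h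
        exact absurd h Sum.inl_ne_inr
    choose τ₀ hτ₀ using h1
    have hτi : Function.Injective τ₀ := by
      intro b c h
      have : roleEquiv (σ u) (σ ((roleEquiv u).symm (Sum.inl b))) =
          roleEquiv (σ u) (σ ((roleEquiv u).symm (Sum.inl c))) := by rw [hτ₀, hτ₀, h]
      simpa using this
    let τ : Equiv.Perm (Fin n) := Equiv.ofBijective τ₀ (Finite.injective_iff_bijective.1 hτi)
    have hτ : ∀ w, roleEquiv (σ u) (σ w) = Sum.map τ id (roleEquiv u w) := by
      intro w
      rcases h : roleEquiv u w with b | q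
      · have : w = (roleEquiv u).symm (Sum.inl b) := by rw [← h, Equiv.symm_apply_apply]
        rw [this, hτ₀]
        rfl
      · have : w = u := (roleEquiv u).injective (by rw [h, roleEquiv_self])
        rw [this, roleEquiv_self]
        rfl
    rw [← orientList_permRow P _ τ]
    congr 1
    simp only [graphRows, List.map_cons, permRow_constRow, List.map_map]
    congr 1
    refine List.map_congr_left fun e _ => ?_
    simp only [Function.comp_apply, permRow_edgeRow, Prod.map_fst, Prod.map_snd, hτ]

/-! ### Splitting a vertex -/

/-- All ways to redistribute the edges at the vertex `v` between `v` and a new vertex. -/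
def splitVertex (v : Fin n) : OrderedGraph n → List (OrderedGraph (n + 1))
  | [] => [[]]
  | e :: E =>
    (splitVertex v E).map (fun l => (e.1.castSucc, e.2.castSucc) :: l) ++
      if e.1 = v then (splitVertex v E).map fun l => (Fin.last n, e.2.castSucc) :: l
      else if e.2 = v then (splitVertex v E).map fun l => (e.1.castSucc, Fin.last n) :: l
      else []

/-- The sum of the arrows over which an edge is redistributed. -/
def splitRow (W : Fin (n + 1) → Fin N ⊕ Q) (v : Fin n) (e : Fin n × Fin n) : SymbRow N Q d :=
  edgeRow (W e.1.castSucc) (W e.2.castSucc) +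
    if e.1 = v then edgeRow (W (Fin.last n)) (W e.2.castSucc)
    else if e.2 = v then edgeRow (W e.1.castSucc) (W (Fin.last n)) else 0

/-- Multilinearity: picking a summand in every `splitRow` is the same as choosing, for each edge at
`v`, which half it is attached to. -/
theorem sum_splitVertex (φ : Q → R) (W : Fin (n + 1) → Fin N ⊕ Q) (v : Fin n)
    (E : OrderedGraph n) (pre : List (SymbRow N Q d)) (h : pre.length + E.length ≤ N * 2) :
    ((splitVertex v E).map fun l => orientList P φ (pre ++ graphRows W l)).sum =
      orientList P φ (pre ++ E.map (splitRow W v)) := by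
  induction E generalizing pre with
  | nil => simp [splitVertex, graphRows]
  | cons e E ih =>
    have hlt : pre.length < N * 2 := by simp at h; omega
    have key : ∀ r : Fin (n + 1) × Fin (n + 1),
        (((splitVertex v E).map fun l => r :: l).map
          fun l => orientList P φ (pre ++ graphRows W l)).sum =
        orientListAt P φ pre (E.map (splitRow W v)) hlt (edgeRow (W r.1) (W r.2)) := by
      intro r
      have := ih (pre ++ [edgeRow (W r.1) (W r.2)]) (by simp at h ⊢; omega)
      rw [List.append_assoc] at this
      rw [orientListAt_apply, List.map_map]
      simpa [graphRows, Function.comp_def] using this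
    rw [List.map_cons, ← orientListAt_apply _ _ _ _ hlt, splitRow, map_add, splitVertex,
      List.map_append, List.sum_append, key]
    congr 1
    split_ifs
    · rw [key]
    · rw [key]
    · simp

theorem edgeRow_apply (u w : Fin n ⊕ Q) (b : Fin n) (i : Fin d) :
    (edgeRow u w : SymbRow n Q d) b i =
      (if Sum.inl b = u then X (w, i) else 0) + (if Sum.inl b = w then X (u, i) else 0) := rfl

/-- An edge into the split vertex heads to the sum of its two halves; an edge out of it heads
elsewhere, as there are no loops. With `S` the range of `jointHom`, the other arrows thus
differentiate the halves only jointly. -/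
theorem splitRow_mem {W : Fin (n + 1) → Fin N ⊕ Q} (hW : Function.Injective W) {v : Fin n}
    {e : Fin n × Fin n} (he : e.1 ≠ e.2) (S : Subalgebra ℝ (Symb (Fin N ⊕ Q) d))
    (h1 : ∀ i, X (W v.castSucc, i) + X (W (Fin.last n), i) ∈ S)
    (h2 : ∀ h i, h ≠ W v.castSucc → h ≠ W (Fin.last n) → X (h, i) ∈ S) (b : Fin N) (i : Fin d) :
    splitRow W v e b i ∈ S := by
  have h3 : ∀ y, y ≠ v → ∀ i, X (W y.castSucc, i) ∈ S := fun y hy i =>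
    h2 _ _ (fun h => hy (Fin.castSucc_injective n (hW h)))
      (fun h => Fin.castSucc_ne_last y (hW h))
  have h4 : ∀ (p : Prop) [Decidable p] (x : Symb (Fin N ⊕ Q) d), x ∈ S →
      (if p then x else 0) ∈ S := by
    intro p _ x hx
    split_ifs
    · exact hx
    · exact S.zero_mem
  obtain ⟨x, y⟩ := e
  simp only [splitRow, Pi.add_apply, edgeRow_apply]
  by_cases hx : x = v
  · subst hx
    have hy : y ≠ x := fun h => he h.symm
    simp only [if_true, edgeRow_apply]
    have : ∀ (p q r : Prop) [Decidable p] [Decidable q] [Decidable r]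
        (A B C : Symb (Fin N ⊕ Q) d), ((if p then A else 0) + if q then B else 0) +
        ((if r then A else 0) + if q then C else 0) =
        (if p then A else 0) + (if r then A else 0) + if q then B + C else 0 := by
      intros; split_ifs <;> ring
    rw [this]
    exact S.add_mem (S.add_mem (h4 _ _ (h3 y hy i)) (h4 _ _ (h3 y hy i))) (h4 _ _ (h1 i))
  · by_cases hy : y = v
    · subst hy
      simp only [hx, if_true, if_false, edgeRow_apply]
      have : ∀ (p q r : Prop) [Decidable p] [Decidable q] [Decidable r]
          (A B C : Symb (Fin N ⊕ Q) d), ((if p then B else 0) + if q then A else 0) +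
          ((if p then C else 0) + if r then A else 0) =
          (if q then A else 0) + (if r then A else 0) + if p then B + C else 0 := by
        intros; split_ifs <;> ring
      rw [this]
      exact S.add_mem (S.add_mem (h4 _ _ (h3 x hx i)) (h4 _ _ (h3 x hx i))) (h4 _ _ (h1 i))
    · simp only [hx, hy, if_false, Pi.zero_apply, add_zero]
      exact S.add_mem (h4 _ _ (h3 y hy i)) (h4 _ _ (h3 x hx i))

/-- A redistributed edge may start at either half on equal terms. This is the symmetry of columns
that the Jacobi argument needs. -/
theorem splitRow_tail {W : Fin (n + 1) → Fin N ⊕ Q} (hW : Function.Injective W) {v : Fin n}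
    {e : Fin n × Fin n} (he : e.1 ≠ e.2) {b b' : Fin N} (hb : W v.castSucc = Sum.inl b)
    (hb' : W (Fin.last n) = Sum.inl b') :
    (splitRow W v e : SymbRow N Q d) b = splitRow W v e b' := by
  have hbb : b ≠ b' := by
    intro h
    rw [h, ← hb'] at hb
    exact Fin.castSucc_ne_last v (hW hb)
  have h1 : ∀ y : Fin n, y ≠ v → W y.castSucc ≠ Sum.inl b := fun y hy h =>
    hy (Fin.castSucc_injective n (hW (h.trans hb.symm)))
  have h2 : ∀ y : Fin n, W y.castSucc ≠ Sum.inl b' := fun y h =>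
    Fin.castSucc_ne_last y (hW (h.trans hb'.symm))
  obtain ⟨x, y⟩ := e
  funext i
  simp only [splitRow, Pi.add_apply, edgeRow_apply]
  by_cases hx : x = v
  · subst hx
    have hy : y ≠ x := fun h => he h.symm
    simp [edgeRow_apply, hb, hb', hbb, hbb.symm, (h1 y hy).symm, (h2 y).symm]
  · by_cases hy : y = v
    · subst hy
      simp [edgeRow_apply, hx, hb, hb', hbb, hbb.symm, (h1 x hx).symm, (h2 x).symm]
    · simp [hx, hy, (h1 x hx).symm, (h2 x).symm, (h1 y hy).symm, (h2 y).symm]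

theorem jointHom_X_add {H : Type*} [Fintype H] [DecidableEq H] (B B' : H) (i : Fin d) :
    (X (B, i) + X (B', i) : Symb H d) ∈ (jointHom (d := d) B B').range :=
  ⟨X (B, i), by change jointHom B B' _ = _; simp [jointHom]⟩

theorem jointHom_X_of_ne {H : Type*} [Fintype H] [DecidableEq H] {B B' h : H} (i : Fin d)
    (h1 : h ≠ B) (h2 : h ≠ B') : (X (h, i) : Symb H d) ∈ (jointHom (d := d) B B').range :=
  ⟨X (h, i), by change jointHom B B' _ = _; simp [jointHom, h1, h2]⟩

theorem sum_map_finsetSum {α β A : Type*} [Fintype β] [AddCommMonoid A] (l : List α)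
    (f : α → β → A) : (l.map fun x => ∑ y, f x y).sum = ∑ y, (l.map fun x => f x y).sum := by
  induction l with
  | nil => simp
  | cons x l ih => simp [ih, Finset.sum_add_distrib]

variable {P a}

/-- The sum over all ways to split a vertex vanishes on a Poisson bi-vector and its Casimir. -/
theorem sum_casimirSum_splitVertex (hP : ∀ i j, P j i = -P i j)
    (hJ : ∀ i j l, ∑ k, (P k i * DiffRing.der k (P j l) + P k j * DiffRing.der k (P l i) +
      P k l * DiffRing.der k (P i j)) = 0)
    (ha : ∀ j, ∑ i, P i j * DiffRing.der i a = 0) (v : Fin n) {E : OrderedGraph n}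
    (hE : ∀ e ∈ E, e.1 ≠ e.2) (hlen : E.length + 2 ≤ n * 2) :
    ((splitVertex v E).map fun l => casimirSum P a ξ ((v.castSucc, Fin.last n) :: l)).sum = 0 := by
  simp only [casimirSum]
  rw [sum_map_finsetSum]
  refine Finset.sum_eq_zero fun u _ => ?_
  have h0 := sum_splitVertex P (fun _ : Unit => a) (roleEquiv u) v E
    [constRow ξ, edgeRow (roleEquiv u v.castSucc) (roleEquiv u (Fin.last n))]
    (by simp; omega)
  refine Eq.trans ?_ (h0.trans ?_)
  · simp [graphRows]
  · set W := roleEquiv u with hWdef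
    have hW : Function.Injective W := W.injective
    -- The new edge has position `1`, because position `0` is taken by the arrow to the sink.
    let e₀ : Fin n × Fin 2 := finProdFinEquiv.symm ⟨1, by omega⟩
    rw [orientList]
    set ρ := listRows ([constRow ξ, edgeRow (W v.castSucc) (W (Fin.last n))] ++
      E.map (splitRow W v)) with hρdef
    have he₀ : ρ e₀ = edgeRow (W v.castSucc) (W (Fin.last n)) := by
      rw [hρdef, listRows, Equiv.apply_symm_apply]; rfl
    have hρ : ∀ e, e ≠ e₀ → ρ e = constRow ξ ∨ ρ e = 0 ∨ ∃ e' ∈ E, ρ e = splitRow W v e' := by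
      intro e he
      rw [hρdef, listRows, List.getD_eq_getElem?_getD]
      rcases hk : ((finProdFinEquiv e : Fin (n * 2)) : ℕ) with _ | _ | k
      · left; rfl
      · exact absurd (by rw [Equiv.eq_symm_apply]; exact Fin.ext hk) he
      · right
        simp only [List.cons_append, List.nil_append, List.getElem?_cons_succ, List.getElem?_map]
        rcases hk : E[k]? with _ | e'
        · left; rfl
        · right
          exact ⟨e', List.mem_of_getElem? hk, rfl⟩
    have hmem : ∀ (S : Subalgebra ℝ (Symb (Fin n ⊕ Unit) d)),
        (∀ i, X (W v.castSucc, i) + X (W (Fin.last n), i) ∈ S) →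
        (∀ h i, h ≠ W v.castSucc → h ≠ W (Fin.last n) → X (h, i) ∈ S) →
        ∀ e, e ≠ e₀ → ∀ b i, ρ e b i ∈ S := by
      intro S h1 h2 e he b i
      rcases hρ e he with h | h | ⟨e', he', h⟩ <;> rw [h]
      · exact S.algebraMap_mem _
      · exact S.zero_mem
      · exact splitRow_mem hW (hE e' he') S h1 h2 b i
    -- The new edge joins two bi-vectors (Jacobi) or a bi-vector and the Casimir; it cannot join two
    -- Casimirs, since only one vertex carries `a`.
    rcases hv : W v.castSucc with b | q <;> rcases hl : W (Fin.last n) with b' | q'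
    · have hbb : b ≠ b' := by
        intro h
        rw [h, ← hl] at hv
        exact Fin.castSucc_ne_last v (hW hv)
      rw [hv, hl] at he₀ hmem
      refine orientForm_eq_zero_of_jacobi hP hJ hbb he₀
        (hmem _ (fun i => jointHom_X_add _ _ _) fun h i h1 h2 => jointHom_X_of_ne i h1 h2) ?_
      intro e he
      rcases hρ e he with h | h | ⟨e', he', h⟩ <;> rw [h]
      · rfl
      · rfl
      · exact splitRow_tail hW (hE e' he') hv hl
    · rw [hv, hl] at he₀ hmem
      exact orientForm_eq_zero_of_casimir hP ha he₀
        (hmem _ (fun i => jointHom_X_add _ _ _) fun h i h1 h2 => jointHom_X_of_ne i h1 h2)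
    · rw [hv, hl] at he₀ hmem
      exact orientForm_eq_zero_of_casimir hP ha (he₀.trans (edgeRow_comm _ _))
        (hmem _ (fun i => by rw [add_comm]; exact jointHom_X_add _ _ _)
          fun h i h1 h2 => jointHom_X_of_ne i h2 h1)
    · exact absurd (hW (hv.trans hl.symm)) (Fin.castSucc_ne_last v)

end Graphs

/-! ### Normal forms of graphs -/

section Certificate

variable {N n d : ℕ} {R : Type*} [CommRing R] [Algebra ℝ R] [DiffRing d R]

/-- Insert an edge into a list of edges, and count the sign of the transpositions. -/
def insertEdge (e : Fin N × Fin N) : OrderedGraph N → ℤ × OrderedGraph N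
  | [] => (1, [e])
  | e' :: l =>
    if e.1.val * N + e.2.val ≤ e'.1.val * N + e'.2.val then (1, e :: e' :: l)
    else (-(insertEdge e l).1, e' :: (insertEdge e l).2)

/-- Sort the edges of a graph, and count the sign of the permutation. -/
def sortEdges : OrderedGraph N → ℤ × OrderedGraph N
  | [] => (1, [])
  | e :: l =>
    ((sortEdges l).1 * (insertEdge (if e.1 ≤ e.2 then e else e.swap) (sortEdges l).2).1,
      (insertEdge (if e.1 ≤ e.2 then e else e.swap) (sortEdges l).2).2)

/-- A permutation of the vertices, as a product of transpositions. -/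
def swapPerm (l : List (Fin N × Fin N)) : Equiv.Perm (Fin N) :=
  l.foldr (fun p σ => Equiv.swap p.1 p.2 * σ) 1

/-- Add a multiple of a graph to a linear combination of graphs. -/
def addTerm (c : ℤ) (Γ : OrderedGraph N) : List (ℤ × OrderedGraph N) → List (ℤ × OrderedGraph N)
  | [] => [(c, Γ)]
  | t :: l => if t.2 = Γ then (c + t.1, Γ) :: l else t :: addTerm c Γ l

/-- Relabel the vertices of the graphs, sort their edges, and collect equal graphs. -/
def normalizeTerms :
    List (ℤ × OrderedGraph N) → List (List (Fin N × Fin N)) → List (ℤ × OrderedGraph N)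
  | [], _ => []
  | t :: ts, σ =>
    addTerm (t.1 * (sortEdges (t.2.map (Prod.map (swapPerm (σ.headD [])) (swapPerm (σ.headD []))))).1)
      (sortEdges (t.2.map (Prod.map (swapPerm (σ.headD [])) (swapPerm (σ.headD []))))).2
      (normalizeTerms ts σ.tail)

theorem length_insertEdge (e : Fin N × Fin N) (l : OrderedGraph N) :
    (insertEdge e l).2.length = l.length + 1 := by
  induction l with
  | nil => rfl
  | cons e' l ih =>
    rw [insertEdge]
    split_ifs
    · rfl
    · simp [ih]

theorem length_sortEdges (l : OrderedGraph N) : (sortEdges l).2.length = l.length := by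
  induction l with
  | nil => rfl
  | cons e l ih => simp [sortEdges, length_insertEdge, ih]

variable {M : ℕ} {Z : OrderedGraph N → R}

theorem IsGraphInvariant.insertEdge (hZ : IsGraphInvariant M Z) (e : Fin N × Fin N)
    (l l' : OrderedGraph N) (h : l.length + l'.length + 1 = M) :
    Z (l ++ e :: l') = (insertEdge e l').1 • Z (l ++ (NambuFlow.insertEdge e l').2) := by
  induction l' generalizing l with
  | nil => simp [NambuFlow.insertEdge]
  | cons e' l' ih =>
    rw [NambuFlow.insertEdge]
    split_ifs
    · simp
    · have h1 := ih (l ++ [e']) (by simp at h ⊢; omega)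
      simp only [List.append_assoc, List.cons_append, List.nil_append] at h1
      rw [hZ.swap l l' e' e (by simp at h ⊢; omega), h1]
      simp

theorem IsGraphInvariant.sortEdges (hZ : IsGraphInvariant M Z)
    (l l' : OrderedGraph N) (h : l.length + l'.length = M) :
    Z (l ++ l') = (sortEdges l').1 • Z (l ++ (NambuFlow.sortEdges l').2) := by
  induction l' generalizing l with
  | nil => simp [NambuFlow.sortEdges]
  | cons e l' ih =>
    have h1 := ih (l ++ [e]) (by simp at h ⊢; omega)
    simp only [List.append_assoc, List.cons_append, List.nil_append] at h1
    have h2 : ∀ l'', Z (l ++ (if e.1 ≤ e.2 then e else e.swap) :: l'') = Z (l ++ e :: l'') := by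
      intro l''
      split_ifs
      · rfl
      · exact hZ.flip _ _ _
    rw [h1, ← h2, hZ.insertEdge _ _ _ (by rw [length_sortEdges]; simp at h; omega),
      NambuFlow.sortEdges, smul_smul]

theorem sum_addTerm (c : ℤ) (Γ : OrderedGraph N) (l : List (ℤ × OrderedGraph N)) :
    ((addTerm c Γ l).map fun t => t.1 • Z t.2).sum = c • Z Γ + (l.map fun t => t.1 • Z t.2).sum := by
  induction l with
  | nil => simp [addTerm]
  | cons t l ih =>
    rw [addTerm]
    split_ifs with h
    · simp only [List.map_cons, List.sum_cons, h, add_smul, add_assoc]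
    · rw [List.map_cons, List.sum_cons, ih, List.map_cons, List.sum_cons, add_left_comm]

theorem IsGraphInvariant.sum_normalizeTerms (hZ : IsGraphInvariant M Z)
    (ts : List (ℤ × OrderedGraph N)) (σ : List (List (Fin N × Fin N)))
    (h : ∀ t ∈ ts, t.2.length = M) :
    ((normalizeTerms ts σ).map fun t => t.1 • Z t.2).sum = (ts.map fun t => t.1 • Z t.2).sum := by
  induction ts generalizing σ with
  | nil => rfl
  | cons t ts ih =>
    rw [normalizeTerms, sum_addTerm, ih _ fun t' ht' => h t' (List.mem_cons_of_mem _ ht'),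
      List.map_cons, List.sum_cons]
    congr 1
    rw [mul_smul]
    congr 1
    have h1 := hZ.sortEdges [] (t.2.map (Prod.map (swapPerm (σ.headD [])) (swapPerm (σ.headD []))))
      (by simpa using h t List.mem_cons_self)
    simp only [List.nil_append] at h1
    rw [← h1, hZ.relabel]

/-- The list `σ` acts as a certificate: any relabellings preserve the sum, so it suffices that the
coefficients cancel for one choice, and no canonical form of graphs is required. Missing entries of
`σ` mean the identity. -/
theorem IsGraphInvariant.sum_eq_zero (hZ : IsGraphInvariant M Z)
    (ts : List (ℤ × OrderedGraph N)) (σ : List (List (Fin N × Fin N)))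
    (h : ∀ t ∈ ts, t.2.length = M) (h0 : ∀ t ∈ normalizeTerms ts σ, t.1 = 0) :
    (ts.map fun t => t.1 • Z t.2).sum = 0 := by
  rw [← hZ.sum_normalizeTerms ts σ h]
  refine List.sum_eq_zero fun x hx => ?_
  obtain ⟨t, ht, rfl⟩ := List.mem_map.1 hx
  rw [h0 t ht, zero_smul]

/-! ### Graph cocycles -/

/-- All graphs obtained by splitting a vertex. -/
def splitTerms (γ : List (ℤ × OrderedGraph n)) : List (ℤ × OrderedGraph (n + 1)) :=
  γ.flatMap fun t => (List.finRange n).flatMap fun v =>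
    (splitVertex v t.2).map fun l => (t.1, (v.castSucc, Fin.last n) :: l)

/-- All graphs obtained by attaching a new vertex of valence one. -/
def leafTerms (γ : List (ℤ × OrderedGraph n)) : List (ℤ × OrderedGraph (n + 1)) :=
  γ.flatMap fun t => (List.finRange n).map fun w =>
    (t.1, (w.castSucc, Fin.last n) :: t.2.map (Prod.map Fin.castSucc Fin.castSucc))

/-- The terms of the differential of the graph complex. -/
def differentialTerms (γ : List (ℤ × OrderedGraph n)) : List (ℤ × OrderedGraph (n + 1)) :=
  -- For a loopless graph, leaving all edges at `v` and moving all of them to the new vertex give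
  -- isomorphic graphs with a leaf, with equal signs. The coefficient `-2` removes both.
  splitTerms γ ++ (leafTerms γ).map fun t => (-2 * t.1, t.2)

/-- A linear combination of graphs on `n` vertices with `2n - 2` edges and without loops that is
a cocycle in the graph complex. -/
def IsGraphCocycle (γ : List (ℤ × OrderedGraph n)) : Prop :=
  (∀ t ∈ γ, t.2.length + 2 = n * 2 ∧ ∀ e ∈ t.2, e.1 ≠ e.2) ∧
    (∀ t ∈ differentialTerms γ, t.2.length + 1 = n * 2) ∧
    ∃ σ, ∀ t ∈ normalizeTerms (differentialTerms γ) σ, t.1 = 0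

/-- The tetrahedron. -/
def tetrahedron : List (ℤ × OrderedGraph 4) :=
  [(1, [(0, 1), (0, 2), (0, 3), (1, 2), (1, 3), (2, 3)])]

/-- Twice the pentagon-wheel cocycle. -/
def pentagonWheel : List (ℤ × OrderedGraph 6) :=
  [(2, [(1, 2), (2, 3), (3, 4), (4, 5), (5, 1), (0, 1), (0, 2), (0, 3), (0, 4), (0, 5)]),
   (5, [(0, 1), (1, 2), (0, 2), (3, 4), (4, 5), (3, 5), (0, 3), (1, 4), (2, 5), (0, 4)])]

/-- Relabellings of the terms of the differential of the tetrahedron into normal form. -/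
def tetrahedronLabels : List (List (Fin 5 × Fin 5)) :=
  [[], [(0, 2)], [(0, 3)], [(0, 4), (1, 2), (3, 4)], [(0, 2), (1, 3)], [(0, 4), (3, 4)],
   [(0, 4), (2, 4)], [(0, 4)], [(0, 1)], [(1, 2)], [(1, 3)], [(0, 2), (1, 4), (3, 4)],
   [(0, 3), (1, 2)], [(1, 4), (3, 4)], [(1, 4), (2, 4)], [(0, 1), (1, 4)], [(0, 2)], [],
   [(1, 2), (2, 3)], [(0, 3), (2, 4)], [(0, 2), (2, 3)], [(1, 3), (2, 4)], [(2, 4), (3, 4)],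
   [(0, 2), (2, 4)], [(0, 3)], [], [(1, 3), (2, 3)], [(0, 2), (3, 4)], [(0, 3), (2, 3)],
   [(1, 2), (3, 4)], [(2, 3), (3, 4)], [(0, 3), (3, 4)], [], [(0, 1)], [(0, 2)], [(0, 3)]]

/-- Relabellings of the terms of the differential of the pentagon wheel into normal form. -/
def pentagonWheelLabels : List (List (Fin 7 × Fin 7)) :=
  [[(3, 4), (4, 5)], [(1, 3), (2, 3)], [(3, 4), (4, 5)], [(1, 2), (4, 6)], [(2, 3), (3, 5)],
   [(3, 6)], [(3, 5), (4, 6)], [(0, 4), (1, 5), (2, 6), (4, 5), (5, 6)], [(1, 4), (2, 5)],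
   [(1, 3), (2, 5), (4, 5), (5, 6)], [(2, 5), (4, 6)], [(0, 3), (1, 5), (2, 4), (3, 6)],
   [(1, 2), (2, 5), (3, 6), (4, 6)], [(0, 3), (1, 6), (3, 6), (4, 5)],
   [(0, 4), (1, 5), (3, 5), (4, 5), (5, 6)], [(0, 6), (1, 5), (2, 3), (3, 5), (4, 5)],
   [(1, 5), (2, 3), (3, 5), (4, 5)], [(1, 5), (3, 5), (4, 5), (5, 6)],
   [(1, 5), (2, 5), (3, 5), (4, 6)], [(0, 4), (1, 2), (2, 5), (3, 6), (4, 6)],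
   [(1, 5), (2, 4), (3, 6)], [(0, 4), (2, 5), (4, 6)], [(0, 3), (1, 4), (2, 6), (3, 6)],
   [(0, 6), (1, 4), (2, 5)], [(1, 5), (2, 6), (4, 5), (5, 6)], [(0, 4), (3, 5), (4, 6)],
   [(0, 4), (3, 6), (4, 6)], [(0, 6), (2, 3), (3, 5)], [(0, 4), (1, 2), (4, 6)],
   [(0, 6), (3, 4), (4, 5)], [(0, 6), (1, 3), (2, 3)], [(0, 6), (3, 4), (4, 5)], [(3, 4), (4, 5)],
   [(1, 5), (2, 3), (3, 5), (4, 5)], [(1, 4), (3, 4)], [(1, 6), (2, 4), (3, 4), (4, 6), (5, 6)],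
   [(1, 4), (2, 5)], [(1, 6), (2, 3), (3, 6), (4, 6), (5, 6)],
   [(1, 6), (2, 3), (3, 6), (4, 6), (5, 6)], [(1, 6), (3, 4), (4, 5)], [(1, 2), (4, 5)],
   [(1, 4), (2, 5)], [(1, 2), (2, 4), (3, 5), (4, 5)], [(1, 4), (2, 6), (5, 6)], [(1, 4), (2, 5)],
   [(1, 2), (2, 6), (3, 5), (4, 5), (5, 6)], [(1, 4), (2, 6), (5, 6)], [(1, 2), (2, 6), (4, 5)],
   [(1, 4), (3, 4)], [(2, 3), (3, 5)], [(3, 4), (4, 5)], [(1, 2), (2, 4), (3, 6), (4, 6), (5, 6)],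
   [(1, 2), (2, 4), (3, 5), (4, 5)], [(3, 6), (4, 5), (5, 6)], [(2, 3), (3, 6), (5, 6)],
   [(1, 4), (3, 6), (4, 6)], [(1, 4), (2, 5)], [(3, 4), (4, 5)], [(1, 2), (4, 5)],
   [(2, 3), (3, 5), (4, 6)], [(3, 4), (4, 5)], [(1, 3), (2, 3), (4, 6)], [(3, 4), (4, 6), (5, 6)],
   [(1, 4), (2, 5), (4, 6)], [(1, 2), (2, 4), (3, 5), (4, 5)], [(1, 3), (2, 3)], [(1, 4), (3, 4)],
   [(1, 2), (4, 5), (5, 6)], [(1, 2), (4, 5)], [(1, 4), (3, 4), (5, 6)], [(1, 3), (2, 3), (5, 6)],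
   [(1, 2), (2, 4), (3, 5), (4, 5), (5, 6)], [(1, 2), (2, 4)], [(1, 2), (2, 4)],
   [(0, 1), (1, 2), (2, 5), (3, 4), (4, 5)], [(0, 5), (1, 4), (2, 6), (3, 4), (4, 5)],
   [(0, 1), (1, 3), (2, 5), (3, 5), (4, 5)], [(0, 5), (1, 3), (2, 6), (4, 5), (5, 6)],
   [(0, 2), (2, 5), (3, 4), (4, 5)], [(0, 6), (1, 4), (2, 5), (3, 5), (4, 6)],
   [(0, 1), (1, 4), (2, 5), (3, 5)], [(0, 6), (1, 3), (2, 5), (3, 5), (4, 6)],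
   [(0, 3), (1, 4), (2, 5), (3, 5), (4, 5)], [(0, 6), (1, 3), (2, 5), (3, 5), (4, 6), (5, 6)],
   [(0, 3), (1, 4), (2, 5), (3, 4)], [(0, 6), (1, 2), (2, 5), (3, 4), (4, 6), (5, 6)],
   [(0, 6), (1, 3), (2, 5), (3, 5), (4, 6), (5, 6)], [(0, 6), (1, 2), (2, 4)], [(1, 2), (2, 4)],
   [(1, 4), (2, 3)], [(0, 1), (1, 3), (2, 5), (3, 5), (4, 5)],
   [(0, 1), (1, 6), (2, 5), (3, 5), (4, 6)], [(0, 1), (1, 4), (2, 5), (3, 5)],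
   [(0, 1), (1, 6), (2, 5), (3, 5), (4, 6), (5, 6)], [(1, 6), (2, 3), (4, 6)],
   [(1, 6), (2, 4), (4, 6)], [(1, 3), (3, 4)], [(1, 2), (2, 4)],
   [(0, 1), (1, 3), (2, 5), (3, 5), (4, 5)], [(0, 1), (1, 3), (2, 6), (3, 6), (4, 6), (5, 6)],
   [(0, 1), (1, 3), (2, 5), (3, 5), (4, 5)], [(0, 1), (1, 3), (2, 6), (3, 6), (4, 6), (5, 6)],
   [(0, 1), (1, 3), (2, 6), (3, 6), (4, 6), (5, 6)], [(1, 3), (2, 6), (3, 4)],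
   [(0, 1), (1, 3), (2, 5), (3, 5), (4, 5)], [(0, 1), (1, 2), (2, 5), (3, 4), (4, 5)],
   [(1, 2), (2, 4)], [(1, 2), (2, 3), (3, 6), (4, 6)], [(1, 2), (2, 3), (3, 4)],
   [(1, 2), (2, 4), (3, 6)], [(0, 1), (1, 2), (2, 5), (3, 6), (4, 5), (5, 6)],
   [(0, 1), (1, 3), (2, 5), (3, 6), (4, 6), (5, 6)], [(0, 1), (1, 3), (2, 5), (3, 5), (4, 5)],
   [(1, 2), (2, 4)], [(1, 4), (2, 3)], [(3, 4), (4, 6)], [(1, 2), (2, 4)], [(4, 5), (5, 6)],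
   [(1, 2)], [(1, 2), (2, 3), (3, 4), (4, 6)], [(1, 2), (2, 3), (3, 4)],
   [(1, 4), (2, 3), (3, 4), (4, 6)], [(3, 4), (5, 6)], [(1, 2), (2, 4), (4, 6)], [(3, 4)],
   [(1, 4), (2, 3), (4, 6)], [(0, 1), (1, 3), (2, 5), (3, 5), (4, 6), (5, 6)],
   [(0, 1), (1, 3), (2, 5), (3, 5), (4, 6), (5, 6)], [(0, 1), (1, 4), (2, 5)], [(1, 2), (2, 4)],
   [(1, 2), (2, 4)], [(1, 2), (2, 4), (5, 6)], [(1, 2), (2, 4)], [(1, 2), (2, 4), (5, 6)],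
   [(0, 1), (1, 3), (2, 5), (3, 5), (4, 5), (5, 6)], [(0, 1), (1, 4), (2, 5), (5, 6)],
   [(3, 4), (4, 5)], [(3, 4), (4, 5)], [(1, 2), (4, 5)], [(1, 4), (3, 4)], [(1, 4), (2, 5)],
   [(1, 2), (2, 4), (3, 5), (4, 5)], [(1, 2), (2, 4)], [(1, 2), (2, 4)], [(1, 3), (3, 4)],
   [(0, 1), (1, 3), (2, 5), (3, 5), (4, 5)], [(0, 1), (1, 3), (2, 5), (3, 5), (4, 5)],
   [(0, 1), (1, 4), (2, 5)]]

-- Each of the four trivalent vertices has `2 ^ 3` redistributions of its edges. The resulting 32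
-- split graphs and the four leaf graphs cancel after relabelling.
set_option maxRecDepth 100000 in
theorem isGraphCocycle_tetrahedron : IsGraphCocycle tetrahedron :=
  ⟨by decide +kernel, by decide +kernel, tetrahedronLabels, by decide +kernel⟩

-- The cocycle is doubled to have integer coefficients. The wheel has `32 + 5 * 8` splittings, the
-- prism with its diagonal `2 * 16 + 4 * 8`, and there are twelve leaf graphs.
set_option maxRecDepth 100000 in
theorem isGraphCocycle_pentagonWheel : IsGraphCocycle pentagonWheel :=
  ⟨by decide +kernel, by decide +kernel, pentagonWheelLabels, by decide +kernel⟩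

end Certificate

/-! ### The graph flow and the velocities of Casimirs -/

section CasimirIdentity

variable {n d : ℕ} {R : Type*} [CommRing R] [Algebra ℝ R] [DiffRing d R]
  (P : Fin d → Fin d → R) (a : R)

/-- The components of the graph flow, up to normalization. -/
def flowComponent (γ : GraphSum n) (i j : Fin d) : R :=
  (γ.map fun t => t.1 • orientList P Empty.elim (constRow (Pi.single i 1) ::
    constRow (Pi.single j 1) :: graphRows Sum.inl t.2)).sum

/-- The velocity of a Casimir, up to normalization. -/
def velocityForm (γ : GraphSum (n + 1)) : R :=
  (γ.map fun t => t.1 • ∑ v, orientList P (fun _ : Unit => a) (graphRows (roleEquiv v) t.2)).sum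

/-- The edge of a leaf that holds `a` must be directed into it. Summed over the points of attachment
it is an arrow from any bi-vector, so `a` acts as a second sink. The sign comes from moving this
arrow before the one to `ξ`. -/
theorem orientList_leaf_casimir (ξ : Fin d → ℝ) (E : OrderedGraph (n + 1)) :
    ∑ w : Fin (n + 1), orientList P (fun _ : Unit => a)
      (constRow ξ :: graphRows (roleEquiv (Fin.last (n + 1)))
        ((w.castSucc, Fin.last (n + 1)) :: E.map (Prod.map Fin.castSucc Fin.castSucc))) =
    -∑ i, DiffRing.der i a * orientList P Empty.elim (constRow (Pi.single i 1) ::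
      constRow ξ :: graphRows Sum.inl E) := by
  have hrows : (graphRows (roleEquiv (Fin.last (n + 1)))
      (E.map (Prod.map Fin.castSucc Fin.castSucc)) : List (SymbRow (n + 1) Unit d)) =
      graphRows Sum.inl E := by
    simp [graphRows, roleEquiv_last_castSucc]
  have hlt : ([constRow ξ] : List (SymbRow (n + 1) Unit d)).length < (n + 1) * 2 := by
    simp; omega
  have h1 : ∀ w : Fin (n + 1), orientList P (fun _ : Unit => a)
      (constRow ξ :: graphRows (roleEquiv (Fin.last (n + 1)))
        ((w.castSucc, Fin.last (n + 1)) :: E.map (Prod.map Fin.castSucc Fin.castSucc))) =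
      orientListAt P (fun _ : Unit => a) [constRow ξ] (graphRows Sum.inl E) hlt
        (edgeRow (Sum.inl w) (Sum.inr ())) := by
    intro w
    rw [orientListAt_apply, ← hrows, ← roleEquiv_last_castSucc w,
      ← roleEquiv_self (Fin.last (n + 1))]
    rfl
  have h2 : ∑ w : Fin (n + 1), (edgeRow (Sum.inl w) (Sum.inr ()) : SymbRow (n + 1) Unit d) =
      scalarRow () := by
    funext b i
    simp [Finset.sum_apply, edgeRow_apply, scalarRow]
  simp_rw [h1]
  rw [← map_sum, h2, orientListAt_apply]
  have h3 := orientList_swap P (fun _ : Unit => a) [] (graphRows Sum.inl E) (scalarRow ())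
    (constRow ξ) (by simp; omega)
  rw [List.nil_append, List.nil_append] at h3
  rw [List.singleton_append, h3]
  congr 1
  have h4 := orientForm_scalarRow P a (finProdFinEquiv.symm (⟨0, by omega⟩ : Fin ((n + 1) * 2)))
    (listRows (0 :: constRow ξ :: graphRows Sum.inl E))
    (listRows (scalarRow () :: constRow ξ :: graphRows Sum.inl E)) ?_ ?_
  · rw [orientList, h4]
    refine Finset.sum_congr rfl fun i _ => ?_
    have h5 : listRows (constRow (Pi.single i 1) :: constRow ξ :: graphRows Sum.inl E) =
        Function.update (listRows (0 :: constRow ξ :: graphRows Sum.inl E))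
          (finProdFinEquiv.symm (⟨0, by omega⟩ : Fin ((n + 1) * 2)))
          (constRow (Pi.single i 1) : SymbRow (n + 1) Empty d) :=
      listRows_append_cons [] _ _ (by simp)
    rw [orientList, h5]
  · intro e he b i
    simp only [listRows, List.getD_eq_getElem?_getD]
    rcases hk : ((finProdFinEquiv e : Fin ((n + 1) * 2)) : ℕ) with _ | _ | k
    · exact absurd (by rw [Equiv.eq_symm_apply]; exact Fin.ext hk) he
    · simp [constRow]
    · simp only [List.getElem?_cons_succ, graphRows, List.getElem?_map]
      rcases E[k]? with _ | e'
      · simp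
      · simp [edgeRow_apply, apply_ite (rename _)]
  · rw [listRows, Equiv.apply_symm_apply]; rfl

/-- The edges of `E` already fill all slots of the other `n` bi-vectors. So the leaf issues both the
arrow to the sink and its own edge, and the latter, summed over the points of attachment,
differentiates the whole value of `E`. -/
theorem orientList_leaf_bivector (ξ : Fin d → ℝ) (E : OrderedGraph (n + 1))
    (hE : E.length = n * 2) (v : Fin (n + 1)) :
    ∑ w : Fin (n + 1), orientList P (fun _ : Unit => a)
      (constRow ξ :: graphRows (roleEquiv v.castSucc)
        ((w.castSucc, Fin.last (n + 1)) :: E.map (Prod.map Fin.castSucc Fin.castSucc))) =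
    ∑ i, ∑ j, P i j * (ξ i • DiffRing.der j
        (orientList P (fun _ : Unit => a) (graphRows (roleEquiv v) E)) -
      ξ j • DiffRing.der i (orientList P (fun _ : Unit => a) (graphRows (roleEquiv v) E))) := by
  let ι : Fin n ⊕ Unit → Fin (n + 1) ⊕ Unit := Sum.map Fin.castSucc id
  let rows : List (SymbRow (n + 1) Unit d) :=
    E.map fun e => edgeRow (ι (roleEquiv v e.1)) (ι (roleEquiv v e.2))
  let leaf : SymbRow (n + 1) Unit d :=
    ∑ w, edgeRow (ι (roleEquiv v w)) (Sum.inl (Fin.last n))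
  have hrows : graphRows (roleEquiv v.castSucc) (E.map (Prod.map Fin.castSucc Fin.castSucc)) =
      rows := by
    simp [graphRows, roleEquiv_castSucc_castSucc, rows, ι]
  have hlen : rows.length = n * 2 := by simp [rows, hE]
  have hlt : ([constRow ξ] : List (SymbRow (n + 1) Unit d)).length < (n + 1) * 2 := by
    simp; omega
  have h1 : ∀ w : Fin (n + 1), orientList P (fun _ : Unit => a)
      (constRow ξ :: graphRows (roleEquiv v.castSucc)
        ((w.castSucc, Fin.last (n + 1)) :: E.map (Prod.map Fin.castSucc Fin.castSucc))) =
      orientListAt P (fun _ : Unit => a) [constRow ξ] rows hlt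
        (edgeRow (ι (roleEquiv v w)) (Sum.inl (Fin.last n))) := by
    intro w
    rw [orientListAt_apply, ← hrows, ← roleEquiv_castSucc_last v,
      show ι (roleEquiv v w) = _ from (roleEquiv_castSucc_castSucc v w).symm]
    rfl
  simp_rw [h1]
  rw [← map_sum, orientListAt_apply, List.singleton_append,
    orientList_move_two _ _ _ _ _ (by omega), orientList, orientList]
  have hpos : ∀ (b : Fin n) (j : Fin 2), ((finProdFinEquiv (b, j) : Fin (n * 2)) : ℕ) < n * 2 :=
    fun b j => (finProdFinEquiv (b, j)).2
  have hz : ∀ (b : Fin n) (j : Fin 2),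
      ∃ e, listRows (rows ++ [constRow ξ, leaf]) (Fin.castSucc b, j) =
        edgeRow (ι (roleEquiv v (e : Fin (n + 1) × Fin (n + 1)).1)) (ι (roleEquiv v e.2)) ∧
        listRows (graphRows (roleEquiv v) E) (b, j) =
          (edgeRow (roleEquiv v e.1) (roleEquiv v e.2) : SymbRow n Unit d) := by
    intro b j
    have hk : ((finProdFinEquiv (b.castSucc, j) : Fin ((n + 1) * 2)) : ℕ) =
      (finProdFinEquiv (b, j) : Fin (n * 2)) := rfl
    have hlt' : ((finProdFinEquiv (b, j) : Fin (n * 2)) : ℕ) < E.length := by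
      rw [hE]; exact hpos b j
    refine ⟨E[((finProdFinEquiv (b, j) : Fin (n * 2)) : ℕ)], ?_, ?_⟩
    · rw [listRows, hk, List.getD_append _ _ _ _ (by rw [hlen]; exact hpos b j),
        List.getD_eq_getElem _ _ (by rw [hlen]; exact hpos b j)]
      simp only [rows, List.getElem_map]
    · rw [listRows, List.getD_eq_getElem _ _ (by simpa [graphRows] using hlt')]
      simp only [graphRows, List.getElem_map]
  have hιι : ∀ (b : Fin n) (h : Fin n ⊕ Unit),
      (Sum.inl (Fin.castSucc b) = ι h) = (Sum.inl b = h) := by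
    rintro b (h | h) <;> simp [ι]
  have hιl : ∀ (h : Fin n ⊕ Unit), ¬ Sum.inl (Fin.last n) = ι h := by
    rintro (h | h)
    · simp [ι, (Fin.castSucc_ne_last h).symm]
    · simp [ι]
  refine orientForm_last P _ ξ _ _ ?_ ?_ ?_ ?_
  · intro b j c i
    obtain ⟨e, h1, h2⟩ := hz b j
    rw [h1, h2, edgeRow_apply, edgeRow_apply]
    simp [hιι, apply_ite (rename _), ι]
  · intro b j i
    obtain ⟨e, h1, h2⟩ := hz b j
    rw [h1, edgeRow_apply]
    simp [hιl]
  · have hk : ((finProdFinEquiv (Fin.last n, (0 : Fin 2)) : Fin ((n + 1) * 2)) : ℕ) =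
      rows.length := by rw [hlen]; simp [finProdFinEquiv, mul_comm]
    rw [listRows, hk, List.getD_append_right _ _ _ _ le_rfl, Nat.sub_self]
    rfl
  · intro i
    have hk : ((finProdFinEquiv (Fin.last n, (1 : Fin 2)) : Fin ((n + 1) * 2)) : ℕ) =
      rows.length + 1 := by rw [hlen]; simp [finProdFinEquiv, mul_comm, add_comm]
    rw [listRows, hk, List.getD_append_right _ _ _ _ (by omega), Nat.add_sub_cancel_left]
    change leaf (Fin.last n) i = _
    simp only [leaf, Finset.sum_apply, edgeRow_apply, hιl, if_false, zero_add, if_true]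
    exact (roleEquiv v).sum_comp fun h => (X (ι h, i) : Symb (Fin (n + 1) ⊕ Unit) d)

variable {P a}

/-- On a Poisson bi-vector with Casimir `a`, the graph flow `Q` of a graph cocycle and the velocity
`ȧ` satisfy `Q(a, ·) + P(ȧ, ·) = 0`. -/
theorem sum_der_mul_flowComponent (hP : ∀ i j, P j i = -P i j)
    (hJ : ∀ i j l, ∑ k, (P k i * DiffRing.der k (P j l) + P k j * DiffRing.der k (P l i) +
      P k l * DiffRing.der k (P i j)) = 0)
    (ha : ∀ j, ∑ i, P i j * DiffRing.der i a = 0) {γ : List (ℤ × OrderedGraph (n + 1))}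
    (hγ : IsGraphCocycle γ) (c : ℝ) (j : Fin d) :
    ∑ i, DiffRing.der i a * flowComponent P (γ.map fun t => (c * (t.1 : ℝ), t.2)) i j =
      (-2 : ℝ) • ∑ k, P k j *
        DiffRing.der k (velocityForm P a (γ.map fun t => (c * (t.1 : ℝ), t.2))) := by
  obtain ⟨h1, h2, σ, h3⟩ := hγ
  let ξ : Fin d → ℝ := Pi.single j 1
  -- Graphs in the differential carry `n + 1` bi-vectors, and one of their slots serves the sink.
  have hZ := isGraphInvariant_casimirSum P a ξ (n := n + 1) (M := (n + 1) * 2 - 1) (by omega)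
  have h4 := hZ.sum_eq_zero (differentialTerms γ) σ (fun t ht => by have := h2 t ht; omega) h3
  have hleaf : ∀ E : OrderedGraph (n + 1), E.length = n * 2 →
      ∑ w : Fin (n + 1), casimirSum P a ξ ((w.castSucc, Fin.last (n + 1)) ::
        E.map (Prod.map Fin.castSucc Fin.castSucc)) =
      (-2 : ℝ) • (∑ k, P k j * DiffRing.der k (∑ v, orientList P (fun _ : Unit => a)
        (graphRows (roleEquiv v) E))) -
      ∑ i, DiffRing.der i a * orientList P Empty.elim (constRow (Pi.single i 1) ::
        constRow ξ :: graphRows Sum.inl E) := by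
    intro E hE
    simp only [casimirSum]
    -- Separate the terms with the Casimir in the leaf from those with a bi-vector there.
    rw [Finset.sum_comm, Fin.sum_univ_castSucc, orientList_leaf_casimir, sub_eq_add_neg]
    congr 1
    simp_rw [orientList_leaf_bivector P a ξ E hE, map_sum, Finset.mul_sum]
    rw [Finset.sum_comm (s := Finset.univ (α := Fin d)), Finset.smul_sum]
    refine Finset.sum_congr rfl fun v _ => ?_
    simp only [mul_sub, Finset.sum_sub_distrib, ξ, Pi.single_apply, ite_smul, one_smul, zero_smul,
      mul_ite, mul_zero, Finset.sum_ite_eq', Finset.sum_ite_irrel, Finset.sum_const_zero,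
      Finset.mem_univ, if_true]
    -- By antisymmetry the two ways to fill the slots of the leaf agree, whence the factor `-2`.
    simp_rw [hP _ j]
    simp only [neg_mul, Finset.sum_neg_distrib, neg_smul, two_smul]
    ring
  have hflat : ∀ {α β : Type} (l : List α) (f : α → List β) (g : β → R),
      ((l.flatMap f).map g).sum = (l.map fun x => ((f x).map g).sum).sum := by
    intro α β l f g
    induction l with
    | nil => rfl
    | cons x l ih => simp [ih]
  have hsplit : ((splitTerms γ).map fun t => t.1 • casimirSum P a ξ t.2).sum = 0 := by
    rw [splitTerms, hflat]
    refine List.sum_eq_zero fun x hx => ?_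
    obtain ⟨t, ht, rfl⟩ := List.mem_map.1 hx
    rw [hflat]
    refine List.sum_eq_zero fun x hx => ?_
    obtain ⟨v, -, rfl⟩ := List.mem_map.1 hx
    have h5 := sum_casimirSum_splitVertex ξ hP hJ ha v (h1 t ht).2 (h1 t ht).1.le
    rw [List.map_map, ← smul_zero t.1, ← h5, List.smul_sum, List.map_map]
    rfl
  have hsum : ((leafTerms γ).map fun t => t.1 • casimirSum P a ξ t.2).sum = 0 := by
    -- The whole differential and its splitting part vanish, hence so does the leaf part.
    rw [differentialTerms, List.map_append, List.sum_append, hsplit, zero_add, List.map_map] at h4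
    have h5 : ((leafTerms γ).map fun t => (-2 * t.1) • casimirSum P a ξ t.2).sum =
        (-2 : ℝ) • ((leafTerms γ).map fun t => t.1 • casimirSum P a ξ t.2).sum := by
      rw [List.smul_sum, List.map_map]
      congr 1
      refine List.map_congr_left fun t _ => ?_
      simp [mul_smul, two_smul, zsmul_eq_mul]
    exact (smul_eq_zero.1 (h5.symm.trans h4)).resolve_left (by norm_num)
  rw [leafTerms, hflat] at hsum
  have hterm : ∀ t ∈ γ, ((((List.finRange (n + 1)).map fun w : Fin (n + 1) =>
      (t.1, (w.castSucc, Fin.last (n + 1)) ::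
        t.2.map (Prod.map Fin.castSucc Fin.castSucc))).map
      fun t => t.1 • casimirSum P a ξ t.2).sum) =
      (t.1 : ℝ) • ((-2 : ℝ) • (∑ k, P k j * DiffRing.der k (∑ v, orientList P (fun _ : Unit => a)
        (graphRows (roleEquiv v) t.2))) -
      ∑ i, DiffRing.der i a * orientList P Empty.elim (constRow (Pi.single i 1) ::
        constRow ξ :: graphRows Sum.inl t.2)) := by
    intro t ht
    rw [← hleaf t.2 (by have := (h1 t ht).1; omega), List.map_map, Fin.sum_univ_def,
      Int.cast_smul_eq_zsmul, List.smul_sum, List.map_map]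
    rfl
  rw [List.map_congr_left hterm] at hsum
  have hlin : ∀ l : List (ℤ × OrderedGraph (n + 1)),
      (∑ i, DiffRing.der i a * flowComponent P (l.map fun t => (c * (t.1 : ℝ), t.2)) i j) +
      (2 : ℝ) • (∑ k, P k j *
        DiffRing.der k (velocityForm P a (l.map fun t => (c * (t.1 : ℝ), t.2)))) +
      c • (l.map fun t => (t.1 : ℝ) • ((-2 : ℝ) • (∑ k, P k j * DiffRing.der k
        (∑ v, orientList P (fun _ : Unit => a) (graphRows (roleEquiv v) t.2))) -
      ∑ i, DiffRing.der i a * orientList P Empty.elim (constRow (Pi.single i 1) ::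
        constRow ξ :: graphRows Sum.inl t.2))).sum = 0 := by
    intro l
    induction l with
    | nil => simp [flowComponent, velocityForm]
    | cons t l ih =>
      rw [← ih]
      simp only [flowComponent, velocityForm, List.map_cons, List.sum_cons, mul_add, map_add,
        Finset.sum_add_distrib, smul_add, smul_sub, Derivation.map_smul, mul_smul_comm,
        ← Finset.smul_sum, smul_smul]
      module
  have h6 := hlin γ
  rw [hsum, smul_zero, add_zero] at h6
  rw [neg_smul]
  exact eq_neg_of_add_eq_zero_left h6

end CasimirIdentity

/-! ### The differential ring of smooth functions -/

section Smooth

variable {d : ℕ}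

theorem contDiff_partialD (i : Fin d) {f : Fn d} (hf : ContDiff ℝ ∞ f) :
    ContDiff ℝ ∞ (partialD i f) :=
  (hf.fderiv_right (m := ∞) (by simp)).clm_apply contDiff_const

theorem partialD_comm (i j : Fin d) {f : Fn d} (hf : ContDiff ℝ ∞ f) :
    partialD i (partialD j f) = partialD j (partialD i f) := by
  funext x
  have h1 : DifferentiableAt ℝ (fderiv ℝ f) x :=
    ((hf.fderiv_right (m := ∞) (by simp)).differentiable (by simp)) x
  have h2 : ∀ i j : Fin d, partialD i (partialD j f) x =
      fderiv ℝ (fderiv ℝ f) x (Pi.single i 1) (Pi.single j 1) := by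
    intro i j
    have h3 := (h1.hasFDerivAt.clm_apply (hasFDerivAt_const (Pi.single j (1 : ℝ) : Fin d → ℝ) x))
    rw [partialD]
    change fderiv ℝ (fun y => fderiv ℝ f y (Pi.single j 1)) x _ = _
    rw [h3.fderiv]
    simp
  rw [h2, h2]
  exact (hf.contDiffAt.isSymmSndFDerivAt
    (by rw [minSmoothness_of_isRCLikeNormedField]; exact WithTop.coe_le_coe.2 le_top)) _ _

/-- The algebra of smooth functions. -/
def SmoothFn (d : ℕ) : Subalgebra ℝ (Fn d) where
  carrier := {f | ContDiff ℝ ∞ f}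
  mul_mem' hf hg := Set.mem_ofPred_eq ▸ ContDiff.mul (Set.mem_ofPred.1 hf) (Set.mem_ofPred.1 hg)
  add_mem' hf hg := Set.mem_ofPred_eq ▸ ContDiff.add (Set.mem_ofPred.1 hf) (Set.mem_ofPred.1 hg)
  algebraMap_mem' _ := Set.mem_ofPred_eq ▸ contDiff_const

theorem mem_smoothFn {f : Fn d} : f ∈ SmoothFn d ↔ ContDiff ℝ ∞ f := Set.mem_ofPred

theorem contDiff_coe (f : SmoothFn d) : ContDiff ℝ ∞ f.1 := mem_smoothFn.1 f.2

/-- Evaluation of smooth functions at a point. -/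
def evalAt (x : Fin d → ℝ) : SmoothFn d →ₐ[ℝ] ℝ :=
  (Pi.evalAlgHom ℝ (fun _ => ℝ) x).comp (SmoothFn d).val

theorem evalAt_apply (x : Fin d → ℝ) (f : SmoothFn d) : evalAt x f = f.1 x := rfl

instance : DiffRing d (SmoothFn d) where
  der i := Derivation.mk'
    { toFun := fun f => ⟨partialD i f.1, mem_smoothFn.2 (contDiff_partialD i (contDiff_coe f))⟩
      map_add' := fun f g => Subtype.ext <| funext fun x => by
        have hf := ((contDiff_coe f).differentiable (by simp)) x
        have hg := ((contDiff_coe g).differentiable (by simp)) x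
        change fderiv ℝ (f.1 + g.1) x _ = fderiv ℝ f.1 x _ + fderiv ℝ g.1 x _
        rw [fderiv_add hf hg]; rfl
      map_smul' := fun c f => Subtype.ext <| funext fun x => by
        have hf := ((contDiff_coe f).differentiable (by simp)) x
        change fderiv ℝ (c • f.1) x _ = c • fderiv ℝ f.1 x _
        rw [fderiv_const_smul hf]; rfl }
    fun f g => Subtype.ext <| funext fun x => by
        have hf := ((contDiff_coe f).differentiable (by simp)) x
        have hg := ((contDiff_coe g).differentiable (by simp)) x
        change fderiv ℝ (f.1 * g.1) x _ = f.1 x * fderiv ℝ g.1 x _ + g.1 x * fderiv ℝ f.1 x _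
        rw [fderiv_mul hf hg]; rfl
  der_comm i j f := Subtype.ext (partialD_comm i j (contDiff_coe f))

theorem coe_der (i : Fin d) (f : SmoothFn d) : (DiffRing.der i f : SmoothFn d).1 = partialD i f.1 :=
  rfl

theorem coe_iterDer (l : List (Fin d)) (f : SmoothFn d) :
    (iterDer (l : Multiset (Fin d)) f).1 = iterPartial l f.1 := by
  rw [iterDer_coe]
  induction l with
  | nil => rfl
  | cons i l ih =>
    rw [List.foldr_cons, coe_der, ih]
    rfl

end Smooth

/-! ### Signs -/

theorem sign_eq_neg_one_pow {m : ℕ} (p : Equiv.Perm (Fin m)) :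
    ((Equiv.Perm.sign p : ℤ) : ℝ) = (-1) ^ (Finset.univ.filter fun q : Fin m × Fin m =>
      q.1 < q.2 ∧ p q.2 < p q.1).card := by
  rw [Equiv.Perm.sign_eq_prod_prod_Ioi]
  rw [← Finset.prod_const, Finset.prod_filter, Fintype.prod_prod_type]
  push_cast
  refine Finset.prod_congr rfl fun i _ => ?_
  rw [← Finset.prod_filter_mul_prod_filter_not Finset.univ (fun j => i < j)]
  have h1 : Finset.univ.filter (fun j => i < j) = Finset.Ioi i := by ext; simp
  rw [h1, Finset.prod_congr rfl (g := fun _ => (1 : ℝ)) (s₁ := Finset.univ.filter fun j => ¬ i < j),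
    Finset.prod_const_one, mul_one]
  · refine Finset.prod_congr rfl fun j hj => ?_
    rw [Finset.mem_Ioi] at hj
    have hne : p i ≠ p j := p.injective.ne hj.ne
    rcases lt_or_gt_of_ne hne with h | h
    · simp [h, h.not_gt]
    · simp [h, h.not_gt, hj]
  · intro j hj
    have : ¬ i < j := (Finset.mem_filter.1 hj).2
    simp [this]

/-- The sign of an assignment of arrows to slots: inversions of tails, and inversions of the two
slots of one bi-vector. -/
theorem sign_slots {m n N : ℕ} (hm : m = n * 2) (π : Fin m ≃ Fin n × Fin 2) (c : Fin n → Fin N)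
    (hc : StrictMono c) (τ : Fin m → Fin N) (hτ : ∀ e, c (π e).1 = τ e) :
    ((Equiv.Perm.sign ((finCongr hm).symm.trans (π.trans finProdFinEquiv)) : ℤ) : ℝ) =
      (-1) ^ (Finset.univ.filter fun p : Fin m × Fin m => p.1 < p.2 ∧ τ p.2 < τ p.1).card *
      ∏ b, if π.symm (b, 0) < π.symm (b, 1) then 1 else -1 := by
  subst hm
  rw [sign_eq_neg_one_pow]
  -- Slots are ordered lexicographically: an inversion is either one of tails or one within a single
  -- bi-vector.
  have h1 : ∀ i j, finProdFinEquiv (π j) < finProdFinEquiv (π i) ↔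
      (τ j < τ i ∨ (π j).1 = (π i).1 ∧ (π j).2 < (π i).2) := by
    intro i j
    rw [← hτ, ← hτ, hc.lt_iff_lt]
    rcases π j with ⟨b, k⟩
    rcases π i with ⟨b', k'⟩
    simp only [finProdFinEquiv, Equiv.coe_fn_mk, Fin.lt_def, Fin.ext_iff]
    have := k.2; have := k'.2
    omega
  have h2 : (∏ b, if π.symm (b, 0) < π.symm (b, 1) then (1 : ℝ) else -1) =
      (-1) ^ (Finset.univ.filter fun b => ¬ π.symm (b, 0) < π.symm (b, 1)).card := by
    rw [← Finset.prod_const, Finset.prod_filter]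
    refine Finset.prod_congr rfl fun b _ => ?_
    split_ifs <;> rfl
  rw [h2, ← pow_add]
  congr 1
  have h3 : (Finset.univ.filter fun b => ¬ π.symm (b, 0) < π.symm (b, 1)).card =
      (Finset.univ.filter fun p : Fin (n * 2) × Fin (n * 2) =>
        p.1 < p.2 ∧ (π p.2).1 = (π p.1).1 ∧ (π p.2).2 < (π p.1).2).card := by
    refine Finset.card_bij (fun b _ => (π.symm (b, 1), π.symm (b, 0))) ?_ ?_ ?_
    · intro b hb
      have hb' := (Finset.mem_filter.1 hb).2
      have hne : π.symm (b, 0) ≠ π.symm (b, 1) := π.symm.injective.ne (by simp)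
      simp only [Finset.mem_filter, Finset.mem_univ, true_and, Equiv.apply_symm_apply]
      exact ⟨lt_of_le_of_ne (not_lt.1 hb') hne.symm, by decide⟩
    · intro b _ b' _ h
      have := congrArg Prod.fst h
      simpa using this
    · rintro ⟨i, j⟩ h
      simp only [Finset.mem_filter, Finset.mem_univ, true_and] at h
      obtain ⟨hij, hb, hk⟩ := h
      have hk1 : (π i).2 = 1 := by omega
      have hk0 : (π j).2 = 0 := by omega
      have hi : π.symm ((π i).1, 1) = i := by rw [Equiv.symm_apply_eq, ← hk1]
      have hj : π.symm ((π i).1, 0) = j := by rw [Equiv.symm_apply_eq, ← hk0, ← hb]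
      refine ⟨(π i).1, ?_, by rw [hi, hj]⟩
      simp only [Finset.mem_filter, Finset.mem_univ, true_and, hi, hj]
      exact hij.not_gt
  rw [h3, ← Finset.card_union_of_disjoint]
  · congr 1
    ext ⟨i, j⟩
    simp only [Finset.mem_filter, Finset.mem_univ, true_and, Finset.mem_union]
    have := h1 i j
    simp only [Equiv.trans_apply, finCongr_refl, Equiv.refl_symm, Equiv.refl_apply]
    rw [this]
    tauto
  · rw [Finset.disjoint_left]
    rintro ⟨i, j⟩ h h'
    simp only [Finset.mem_filter, Finset.mem_univ, true_and] at h h'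
    rw [← hτ, ← hτ, h'.2.1] at h
    exact lt_irrefl _ h.2

/-- The number of assignments of arrows to slots with given tails. -/
theorem card_slots {n : ℕ} {A V : Type*} [Fintype A] [DecidableEq A] [DecidableEq V]
    (ε : Fin n × Fin 2 ≃ A) (c : Fin n → V) (hc : Function.Injective c) (τ : A → V)
    (σ₀ : Equiv.Perm (Fin n × Fin 2)) (h₀ : ∀ e, c (σ₀.symm (ε.symm e)).1 = τ e) :
    (Finset.univ.filter fun σ : Equiv.Perm (Fin n × Fin 2) =>
      ∀ e, c (σ.symm (ε.symm e)).1 = τ e).card = 2 ^ n := by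
  -- Assignments with the same tails differ by permutations preserving each pair of slots, a group
  -- of order `2 ^ n`.
  have h1 := DomMulAct.stabilizer_card (fun t : Fin n × Fin 2 => t.1)
  have h2 : ∀ b : Fin n, Fintype.card {t : Fin n × Fin 2 // t.1 = b} = 2 := by
    intro b
    rw [Fintype.card_subtype, show (Finset.univ.filter fun t : Fin n × Fin 2 => t.1 = b) =
      ({b} : Finset (Fin n)) ×ˢ Finset.univ by ext ⟨x, y⟩; simp [eq_comm]]
    simp
  simp only [h2] at h1
  rw [Finset.prod_const, Finset.card_univ, Fintype.card_fin, Nat.factorial_two] at h1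
  rw [← h1, Fintype.card_subtype]
  refine Finset.card_bij (fun σ _ => σ⁻¹ * σ₀) ?_ ?_ ?_
  · intro σ hσ
    have hσ' := (Finset.mem_filter.1 hσ).2
    simp only [Finset.mem_filter, Finset.mem_univ, true_and]
    funext t
    have h3 := (hσ' (ε (σ₀ t))).trans (h₀ (ε (σ₀ t))).symm
    simpa using hc h3
  · intro σ _ σ' _ h
    exact inv_injective (mul_right_cancel h)
  · intro g hg
    have hg' := (Finset.mem_filter.1 hg).2
    refine ⟨σ₀ * g⁻¹, ?_, by group⟩
    simp only [Finset.mem_filter, Finset.mem_univ, true_and]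
    intro e
    rw [← h₀ e]
    congr 1
    exact congrFun hg' _

/-! ### The orientation morphism in terms of determinants -/

section OrientGraph

variable {N s n d : ℕ} {Q : Type*} [Fintype Q] [DecidableEq Q] (E : OrderedGraph N)
  (W : Fin N ≃ Fin n ⊕ Q) (P : Fin d → Fin d → SmoothFn d) (φ : Q → SmoothFn d)
  (f : Fin s → Fn d) (x : Fin d → ℝ)

/-- The contents of the vertices in the roles `W`. -/
def vertexContent (v : Fin N) : Content d :=
  (W v).elim (fun _ => .bivector fun i j => (P i j).1) (fun q => .scalar (φ q).1)

/-- The arrows to the sinks. -/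
def sinkRows : List (SymbRow n Q d) := List.ofFn fun j => constRow fun i => partialD i (f j) x

/-- The symbols of all arrows. -/
def arrowRow : Fin (s + E.length) → SymbRow n Q d :=
  Fin.append (fun j => constRow fun i => partialD i (f j) x)
    (fun e => edgeRow (W (E.get e).1) (W (E.get e).2))

/-- The symbols of the heads of the arrows. -/
def headSymb (dir : Fin E.length → Bool) : Fin (s + E.length) → Fin d → Symb (Fin n ⊕ Q) d :=
  Fin.append (fun j i => C (partialD i (f j) x))
    (fun e i => X (W (if dir e then (E.get e).2 else (E.get e).1), i))

theorem listRows_arrows (hlen : s + E.length = n * 2) (t : Fin n × Fin 2) :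
    listRows (sinkRows f x ++ graphRows W E) t =
      arrowRow E W f x (finProdFinEquiv.trans (finCongr hlen.symm) t) := by
  obtain ⟨e, rfl⟩ := (finProdFinEquiv.trans (finCongr hlen.symm)).symm.surjective t
  rw [Equiv.apply_symm_apply]
  have h : ((finProdFinEquiv ((finProdFinEquiv.trans (finCongr hlen.symm)).symm e) :
      Fin (n * 2)) : ℕ) = e := by simp [Nat.mod_add_div]
  rw [listRows, h]
  have hl : (sinkRows f x : List (SymbRow n Q d)).length = s := by simp [sinkRows]
  induction e using Fin.addCases with
  | left j =>
    rw [arrowRow, Fin.append_left, List.getD_append _ _ _ _ (by rw [hl]; simp),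
      List.getD_eq_getElem _ _ (by rw [hl]; simp)]
    simp [sinkRows]
  | right e =>
    rw [arrowRow, Fin.append_right, List.getD_append_right _ _ _ _ (by rw [hl]; simp)]
    rw [hl, Fin.val_natAdd, Nat.add_sub_cancel_left,
      List.getD_eq_getElem _ _ (by simp [graphRows])]
    simp [graphRows]

/-- The row of an edge is a sum over its two directions and that of a sink arrow a sum over its
tails. Expanding the product recovers the sum over directed graphs. -/
theorem prod_arrowRow (b : Fin (s + E.length) → Fin n) (ι : Fin (s + E.length) → Fin d) :
    ∏ e, arrowRow E W f x e (b e) (ι e) =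
      ∑ att : Fin s → Fin N, ∑ dir : Fin E.length → Bool,
        ∏ e, if W.symm (Sum.inl (b e)) = tail E att dir e then headSymb E W f x dir e (ι e)
          else 0 := by
  have h1 : ∀ (att : Fin s → Fin N) (dir : Fin E.length → Bool),
      (∏ e, if W.symm (Sum.inl (b e)) = tail E att dir e then headSymb E W f x dir e (ι e)
          else 0) =
      (∏ j, if W.symm (Sum.inl (b (Fin.castAdd _ j))) = att j then
        (C (partialD (ι (Fin.castAdd _ j)) (f j) x) : Symb (Fin n ⊕ Q) d) else 0) *
      ∏ e, if W.symm (Sum.inl (b (Fin.natAdd s e))) =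
          (if dir e then (E.get e).1 else (E.get e).2) then
        X (W (if dir e then (E.get e).2 else (E.get e).1), ι (Fin.natAdd s e)) else 0 := by
    intro att dir
    rw [Fin.prod_univ_add]
    simp only [tail, headSymb, Fin.append_left, Fin.append_right]
  simp_rw [h1]
  rw [← Finset.sum_mul_sum, Fin.prod_univ_add]
  have h2 := Finset.prod_univ_sum (fun _ : Fin s => (Finset.univ : Finset (Fin N)))
    (fun j v => if W.symm (Sum.inl (b (Fin.castAdd _ j))) = v then
        (C (partialD (ι (Fin.castAdd _ j)) (f j) x) : Symb (Fin n ⊕ Q) d) else 0)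
  have h3 := Finset.prod_univ_sum (fun _ : Fin E.length => (Finset.univ : Finset Bool))
    (fun e p => if W.symm (Sum.inl (b (Fin.natAdd s e))) =
          (if p then (E.get e).1 else (E.get e).2) then
        (X (W (if p then (E.get e).2 else (E.get e).1), ι (Fin.natAdd s e)) :
          Symb (Fin n ⊕ Q) d) else 0)
  rw [Fintype.piFinset_univ] at h2 h3
  rw [← h2, ← h3]
  congr 1
  · refine Finset.prod_congr rfl fun j _ => ?_
    simp [arrowRow, constRow]
  · refine Finset.prod_congr rfl fun e _ => ?_
    simp [arrowRow, edgeRow_apply, Equiv.symm_apply_eq]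

theorem incoming_inr (dir : Fin E.length → Bool) (j : Fin s) :
    incoming E dir (Sum.inr j) = [Fin.castAdd E.length j] := by
  refine List.Perm.eq_singleton ((List.perm_ext_iff_of_nodup
    ((List.nodup_finRange _).filter _) (List.nodup_singleton _)).2 fun e => ?_)
  simp only [List.mem_filter, List.mem_finRange, true_and, decide_eq_true_eq, List.mem_singleton]
  induction e using Fin.addCases with
  | left j' => simp [head]
  | right e =>
    simp only [head, Fin.append_right, reduceCtorEq, false_iff]
    intro h
    have := congrArg Fin.val h
    simp at this
    omega

theorem directions_heads (dir : Fin E.length → Bool) (ι : Fin (s + E.length) → Fin d)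
    (v : Fin N) :
    directions (W v) (Finset.univ.val.map fun e : Fin E.length =>
      (W (if dir e then (E.get e).2 else (E.get e).1), ι (Fin.natAdd s e))) =
    (((incoming (s := s) E dir (Sum.inl v)).map ι : List (Fin d)) : Multiset (Fin d)) := by
  have h0 : (Finset.univ.val : Multiset (Fin E.length)) = (List.finRange E.length : Multiset _) :=
    rfl
  have h1 : List.finRange (s + E.length) = (List.finRange s).map (Fin.castAdd E.length) ++
      (List.finRange E.length).map (Fin.natAdd s) := by
    have h2 : ∀ m, List.finRange m = List.ofFn id := fun m => (List.ofFn_id m).symm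
    rw [h2, h2, h2, List.ofFn_add, List.map_ofFn, List.map_ofFn]
    rfl
  rw [h0, incoming, h1, List.filter_append, List.filter_map, List.filter_map]
  have h2 : ((fun e => decide (head (s := s) E dir e = Sum.inl v)) ∘ Fin.castAdd E.length) =
      fun _ => false := by
    funext j
    simp [head]
  rw [h2, List.filter_false, List.map_nil, List.nil_append, directions, Multiset.map_coe,
    Multiset.filter_coe, Multiset.map_coe, List.filter_map, List.map_map, List.map_map]
  congr 2
  refine List.filter_congr fun e _ => ?_
  simp [head]

theorem outgoing_eq_pair {att : Fin s → Fin N} {dir : Fin E.length → Bool} {v : Fin N}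
    {e e' : Fin (s + E.length)} (hlt : e < e')
    (h : ∀ g, tail E att dir g = v ↔ g = e ∨ g = e') : outgoing E att dir v = [e, e'] := by
  have hs : (outgoing E att dir v).Pairwise (· < ·) :=
    (List.pairwise_lt_finRange _).sublist List.filter_sublist
  refine List.Perm.eq_of_pairwise (le := (· < ·)) (fun a b _ _ h1 h2 => absurd h1 h2.asymm) hs
    (by simpa using hlt) ?_
  refine (List.perm_ext_iff_of_nodup ((List.nodup_finRange _).filter _) (by simp [hlt.ne])).2
    fun g => ?_
  simp only [List.mem_filter, List.mem_finRange, true_and, decide_eq_true_eq, h g,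
    List.mem_cons, List.not_mem_nil, or_false]

/-- The content takes its arrows in the inherited order, while `π` may place them in the slots in
reverse. Antisymmetry turns each reversal into the same sign as in `sign_slots`, so all assignments
with the same tails contribute equally. -/
theorem coeff_eq (hP : ∀ i j, P j i = -P i j) {att : Fin s → Fin N} {dir : Fin E.length → Bool}
    (π : Fin (s + E.length) ≃ Fin n × Fin 2)
    (hπ : ∀ e, W.symm (Sum.inl (π e).1) = tail E att dir e) (ι : Fin (s + E.length) → Fin d)
    (v : Fin N) :
    (vertexContent W P φ v).coeff ((outgoing E att dir v).map ι) =
      (((W v).elim (fun b => if π.symm (b, 0) < π.symm (b, 1) then (1 : ℝ) else -1) fun _ => 1) •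
        contents P φ (fun t => ι (π.symm t)) (W v)).1 := by
  have hmem : ∀ g, tail E att dir g = v ↔ Sum.inl (π g).1 = W v := by
    intro g
    rw [← hπ, Equiv.symm_apply_eq]
  rcases h : W v with b | q
  · have h1 : ∀ g, tail E att dir g = v ↔ g = π.symm (b, 0) ∨ g = π.symm (b, 1) := by
      intro g
      rw [hmem, h, Sum.inl.injEq, Equiv.eq_symm_apply, Equiv.eq_symm_apply]
      constructor
      · intro h2
        rcases hk : π g with ⟨b', k⟩
        rw [hk] at h2
        subst h2
        fin_cases k <;> simp
      · rintro (h2 | h2) <;> rw [h2]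
    simp only [vertexContent, h, Sum.elim_inl, contents]
    split_ifs with hlt
    · rw [outgoing_eq_pair E hlt h1, one_smul]
      rfl
    · have hne : π.symm (b, 0) ≠ π.symm (b, 1) := π.symm.injective.ne (by simp)
      rw [outgoing_eq_pair E (lt_of_le_of_ne (not_lt.1 hlt) hne.symm)
        fun g => (h1 g).trans or_comm, neg_one_smul, ← hP]
      rfl
  · have h1 : outgoing E att dir v = [] := by
      rw [outgoing, List.filter_eq_nil_iff]
      intro g _
      simp [hmem, h]
    simp only [vertexContent, h, Sum.elim_inr, contents, h1, one_smul]
    rfl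

theorem sign_mul_jetEval (hP : ∀ i j, P j i = -P i j)
    (hW : StrictMono fun b : Fin n => W.symm (Sum.inl b)) (hlen : s + E.length = n * 2)
    (att : Fin s → Fin N) (dir : Fin E.length → Bool)
    (π : Fin (s + E.length) ≃ Fin n × Fin 2)
    (hπ : ∀ e, W.symm (Sum.inl (π e).1) = tail E att dir e) (ι : Fin (s + E.length) → Fin d) :
    ((Equiv.Perm.sign ((finCongr hlen).symm.trans (π.trans finProdFinEquiv)) : ℤ) : ℝ) *
      evalAt x (jetEval (contents P φ fun t => ι (π.symm t)) (∏ e, headSymb E W f x dir e (ι e))) =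
    orientationSign E att dir * ((∏ v : Fin N, iterPartial
        ((incoming (s := s) E dir (Sum.inl v)).map ι)
        ((vertexContent W P φ v).coeff ((outgoing E att dir v).map ι)) x) *
      ∏ j : Fin s, iterPartial ((incoming E dir (Sum.inr j)).map ι) (f j) x) := by
  rw [sign_slots hlen π _ hW (tail E att dir) hπ]
  have h1 : ∏ e, headSymb E W f x dir e (ι e) =
      C (∏ j, partialD (ι (Fin.castAdd _ j)) (f j) x) *
      ∏ e : Fin E.length, X ((fun e => (W (if dir e then (E.get e).2 else (E.get e).1),
        ι (Fin.natAdd s e))) e) := by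
    rw [Fin.prod_univ_add, map_prod]
    simp only [headSymb, Fin.append_left, Fin.append_right]
  have h2 : ∏ j : Fin s, iterPartial ((incoming E dir (Sum.inr j)).map ι) (f j) x =
      ∏ j, partialD (ι (Fin.castAdd _ j)) (f j) x := by
    refine Finset.prod_congr rfl fun j _ => ?_
    rw [incoming_inr]
    rfl
  have h3 : ∀ v, iterPartial ((incoming (s := s) E dir (Sum.inl v)).map ι)
        ((vertexContent W P φ v).coeff ((outgoing E att dir v).map ι)) x =
      (W v).elim (fun b => if π.symm (b, 0) < π.symm (b, 1) then (1 : ℝ) else -1) (fun _ => 1) *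
      evalAt x (iterDer (directions (W v) (Finset.univ.val.map fun e : Fin E.length =>
        (W (if dir e then (E.get e).2 else (E.get e).1), ι (Fin.natAdd s e))))
        (contents P φ (fun t => ι (π.symm t)) (W v))) := by
    intro v
    rw [coeff_eq E W P φ hP π hπ ι v, ← coe_iterDer, directions_heads, iterDer_smul]
    rfl
  rw [h1, ← smul_eq_C_mul, map_smul, map_smul, jetEval_prod_X, map_prod, h2]
  simp_rw [h3]
  rw [Finset.prod_mul_distrib, W.prod_comp fun h => Sum.elim (fun b =>
    if π.symm (b, 0) < π.symm (b, 1) then (1 : ℝ) else -1) (fun _ => 1) h,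
    W.prod_comp fun h => evalAt x (iterDer (directions h (Finset.univ.val.map
      fun e : Fin E.length => (W (if dir e then (E.get e).2 else (E.get e).1),
        ι (Fin.natAdd s e)))) (contents P φ (fun t => ι (π.symm t)) h)),
    Fintype.prod_sum_type (f := fun h => Sum.elim (fun b =>
    if π.symm (b, 0) < π.symm (b, 1) then (1 : ℝ) else -1) (fun _ => 1) h)]
  simp only [Sum.elim_inl, Sum.elim_inr, Finset.prod_const_one, mul_one, orientationSign,
    smul_eq_mul]
  ring

theorem iterPartial_zero (l : List (Fin d)) : iterPartial l (fun _ => (0 : ℝ)) = fun _ => 0 := by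
  have h := coe_iterDer l (0 : SmoothFn d)
  have h0 : iterDer (l : Multiset (Fin d)) (0 : SmoothFn d) = 0 := by
    have := iterDer_smul (l : Multiset (Fin d)) 0 (0 : SmoothFn d)
    rwa [zero_smul, zero_smul] at this
  rw [h0] at h
  exact h.symm

/-- If every vertex issued the right number of arrows, matching the fibres of `tail` with the slots
would give an assignment. So some vertex has a wrong number, and its coefficient is zero. -/
theorem directedGraphValue_eq_zero {att : Fin s → Fin N} {dir : Fin E.length → Bool}
    (h : ¬ ∃ π : Fin (s + E.length) ≃ Fin n × Fin 2,
      ∀ e, W.symm (Sum.inl (π e).1) = tail E att dir e) :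
    directedGraphValue E att dir (vertexContent W P φ) f x = 0 := by
  obtain ⟨v, hv⟩ : ∃ v, (outgoing E att dir v).length ≠ (W v).elim (fun _ => 2) fun _ => 0 := by
    by_contra! hall
    apply h
    have hcard : ∀ v, Fintype.card {e // tail E att dir e = v} =
        Fintype.card {t : Fin n × Fin 2 // W.symm (Sum.inl t.1) = v} := by
      intro v
      have h1 : Fintype.card {e // tail E att dir e = v} = (outgoing E att dir v).length := by
        rw [Fintype.card_subtype, outgoing, ← List.toFinset_card_of_nodup
          ((List.nodup_finRange _).filter _)]
        congr 1
        ext e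
        simp
      rw [h1, hall v, Fintype.card_subtype]
      rcases hw : W v with b | q
      · have : (Finset.univ.filter fun t : Fin n × Fin 2 => W.symm (Sum.inl t.1) = v) =
            ({b} : Finset (Fin n)) ×ˢ Finset.univ := by
          ext ⟨y, k⟩
          simp only [Finset.mem_filter, Finset.mem_univ, true_and, Finset.mem_product,
            Finset.mem_singleton, and_true, Equiv.symm_apply_eq, hw, Sum.inl.injEq]
        rw [this]
        simp
      · have : (Finset.univ.filter fun t : Fin n × Fin 2 => W.symm (Sum.inl t.1) = v) = ∅ := by
          ext ⟨y, k⟩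
          simp only [Finset.mem_filter, Finset.mem_univ, true_and, Equiv.symm_apply_eq, hw,
            reduceCtorEq, Finset.notMem_empty]
        rw [this]
        simp
    let π := Equiv.ofFiberEquiv (f := tail E att dir)
      (g := fun t : Fin n × Fin 2 => W.symm (Sum.inl t.1))
      fun v => Fintype.equivOfCardEq (hcard v)
    exact ⟨π, fun e => Equiv.ofFiberEquiv_map (g := fun t : Fin n × Fin 2 => W.symm (Sum.inl t.1))
      _ e⟩
  rw [directedGraphValue]
  refine Finset.sum_eq_zero fun ι _ => ?_
  have h1 : (vertexContent W P φ v).coeff ((outgoing E att dir v).map ι) = fun _ => 0 := by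
    have hl : ((outgoing E att dir v).map ι).length = (outgoing E att dir v).length :=
      List.length_map _
    rcases hw : W v with b | q
    · simp only [hw, Sum.elim_inl] at hv
      simp only [vertexContent, hw, Sum.elim_inl]
      rcases hlist : (outgoing E att dir v).map ι with _ | ⟨i, _ | ⟨j, _ | ⟨k, l⟩⟩⟩
      · rfl
      · rfl
      · rw [hlist] at hl; exact absurd hl.symm hv
      · rfl
    · simp only [hw, Sum.elim_inr] at hv
      simp only [vertexContent, hw, Sum.elim_inr]
      rcases hlist : (outgoing E att dir v).map ι with _ | ⟨i, l⟩
      · rw [hlist] at hl; exact absurd hl.symm hv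
      · rfl
  rw [Finset.prod_eq_zero (Finset.mem_univ v), zero_mul]
  rw [h1, iterPartial_zero]

theorem sum_comm_four {α β γ δ A : Type*} [Fintype α] [Fintype β] [Fintype γ] [Fintype δ]
    [AddCommMonoid A] (F : α → β → γ → δ → A) :
    ∑ a, ∑ b, ∑ c, ∑ e, F a b c e = ∑ c, ∑ e, ∑ b, ∑ a, F a b c e := by
  have h : ∀ b, ∑ a, ∑ c, ∑ e, F a b c e = ∑ c, ∑ e, ∑ a, F a b c e := fun b => by
    rw [Finset.sum_comm]
    exact Finset.sum_congr rfl fun c _ => Finset.sum_comm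
  rw [Finset.sum_comm]
  simp_rw [h]
  rw [Finset.sum_comm]
  exact Finset.sum_congr rfl fun c _ => Finset.sum_comm

/-- The orientation morphism is a sum of determinants. -/
theorem orientGraph_eq (hP : ∀ i j, P j i = -P i j)
    (hW : StrictMono fun b : Fin n => W.symm (Sum.inl b)) (hlen : s + E.length = n * 2) :
    2 ^ n * orientGraph E (vertexContent W P φ) f x =
      (orientList P φ (sinkRows f x ++ graphRows W E)).1 x := by
  let ε : Fin n × Fin 2 ≃ Fin (s + E.length) := finProdFinEquiv.trans (finCongr hlen.symm)
  let π : Equiv.Perm (Fin n × Fin 2) → (Fin (s + E.length) ≃ Fin n × Fin 2) :=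
    fun σ => ε.symm.trans σ.symm
  have hsign : ∀ σ, Equiv.Perm.sign ((finCongr hlen).symm.trans ((π σ).trans finProdFinEquiv)) =
      Equiv.Perm.sign σ := by
    intro σ
    have : (finCongr hlen).symm.trans ((π σ).trans finProdFinEquiv) =
        finProdFinEquiv.permCongr σ⁻¹ := by
      ext k
      simp [π, ε, Equiv.permCongr_apply, Equiv.Perm.inv_def]
    rw [this, Equiv.Perm.sign_permCongr, Equiv.Perm.sign_inv]
  -- In the Leibniz formula a permutation `σ` is read as the assignment `π σ` of arrows to slots.
  have hdet : ∀ idx : Fin n × Fin 2 → Fin d,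
      (rowMatrix (listRows (sinkRows f x ++ graphRows W E)) idx).det =
      ∑ σ, ∑ att : Fin s → Fin N, ∑ dir : Fin E.length → Bool,
        ((Equiv.Perm.sign σ : ℤ) : ℝ) • ∏ e, if W.symm (Sum.inl (π σ e).1) = tail E att dir e then
          headSymb E W f x dir e (idx (π σ e)) else 0 := by
    intro idx
    rw [Matrix.det_apply]
    refine Finset.sum_congr rfl fun σ _ => ?_
    simp_rw [← Finset.smul_sum]
    rw [← prod_arrowRow, Units.smul_def, Int.cast_smul_eq_zsmul]
    congr 1
    rw [← (π σ).prod_comp]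
    refine Finset.prod_congr rfl fun e _ => ?_
    have he : finProdFinEquiv.trans (finCongr hlen.symm) (σ (π σ e)) = e := by
      change ε (σ (σ.symm (ε.symm e))) = e
      rw [Equiv.apply_symm_apply, Equiv.apply_symm_apply]
    rw [rowMatrix, Matrix.of_apply, listRows_arrows E W f x hlen, he]
  change _ = evalAt x _
  rw [orientList, orientForm]
  simp_rw [hdet, map_sum, map_smul]
  rw [orientGraph, Finset.mul_sum, sum_comm_four]
  refine Finset.sum_congr rfl fun att _ => ?_
  rw [Finset.mul_sum]
  refine Finset.sum_congr rfl fun dir _ => ?_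
  have hterm : ∀ σ, (∑ idx : Fin n × Fin 2 → Fin d, ((Equiv.Perm.sign σ : ℤ) : ℝ) • evalAt x
      (jetEval (contents P φ idx)
        (∏ e, if W.symm (Sum.inl (π σ e).1) = tail E att dir e then
          headSymb E W f x dir e (idx (π σ e)) else 0))) =
      if ∀ e, W.symm (Sum.inl (σ.symm (ε.symm e)).1) = tail E att dir e then
        orientationSign E att dir * directedGraphValue E att dir (vertexContent W P φ) f x
      else 0 := by
    intro σ
    split_ifs with hσ
    · rw [directedGraphValue, Finset.mul_sum]
      refine Fintype.sum_equiv ((π σ).symm.arrowCongr (Equiv.refl _)) _ _ fun idx => ?_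
      rw [← sign_mul_jetEval E W P φ f x hP hW hlen att dir (π σ) hσ, hsign, smul_eq_mul]
      have h2 : (fun t => ((π σ).symm.arrowCongr (Equiv.refl (Fin d))) idx ((π σ).symm t)) =
          idx := by
        funext t
        change idx ((π σ) ((π σ).symm t)) = idx t
        rw [Equiv.apply_symm_apply]
      have h3 : ∀ e, (if W.symm (Sum.inl (π σ e).1) = tail E att dir e then
          headSymb E W f x dir e (idx (π σ e)) else 0) =
          headSymb E W f x dir e (((π σ).symm.arrowCongr (Equiv.refl (Fin d))) idx e) := by
        intro e
        exact if_pos (hσ e)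
      rw [h2, Finset.prod_congr rfl fun e _ => h3 e]
    · push Not at hσ
      obtain ⟨e, he⟩ := hσ
      refine Finset.sum_eq_zero fun idx _ => ?_
      rw [Finset.prod_eq_zero (Finset.mem_univ e) (if_neg he), map_zero, map_zero, smul_zero]
  rw [Finset.sum_congr rfl fun σ _ => hterm σ, ← Finset.sum_filter, Finset.sum_const, nsmul_eq_mul]
  -- A directed graph is hit by `2 ^ n` assignments or by none; in the latter case its value is
  -- zero.
  by_cases hex : ∃ σ₀ : Equiv.Perm (Fin n × Fin 2),
      ∀ e, W.symm (Sum.inl (σ₀.symm (ε.symm e)).1) = tail E att dir e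
  · obtain ⟨σ₀, h₀⟩ := hex
    have hcard := card_slots ε (fun b => W.symm (Sum.inl b)) hW.injective _ σ₀ h₀
    have hcast : (2 : ℝ) ^ n = ((2 ^ n : ℕ) : ℝ) := by push_cast; rfl
    rw [hcast, ← hcard]
    congr!
  · have hz : directedGraphValue E att dir (vertexContent W P φ) f x = 0 := by
      refine directedGraphValue_eq_zero E W P φ f x ?_
      rintro ⟨π', hπ'⟩
      exact hex ⟨(ε.trans π').symm, fun e => by simpa using hπ' e⟩
    rw [hz]; simp

end OrientGraph

/-! ### Nambu bi-vectors over differential rings -/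

section Nambu

variable {k : ℕ} {A : Type*} [CommRing A]

/-- The determinant with the first two rows `ξ`, `η`. -/
def pairDet (M : Fin k → Fin (k + 2) → A) (ξ η : Fin (k + 2) → A) : A :=
  Matrix.det (Matrix.of (Matrix.vecCons ξ (Matrix.vecCons η M)))

theorem pairDet_swap (M : Fin k → Fin (k + 2) → A) (ξ η : Fin (k + 2) → A) :
    pairDet M η ξ = -pairDet M ξ η := by
  have h := (Matrix.detRowAlternating (R := A)).map_swap
    (Matrix.vecCons ξ (Matrix.vecCons η M)) (i := 0) (j := 1) (by simp)
  rw [pairDet, pairDet]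
  refine Eq.trans ?_ h
  change Matrix.detRowAlternating _ = _
  congr 1
  funext i
  refine Fin.cases ?_ (fun i => Fin.cases ?_ (fun i => ?_) i) i
  · rw [Function.comp_apply, Equiv.swap_apply_left]; rfl
  · change _ = Matrix.vecCons ξ (Matrix.vecCons η M) (Equiv.swap 0 1 1)
    rw [Equiv.swap_apply_right]; rfl
  · rw [Function.comp_apply, Equiv.swap_apply_of_ne_of_ne (Fin.succ_ne_zero _)
      (by rw [← Fin.succ_zero_eq_one, Ne, Fin.succ_inj]; exact Fin.succ_ne_zero _)]
    rfl

theorem pairDet_left (M : Fin k → Fin (k + 2) → A) (ξ η : Fin (k + 2) → A) :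
    pairDet M ξ η = ∑ i, ξ i * pairDet M (Pi.single i 1) η := by
  have h1 : ∀ ζ, pairDet M ζ η = (Matrix.detRowAlternating (R := A)).toMultilinearMap.toLinearMap
      (Matrix.vecCons ξ (Matrix.vecCons η M)) 0 ζ := by
    intro ζ
    rw [MultilinearMap.toLinearMap_apply, Matrix.vecCons, Fin.update_cons_zero]
    rfl
  simp_rw [h1]
  rw [LinearMap.pi_apply_eq_sum_univ]
  refine Finset.sum_congr rfl fun i _ => ?_
  rw [smul_eq_mul]
  congr 2
  funext c
  simp [Pi.single_apply, eq_comm]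

theorem pairDet_eq_sum (M : Fin k → Fin (k + 2) → A) (ξ η : Fin (k + 2) → A) :
    pairDet M ξ η = ∑ i, ∑ j, ξ i * η j * pairDet M (Pi.single i 1) (Pi.single j 1) := by
  rw [pairDet_left]
  refine Finset.sum_congr rfl fun i _ => ?_
  rw [pairDet_swap, pairDet_left, ← Finset.sum_neg_distrib, Finset.mul_sum]
  refine Finset.sum_congr rfl fun j _ => ?_
  rw [pairDet_swap M (Pi.single i 1)]
  ring

theorem pairDet_eq_zero (M : Fin k → Fin (k + 2) → A) (l : Fin k) (η : Fin (k + 2) → A) :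
    pairDet M (M l) η = 0 := by
  refine Matrix.det_zero_of_row_eq (i := 0) (j := l.succ.succ) (Fin.succ_ne_zero _).symm ?_
  rfl

theorem pairDet_update (M : Fin k → Fin (k + 2) → A) (l : Fin k) (ξ η : Fin (k + 2) → A) :
    pairDet (Function.update M l ξ) (M l) η = -pairDet M ξ η := by
  have h := (Matrix.detRowAlternating (R := A)).map_swap
    (Matrix.vecCons ξ (Matrix.vecCons η M)) (i := 0) (j := l.succ.succ) (Fin.succ_ne_zero _).symm
  refine Eq.trans ?_ h
  change Matrix.detRowAlternating _ = _
  congr 1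
  funext i
  refine Fin.cases ?_ (fun i => Fin.cases ?_ (fun i => ?_) i) i
  · rw [Function.comp_apply, Equiv.swap_apply_left]; rfl
  · rw [Function.comp_apply, Equiv.swap_apply_of_ne_of_ne (by simp)
      (by rw [Ne, Fin.succ_inj]; exact (Fin.succ_ne_zero _).symm)]
    rfl
  · by_cases hi : i = l
    · subst hi
      rw [Function.comp_apply, Equiv.swap_apply_right]
      exact Function.update_self _ _ _
    · rw [Function.comp_apply, Equiv.swap_apply_of_ne_of_ne (Fin.succ_ne_zero _) (by simpa using hi)]
      exact Function.update_of_ne hi _ _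

theorem map_pairDet {B : Type*} [CommRing B] (f : A →+* B) (M : Fin k → Fin (k + 2) → A)
    (ξ η : Fin (k + 2) → A) :
    f (pairDet M ξ η) = pairDet (fun l c => f (M l c)) (f ∘ ξ) (f ∘ η) := by
  rw [pairDet, RingHom.map_det, pairDet]
  congr 1
  ext i c
  refine Fin.cases ?_ (fun i => Fin.cases ?_ (fun i => ?_) i) i <;> rfl

variable [Algebra ℝ A] [DiffRing (k + 2) A]

/-- The gradients of the Casimirs. -/
def gradients (a : Fin k → A) (l : Fin k) (c : Fin (k + 2)) : A := DiffRing.der c (a l)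

theorem gradients_update (a : Fin k → A) (l : Fin k) (b : A) :
    gradients (Function.update a l b) = Function.update (gradients a) l fun c => DiffRing.der c b := by
  funext m c
  by_cases h : m = l
  · subst h; simp [gradients]
  · simp [gradients, h]

/-- The components of the Nambu bi-vector. -/
def nambuField (ϱ : A) (a : Fin k → A) (i j : Fin (k + 2)) : A :=
  ϱ * pairDet (gradients a) (Pi.single i 1) (Pi.single j 1)

theorem nambuField_swap (ϱ : A) (a : Fin k → A) (i j : Fin (k + 2)) :
    nambuField ϱ a j i = -nambuField ϱ a i j := by
  rw [nambuField, pairDet_swap, mul_neg, nambuField]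

theorem sum_nambuField_mul (ϱ : A) (a : Fin k → A) (ξ : Fin (k + 2) → A) (j : Fin (k + 2)) :
    ∑ i, nambuField ϱ a i j * ξ i = ϱ * pairDet (gradients a) ξ (Pi.single j 1) := by
  rw [pairDet_left, Finset.mul_sum]
  refine Finset.sum_congr rfl fun i _ => ?_
  rw [nambuField]; ring

theorem sum_nambuField_casimir (ϱ : A) (a : Fin k → A) (l : Fin k) (j : Fin (k + 2)) :
    ∑ i, nambuField ϱ a i j * DiffRing.der i (a l) = 0 := by
  rw [sum_nambuField_mul]
  exact (congrArg _ (pairDet_eq_zero (gradients a) l (Pi.single j 1))).trans (mul_zero _)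

/-- The change of the Nambu bi-vector under the velocities `b` of the Casimirs. -/
def casimirField (ϱ : A) (a b : Fin k → A) (i j : Fin (k + 2)) : A :=
  ∑ l, nambuField ϱ (Function.update a l (b l)) i j

/-- For `m ≠ l` the determinant still contains the row of `a l` and gets it twice. For `m = l`,
interchanging the rows of `a l` and `b l` produces the sign. -/
theorem sum_casimirField_casimir (ϱ : A) (a b : Fin k → A) (l : Fin k) (j : Fin (k + 2)) :
    ∑ i, casimirField ϱ a b i j * DiffRing.der i (a l) =
      -∑ i, nambuField ϱ a i j * DiffRing.der i (b l) := by
  simp_rw [casimirField, Finset.sum_mul]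
  rw [Finset.sum_comm, Finset.sum_eq_single l]
  · rw [sum_nambuField_mul, sum_nambuField_mul, gradients_update, ← mul_neg,
      ← pairDet_update (gradients a) l]
    rfl
  · intro m _ hm
    have h := sum_nambuField_casimir ϱ (Function.update a m (b m)) l j
    rwa [Function.update_of_ne hm.symm] at h
  · simp

/-- The Jacobi identity for `P`. -/
def IsPoisson {d : ℕ} [DiffRing d A] (P : Fin d → Fin d → A) : Prop :=
  ∀ i j l, ∑ k, (P k i * DiffRing.der k (P j l) + P k j * DiffRing.der k (P l i) +
      P k l * DiffRing.der k (P i j)) = 0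

/-- The Jacobiator is invariant under cyclic permutations and odd under transpositions of its
indices. -/
theorem isPoisson_of_lt {d : ℕ} [DiffRing d A] {P : Fin d → Fin d → A}
    (hP : ∀ i j, P j i = -P i j)
    (h : ∀ i j l, i < j → j < l → ∑ k, (P k i * DiffRing.der k (P j l) +
      P k j * DiffRing.der k (P l i) + P k l * DiffRing.der k (P i j)) = 0) : IsPoisson P := by
  let J : Fin d → Fin d → Fin d → A := fun i j l => ∑ k, (P k i * DiffRing.der k (P j l) +
      P k j * DiffRing.der k (P l i) + P k l * DiffRing.der k (P i j))
  have hc : ∀ i j l, J i j l = J j l i := fun i j l => Finset.sum_congr rfl fun k _ => by ring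
  have hs : ∀ i j l, J j i l = -J i j l := by
    intro i j l
    rw [← Finset.sum_neg_distrib]
    refine Finset.sum_congr rfl fun k _ => ?_
    rw [hP l i, hP j l, hP i j, map_neg, map_neg, map_neg]
    ring
  have h0 : ∀ i l, J i i l = 0 := by
    intro i l
    have h1 : (2 : ℝ) • J i i l = 0 := by
      rw [two_smul]
      nth_rewrite 1 [hs i i l]
      exact neg_add_cancel _
    exact (smul_eq_zero.1 h1).resolve_left (by norm_num)
  have h' : ∀ i j l, i < j → j < l → J i j l = 0 := h
  have h2 : ∀ i j l, i < j → J i j l = 0 := by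
    intro i j l hij
    rcases lt_trichotomy j l with hl | rfl | hl
    · exact h' i j l hij hl
    · rw [hc]; exact h0 _ _
    · rcases lt_trichotomy i l with hi | rfl | hi
      · rw [hc, hc, hs, h' i l j hi hl, neg_zero]
      · rw [hc, hc]; exact h0 _ _
      · rw [hc, hc]; exact h' l i j hi hij
  intro i j l
  change J i j l = 0
  rcases lt_trichotomy i j with hij | rfl | hij
  · exact h2 i j l hij
  · exact h0 _ _
  · rw [hs, h2 j i l hij, neg_zero]

end Nambu

/-! ### The Jacobi identity for Nambu bi-vectors in dimensions three and four. -/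

theorem pairDet_three {A : Type*} [CommRing A] (M : Fin 1 → Fin 3 → A) (ξ η : Fin 3 → A) :
    pairDet (k := 1) M ξ η = (ξ 1 * η 2 - ξ 2 * η 1) * M 0 0 + (ξ 2 * η 0 - ξ 0 * η 2) * M 0 1 +
      (ξ 0 * η 1 - ξ 1 * η 0) * M 0 2 := by
  change Matrix.det (n := Fin 3) _ = _
  rw [Matrix.det_fin_three]
  change ξ 0 * η 1 * M 0 2 - ξ 0 * η 2 * M 0 1 - ξ 1 * η 0 * M 0 2 + ξ 1 * η 2 * M 0 0 +
    ξ 2 * η 0 * M 0 1 - ξ 2 * η 1 * M 0 0 = _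
  ring

theorem isPoisson_nambuField_three {A : Type*} [CommRing A] [Algebra ℝ A] [DiffRing 3 A] (ϱ : A)
    (a : Fin 1 → A) : IsPoisson (d := 3) (nambuField (k := 1) ϱ a) := by
  refine isPoisson_of_lt (nambuField_swap ϱ a) fun i j l hij hjl => ?_
  obtain ⟨rfl, rfl, rfl⟩ : i = 0 ∧ j = 1 ∧ l = 2 := by omega
  simp only [nambuField, pairDet_three, gradients, Fin.sum_univ_three]
  simp [DiffRing.der_comm 1 0, DiffRing.der_comm 2 0, DiffRing.der_comm 2 1]
  ring

theorem pairDet_four {A : Type*} [CommRing A] (M : Fin 2 → Fin 4 → A) (ξ η : Fin 4 → A) :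
    pairDet (k := 2) M ξ η =
      (ξ 0 * η 1 - ξ 1 * η 0) * (M 0 2 * M 1 3 - M 0 3 * M 1 2) -
      (ξ 0 * η 2 - ξ 2 * η 0) * (M 0 1 * M 1 3 - M 0 3 * M 1 1) +
      (ξ 0 * η 3 - ξ 3 * η 0) * (M 0 1 * M 1 2 - M 0 2 * M 1 1) +
      (ξ 1 * η 2 - ξ 2 * η 1) * (M 0 0 * M 1 3 - M 0 3 * M 1 0) -
      (ξ 1 * η 3 - ξ 3 * η 1) * (M 0 0 * M 1 2 - M 0 2 * M 1 0) +
      (ξ 2 * η 3 - ξ 3 * η 2) * (M 0 0 * M 1 1 - M 0 1 * M 1 0) := by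
  have h : pairDet (k := 2) M ξ η = Matrix.det (Matrix.of ![ξ, η, M 0, M 1]) := by
    refine congrArg Matrix.det (funext fun i => ?_)
    fin_cases i <;> rfl
  rw [h, Matrix.det_succ_row_zero, Fin.sum_univ_four]
  simp [Matrix.det_fin_three, Fin.succAbove, Fin.lt_def]
  ring

theorem isPoisson_nambuField_four {A : Type*} [CommRing A] [Algebra ℝ A] [DiffRing 4 A] (ϱ : A)
    (a : Fin 2 → A) : IsPoisson (d := 4) (nambuField (k := 2) ϱ a) := by
  refine isPoisson_of_lt (nambuField_swap ϱ a) fun i j l hij hjl => ?_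
  have hN : ∀ i j, nambuField (k := 2) ϱ a i j = ϱ * _ := fun i j =>
    congrArg (ϱ * ·) (pairDet_four (gradients (k := 2) a) (Pi.single i 1) (Pi.single j 1))
  obtain ⟨rfl, rfl, rfl⟩ | ⟨rfl, rfl, rfl⟩ | ⟨rfl, rfl, rfl⟩ | ⟨rfl, rfl, rfl⟩ :
      (i = 0 ∧ j = 1 ∧ l = 2) ∨ (i = 0 ∧ j = 1 ∧ l = 3) ∨ (i = 0 ∧ j = 2 ∧ l = 3) ∨
      (i = 1 ∧ j = 2 ∧ l = 3) := by omega
  all_goals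
    simp only [hN, gradients, Fin.sum_univ_four]
    simp [DiffRing.der_comm 1 0, DiffRing.der_comm 2 0, DiffRing.der_comm 2 1,
      DiffRing.der_comm 3 0, DiffRing.der_comm 3 1, DiffRing.der_comm 3 2]
    ring

/-! ### Iterated derivatives along multi-indices -/

section MultiIndex

variable {d : ℕ} {R : Type*} [CommRing R] [Algebra ℝ R] [DiffRing d R]

/-- The derivatives in the directions of `l`, as many times as the multi-index says. -/
def foldDer (l : List (Fin d)) (α : Fin d → ℕ) (r : R) : R :=
  l.foldr (fun i r => (fun r => DiffRing.der i r)^[α i] r) r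

theorem der_iterate (i j : Fin d) (m : ℕ) (r : R) :
    DiffRing.der i ((fun r => DiffRing.der j r)^[m] r) =
      (fun r => DiffRing.der j r)^[m] (DiffRing.der i r) := by
  have h : Function.Commute (fun r : R => DiffRing.der i r) fun r => DiffRing.der j r :=
    fun r => DiffRing.der_comm i j r
  exact (h.iterate_right m) r

theorem foldDer_single (l : List (Fin d)) (hl : l.Nodup) (α : Fin d → ℕ) (i : Fin d) (r : R) :
    foldDer l (α + Pi.single i 1) r =
      if i ∈ l then DiffRing.der i (foldDer l α r) else foldDer l α r := by
  induction l with
  | nil => rfl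
  | cons j l ih =>
    have ih := ih hl.of_cons
    change (fun r => DiffRing.der j r)^[(α + Pi.single i 1 : Fin d → ℕ) j] (foldDer l _ r) =
      if i ∈ j :: l then DiffRing.der i ((fun r => DiffRing.der j r)^[α j] (foldDer l α r))
      else (fun r => DiffRing.der j r)^[α j] (foldDer l α r)
    rw [ih]
    by_cases hij : j = i
    · subst hij
      rw [if_neg (List.nodup_cons.1 hl).1, if_pos List.mem_cons_self, Pi.add_apply,
        Pi.single_eq_same, Function.iterate_succ_apply']
    · rw [Pi.add_apply, Pi.single_eq_of_ne hij, add_zero, der_iterate]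
      have : i = j ∨ i ∈ l ↔ i ∈ l := or_iff_right (Ne.symm hij)
      simp only [List.mem_cons, this]
      split_ifs <;> rfl

/-- The derivative along a multi-index. -/
def multiDer (α : Fin d → ℕ) (r : R) : R := foldDer (List.finRange d) α r

theorem der_multiDer (α : Fin d → ℕ) (i : Fin d) (r : R) :
    DiffRing.der i (multiDer α r) = multiDer (α + Pi.single i 1) r := by
  rw [multiDer, multiDer, foldDer_single _ (List.nodup_finRange d), if_pos (List.mem_finRange i)]

theorem multiDer_zero (r : R) : multiDer (0 : Fin d → ℕ) r = r := by
  have h : ∀ l : List (Fin d), foldDer l 0 r = r := by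
    intro l
    induction l with
    | nil => rfl
    | cons i l ih => exact ih
  exact h _

theorem coe_multiDer (α : Fin d → ℕ) (f : SmoothFn d) :
    (multiDer α f).1 = multiPartial α f.1 := by
  have h : ∀ l : List (Fin d),
      (foldDer l α f).1 = l.foldr (fun i h => (partialD i)^[α i] h) f.1 := by
    intro l
    induction l with
    | nil => rfl
    | cons i l ih =>
      rw [List.foldr_cons, ← ih]
      have h1 : ∀ (m : ℕ) (g : SmoothFn d), ((fun r : SmoothFn d => DiffRing.der i r)^[m] g).1 =
          (partialD i)^[m] g.1 := by
        intro m
        induction m with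
        | zero => intro g; rfl
        | succ m ihm => intro g; rw [Function.iterate_succ_apply, ihm, Function.iterate_succ_apply]; rfl
      exact h1 _ _
  exact h _

end MultiIndex

/-! ### The differential ring of differential polynomials -/

section Jets

variable {k : ℕ}

/-- The total derivative. -/
def totalDer (i : Fin (k + 2)) : Derivation ℝ (DiffPoly k) (DiffPoly k) :=
  mkDerivation ℝ fun v => X (v.1, v.2 + Pi.single i 1)

theorem totalDer_X (i : Fin (k + 2)) (v : Option (Fin k) × (Fin (k + 2) → ℕ)) :
    totalDer i (X v) = X (v.1, v.2 + Pi.single i 1) := mkDerivation_X _ _ _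

instance : DiffRing (k + 2) (DiffPoly k) where
  der := totalDer
  der_comm i j r := by
    have h : ⁅totalDer i, totalDer j⁆ = (0 : Derivation ℝ (DiffPoly k) (DiffPoly k)) := by
      refine derivation_ext fun v => ?_
      rw [Derivation.commutator_apply, totalDer_X, totalDer_X, totalDer_X, totalDer_X,
        add_right_comm, sub_self]
      rfl
    have h1 := congrArg (fun D => D r) h
    rw [Derivation.commutator_apply] at h1
    exact sub_eq_zero.1 h1

/-- The density and the Casimirs as differential polynomials. -/
def jetVar (q : Option (Fin k)) : DiffPoly k := X (q, 0)

theorem der_jetVar (i : Fin (k + 2)) (q : Option (Fin k)) :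
    DiffRing.der i (jetVar q : DiffPoly k) = X (q, Pi.single i 1) := by
  rw [jetVar]
  refine (totalDer_X _ _).trans ?_
  rw [zero_add]

/-- The value of differential polynomials at smooth functions. -/
def jetHom (u : Option (Fin k) → SmoothFn (k + 2)) : DiffPoly k →ₐ[ℝ] SmoothFn (k + 2) :=
  aeval fun v => multiDer v.2 (u v.1)

theorem jetHom_jetVar (u : Option (Fin k) → SmoothFn (k + 2)) (q : Option (Fin k)) :
    jetHom u (jetVar q) = u q := by
  rw [jetVar, jetHom, aeval_X, multiDer_zero]

/-- Substitution is a homomorphism of differential rings, so an identity proved once for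
indeterminate `ϱ` and `a` holds for all smooth ones. -/
theorem jetHom_der (u : Option (Fin k) → SmoothFn (k + 2)) (i : Fin (k + 2)) (p : DiffPoly k) :
    jetHom u (DiffRing.der i p) = DiffRing.der i (jetHom u p) := by
  induction p using MvPolynomial.induction_on with
  | C c =>
    change jetHom u (DiffRing.der i (algebraMap ℝ (DiffPoly k) c)) =
      DiffRing.der i (jetHom u (algebraMap ℝ (DiffPoly k) c))
    rw [Derivation.map_algebraMap, AlgHom.commutes, Derivation.map_algebraMap, map_zero]
  | add p q hp hq => rw [map_add, map_add, map_add, map_add, hp, hq]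
  | mul_X p v hp =>
    have hX : jetHom u (DiffRing.der i (X v : DiffPoly k)) = DiffRing.der i (jetHom u (X v)) := by
      change jetHom u (totalDer i (X v)) = _
      rw [totalDer_X, jetHom, aeval_X, aeval_X, der_multiDer]
    rw [Derivation.leibniz, map_add, map_mul, Derivation.leibniz, smul_eq_mul, smul_eq_mul,
      smul_eq_mul, smul_eq_mul, map_mul, map_mul, hp, hX]

theorem jetHom_apply (u : Option (Fin k) → SmoothFn (k + 2)) (p : DiffPoly k) (x : Fin (k + 2) → ℝ) :
    (jetHom u p).1 x = p.value (u none).1 (fun l => (u (some l)).1) x := by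
  rw [← evalAt_apply, jetHom, comp_aeval_apply, DiffPoly.value, ← coe_aeval_eq_eval]
  change aeval _ p = aeval _ p
  congr 2
  funext v
  rw [evalAt_apply, coe_multiDer]
  rcases v with ⟨_ | l, α⟩ <;> rfl

end Jets

/-! ### Bi-vectors that annihilate all Casimirs -/

/-- The relation at `i₁` shows that the prime `N i₀` divides `V i₀ * N i₁`, hence `V i₀`. The
quotient is the common factor. -/
theorem exists_eq_mul_of_prime {ι A : Type*} [CommRing A] [IsDomain A] {V N : ι → A} {i₀ i₁ : ι}
    (hN : Prime (N i₀)) (h₁ : ¬ N i₀ ∣ N i₁) (h : ∀ i, V i * N i₀ = V i₀ * N i) :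
    ∃ r, ∀ i, V i = r * N i := by
  have h2 : N i₀ ∣ V i₀ := (hN.dvd_or_dvd ⟨V i₁, by rw [← h i₁, mul_comm]⟩).resolve_right h₁
  obtain ⟨r, hr⟩ := h2
  refine ⟨r, fun i => mul_right_cancel₀ hN.ne_zero ?_⟩
  rw [h i, hr]
  ring

theorem not_dvd_of_eval {σ : Type*} {p q : MvPolynomial σ ℝ} (y : σ → ℝ) (hp : eval y p = 0)
    (hq : eval y q ≠ 0) : ¬ p ∣ q := by
  rintro ⟨r, rfl⟩
  rw [map_mul, hp, zero_mul] at hq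
  exact hq rfl

theorem mul_pairDet_three {A : Type*} [CommRing A] {V : Fin 3 → Fin 3 → A} {b : Fin 3 → A}
    (hV : ∀ i j, V j i = -V i j) (h0 : ∀ i, V i i = 0) (h : ∀ j, ∑ i, V i j * b i = 0)
    (i j : Fin 3) :
    V i j * b 2 = V 0 1 * pairDet (k := 1) (fun _ => b) (Pi.single i 1) (Pi.single j 1) := by
  have e0 := h 0
  have e1 := h 1
  have e2 := h 2
  rw [Fin.sum_univ_three, h0, hV 0 1, hV 0 2] at e0
  rw [Fin.sum_univ_three, h0, hV 1 2] at e1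
  rw [pairDet_three]
  fin_cases i <;> fin_cases j <;> simp [h0, hV 0 1, hV 0 2, hV 1 2]
  · linear_combination -e0
  · linear_combination -e1
  · linear_combination e0
  · linear_combination -e1

/-- Elimination in the linear system without division: the minor of `b` and `c` in columns `2`, `3`
multiplies each component. The vanishing diagonal is assumed separately because antisymmetry does
not imply it in a general ring. -/
theorem mul_pairDet_four {A : Type*} [CommRing A] {V : Fin 4 → Fin 4 → A} {b c : Fin 4 → A}
    (hV : ∀ i j, V j i = -V i j) (h0 : ∀ i, V i i = 0) (hb : ∀ j, ∑ i, V i j * b i = 0)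
    (hc : ∀ j, ∑ i, V i j * c i = 0) (i j : Fin 4) :
    V i j * (b 2 * c 3 - b 3 * c 2) =
      V 0 1 * pairDet (k := 2) ![b, c] (Pi.single i 1) (Pi.single j 1) := by
  have b0 := hb 0
  have b1 := hb 1
  have b2 := hb 2
  have b3 := hb 3
  have c0 := hc 0
  have c1 := hc 1
  have c2 := hc 2
  have c3 := hc 3
  rw [Fin.sum_univ_four, h0, hV 0 1, hV 0 2, hV 0 3] at b0 c0
  rw [Fin.sum_univ_four, h0, hV 1 2, hV 1 3] at b1 c1
  rw [Fin.sum_univ_four, h0, hV 2 3] at b2 c2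
  rw [Fin.sum_univ_four, h0] at b3 c3
  have e02 : V 0 2 * (b 2 * c 3 - b 3 * c 2) = -(V 0 1 * (b 1 * c 3 - b 3 * c 1)) := by
    linear_combination b 3 * c0 - c 3 * b0
  have e03 : V 0 3 * (b 2 * c 3 - b 3 * c 2) = V 0 1 * (b 1 * c 2 - b 2 * c 1) := by
    linear_combination c 2 * b0 - b 2 * c0
  have e12 : V 1 2 * (b 2 * c 3 - b 3 * c 2) = V 0 1 * (b 0 * c 3 - b 3 * c 0) := by
    linear_combination b 3 * c1 - c 3 * b1
  have e13 : V 1 3 * (b 2 * c 3 - b 3 * c 2) = -(V 0 1 * (b 0 * c 2 - b 2 * c 0)) := by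
    linear_combination c 2 * b1 - b 2 * c1
  have e23 : V 2 3 * (b 2 * c 3 - b 3 * c 2) = V 0 1 * (b 0 * c 1 - b 1 * c 0) := by
    linear_combination c 3 * b3 + c 2 * b2 + b 0 * c0 + b 1 * c1
  rw [pairDet_four]
  fin_cases i <;> fin_cases j <;>
    simp [h0, hV 0 1, hV 0 2, hV 0 3, hV 1 2, hV 1 3, hV 2 3, e02, e03, e12, e13, e23] <;> ring

/-- Differential polynomial bi-vectors that annihilate the Casimirs are multiples of the Nambu
determinant. -/
def CasimirDivisible (k : ℕ) : Prop :=
  ∀ V : Fin (k + 2) → Fin (k + 2) → DiffPoly k, (∀ i j, V j i = -V i j) →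
    (∀ l j, ∑ i, V i j * DiffRing.der i (jetVar (some l) : DiffPoly k) = 0) →
    ∃ r : DiffPoly k, ∀ i j, V i j = nambuField r (fun l => jetVar (some l)) i j

theorem piSingle_one_inj {d : ℕ} {i j : Fin d} :
    (Pi.single i 1 : Fin d → ℕ) = Pi.single j 1 ↔ i = j := by
  refine ⟨fun h => ?_, fun h => h ▸ rfl⟩
  by_contra hij
  have := congrFun h i
  rw [Pi.single_eq_same, Pi.single_eq_of_ne hij] at this
  exact one_ne_zero this

theorem casimirDivisible_one : CasimirDivisible 1 := by
  intro V hV h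
  have h1 := mul_pairDet_three (V := V) (b := fun c => X (some 0, Pi.single c 1)) hV
    (fun i => self_eq_neg.1 (hV i i)) fun j => by simpa only [der_jetVar] using h 0 j
  have hb : (fun _ c => X (some 0, Pi.single c 1)) =
      gradients (k := 1) fun l => (jetVar (some l) : DiffPoly 1) := by
    funext l c
    rw [gradients, der_jetVar, Subsingleton.elim l 0]
  have hN : ∀ j : Fin 3, pairDet (k := 1) (fun _ c => (X (some 0, Pi.single c 1) : DiffPoly 1))
      (Pi.single 0 1) (Pi.single j 1) = _ := fun j => pairDet_three _ _ _
  obtain ⟨r, hr⟩ := exists_eq_mul_of_prime (V := fun p : Fin 3 × Fin 3 => V p.1 p.2)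
    (N := fun p => pairDet (k := 1) (fun _ c => (X (some 0, Pi.single c 1) : DiffPoly 1))
      (Pi.single p.1 1) (Pi.single p.2 1)) (i₀ := (0, 1)) (i₁ := (0, 2))
    (by simpa [hN] using X_prime)
    (by
      simp only [hN]
      -- The `(0, 1)` component is the variable for `∂_2 a`, the `(0, 2)` component is minus that
      -- for `∂_1 a`; only the former vanishes at this point.
      refine not_dvd_of_eval (fun v => if v = (some 0, Pi.single 2 1) then 0 else 1) ?_ ?_
      · simp
      · simp [piSingle_one_inj])
    (fun p => by simpa [hN] using h1 p.1 p.2)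
  refine ⟨r, fun i j => ?_⟩
  rw [nambuField, ← hb]
  exact hr (i, j)

/-- The polynomial has degree one in `X q`, and its leading coefficient `X p` is coprime to the
remainder. So it is irreducible, hence prime. -/
theorem prime_minor {σ : Type*} {p q r s : σ} (hpq : p ≠ q) (hpr : p ≠ r) (hps : p ≠ s)
    (hqr : q ≠ r) (hqs : q ≠ s) :
    Prime (X p * X q - X r * X s : MvPolynomial σ ℝ) := by
  classical
  refine Irreducible.prime ?_
  rw [sub_eq_add_neg]
  refine irreducible_mul_X_add _ _ q (X_ne_zero p) (by simpa using hpq.symm) ?_ ?_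
  · rw [vars_neg]
    intro h
    have := vars_mul _ _ h
    simp [hqr, hqs] at this
  · refine (X_prime.irreducible.isRelPrime_iff_not_dvd).2 fun h => ?_
    rw [dvd_neg] at h
    rcases X_prime.dvd_or_dvd h with h | h
    · exact hpr (X_dvd_X.1 h)
    · exact hps (X_dvd_X.1 h)

theorem casimirDivisible_two : CasimirDivisible 2 := by
  intro V hV h
  have h1 := mul_pairDet_four (V := V) (b := fun c => X (some 0, Pi.single c 1))
    (c := fun c => X (some 1, Pi.single c 1)) hV
    (fun i => self_eq_neg.1 (hV i i)) (fun j => by simpa only [der_jetVar] using h 0 j)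
    fun j => by simpa only [der_jetVar] using h 1 j
  have hb : ![fun c => X (some 0, Pi.single c 1), fun c => X (some 1, Pi.single c 1)] =
      gradients (k := 2) fun l => (jetVar (some l) : DiffPoly 2) := by
    funext l c
    rw [gradients, der_jetVar]
    fin_cases l <;> rfl
  have hN : ∀ j : Fin 4, pairDet (k := 2) ![fun c => (X (some 0, Pi.single c 1) : DiffPoly 2),
      fun c => X (some 1, Pi.single c 1)] (Pi.single 0 1) (Pi.single j 1) = _ :=
    fun j => pairDet_four _ _ _
  obtain ⟨r, hr⟩ := exists_eq_mul_of_prime (V := fun p : Fin 4 × Fin 4 => V p.1 p.2)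
    (N := fun p => pairDet (k := 2) ![fun c => (X (some 0, Pi.single c 1) : DiffPoly 2),
      fun c => X (some 1, Pi.single c 1)]
      (Pi.single p.1 1) (Pi.single p.2 1)) (i₀ := (0, 1)) (i₁ := (0, 2))
    (by
      simp only [hN]
      simpa using prime_minor (by simp) (by simp [piSingle_one_inj]) (by simp) (by simp)
        (by simp [piSingle_one_inj]))
    (by
      simp only [hN]
      -- At this point only `∂_1 a_0` and `∂_3 a_1` are nonzero, so the minor in columns `2`, `3`
      -- vanishes but the one in columns `1`, `3` does not.
      refine not_dvd_of_eval (fun v => if v = (some 0, Pi.single 1 1) ∨ v = (some 1, Pi.single 3 1)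
        then 1 else 0) ?_ ?_
      · simp [piSingle_one_inj]
      · simp [piSingle_one_inj])
    (fun p => by simpa [hN] using h1 p.1 p.2)
  refine ⟨r, fun i j => ?_⟩
  rw [nambuField, ← hb]
  exact hr (i, j)

/-! ### Naturality -/

section Naturality

variable {n d k : ℕ} {R R' : Type*} [CommRing R] [Algebra ℝ R] [CommRing R'] [Algebra ℝ R']

theorem map_flowComponent [DiffRing d R] [DiffRing d R'] (f : R →ₐ[ℝ] R')
    (hf : ∀ (i : Fin d) r, f (DiffRing.der i r) = DiffRing.der i (f r)) (P : Fin d → Fin d → R)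
    (γ : GraphSum n) (i j : Fin d) :
    f (flowComponent P γ i j) = flowComponent (fun i j => f (P i j)) γ i j := by
  rw [flowComponent, flowComponent, map_list_sum, List.map_map]
  congr 1
  refine List.map_congr_left fun t _ => ?_
  rw [Function.comp_apply, map_smul, map_orientList P _ f hf]
  congr 2
  exact funext fun q => q.elim

theorem map_velocityForm [DiffRing d R] [DiffRing d R'] (f : R →ₐ[ℝ] R')
    (hf : ∀ (i : Fin d) r, f (DiffRing.der i r) = DiffRing.der i (f r)) (P : Fin d → Fin d → R)
    (a : R) (γ : GraphSum (n + 1)) :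
    f (velocityForm P a γ) = velocityForm (fun i j => f (P i j)) (f a) γ := by
  rw [velocityForm, velocityForm, map_list_sum, List.map_map]
  congr 1
  refine List.map_congr_left fun t _ => ?_
  rw [Function.comp_apply, map_smul, map_sum]
  congr 1
  exact Finset.sum_congr rfl fun v _ => map_orientList P _ f hf _

theorem map_nambuField [DiffRing (k + 2) R] [DiffRing (k + 2) R'] (f : R →ₐ[ℝ] R')
    (hf : ∀ (i : Fin (k + 2)) r, f (DiffRing.der i r) = DiffRing.der i (f r)) (ϱ : R) (a : Fin k → R)
    (i j : Fin (k + 2)) : f (nambuField ϱ a i j) = nambuField (f ϱ) (fun l => f (a l)) i j := by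
  have hs : ∀ i : Fin (k + 2), f ∘ (Pi.single i 1) = (Pi.single i 1 : Fin (k + 2) → R') := by
    intro i
    funext c
    by_cases h : c = i
    · subst h; simp
    · simp [h]
  have h1 := map_pairDet (f : R →+* R') (gradients a) (Pi.single i 1) (Pi.single j 1)
  rw [nambuField, nambuField, map_mul]
  congr 1
  refine h1.trans ?_
  rw [RingHom.coe_coe, hs, hs]
  congr 1
  funext l c
  exact hf c (a l)

theorem map_casimirField [DiffRing (k + 2) R] [DiffRing (k + 2) R'] (f : R →ₐ[ℝ] R')
    (hf : ∀ (i : Fin (k + 2)) r, f (DiffRing.der i r) = DiffRing.der i (f r)) (ϱ : R)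
    (a b : Fin k → R) (i j : Fin (k + 2)) :
    f (casimirField ϱ a b i j) = casimirField (f ϱ) (fun l => f (a l)) (fun l => f (b l)) i j := by
  rw [casimirField, casimirField, map_sum]
  refine Finset.sum_congr rfl fun l _ => ?_
  rw [map_nambuField f hf]
  congr 1
  exact Function.comp_update f a l (b l)

theorem flowComponent_swap [DiffRing d R] (hn : 0 < n) (P : Fin d → Fin d → R) (γ : GraphSum n)
    (i j : Fin d) : flowComponent P γ j i = -flowComponent P γ i j := by
  have h : ∀ t : ℝ × OrderedGraph n, orientList P Empty.elim (constRow (Pi.single j 1) ::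
      constRow (Pi.single i 1) :: graphRows Sum.inl t.2) = -orientList P Empty.elim
      (constRow (Pi.single i 1) :: constRow (Pi.single j 1) :: graphRows Sum.inl t.2) := fun t =>
    orientList_swap P Empty.elim [] _ _ _ (by simp; omega)
  rw [flowComponent, flowComponent]
  simp_rw [h, smul_neg]
  induction γ with
  | nil => simp
  | cons t γ ih => rw [List.map_cons, List.sum_cons, ih, List.map_cons, List.sum_cons, neg_add]

end Naturality

/-! ### The evolution of the density -/

section Density

variable {n k : ℕ}

/-- The Nambu bi-vector with indeterminate density and Casimirs. -/
def universalNambu (k : ℕ) : Fin (k + 2) → Fin (k + 2) → DiffPoly k :=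
  nambuField (jetVar none) fun l => jetVar (some l)

/-- The velocity of a Casimir as a differential polynomial. -/
def velocityPoly (γ : GraphSum (n + 1)) (l : Fin k) : DiffPoly k :=
  ((1 / 2 : ℝ) ^ n) • velocityForm (universalNambu k) (jetVar (some l)) γ

/-- The flow minus the contribution of the Casimirs is an antisymmetric bi-vector that annihilates
every Casimir, so `hdiv` applies. -/
theorem exists_densityPoly (hdiv : CasimirDivisible k) (hJ : IsPoisson (universalNambu k))
    {γ : List (ℤ × OrderedGraph (n + 1))} (hγ : IsGraphCocycle γ) (c : ℝ) :
    ∃ r : DiffPoly k, ∀ i j,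
      ((1 / 2 : ℝ) ^ (n + 1)) •
        flowComponent (universalNambu k) (γ.map fun t => (c * (t.1 : ℝ), t.2)) i j =
      nambuField r (fun l => jetVar (some l)) i j +
        casimirField (jetVar none) (fun l => jetVar (some l))
          (velocityPoly (γ.map fun t => (c * (t.1 : ℝ), t.2))) i j := by
  set γ' : GraphSum (n + 1) := γ.map fun t => (c * (t.1 : ℝ), t.2) with hγ'
  have hV := hdiv (fun i j => ((1 / 2 : ℝ) ^ (n + 1)) • flowComponent (universalNambu k) γ' i j -
    casimirField (jetVar none) (fun l => jetVar (some l)) (velocityPoly γ') i j) ?_ ?_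
  · obtain ⟨r, hr⟩ := hV
    exact ⟨r, fun i j => by rw [← hr i j, sub_add_cancel]⟩
  · intro i j
    rw [flowComponent_swap n.succ_pos, casimirField, casimirField]
    simp_rw [nambuField_swap _ _ i j]
    rw [Finset.sum_neg_distrib, smul_neg]
    abel
  · intro l j
    simp_rw [sub_mul]
    rw [Finset.sum_sub_distrib, sum_casimirField_casimir]
    -- Here the factor `-2` meets the normalizations: the flow has one more bi-vector than the
    -- velocity, hence one more factor `1 / 2`.
    have h := sum_der_mul_flowComponent (P := universalNambu k) (a := jetVar (some l))
      (nambuField_swap _ _) hJ (sum_nambuField_casimir _ _ l) hγ c j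
    simp_rw [smul_mul_assoc]
    rw [← Finset.smul_sum]
    simp_rw [mul_comm _ (DiffRing.der _ (jetVar (some l)))]
    rw [h, smul_smul]
    simp_rw [velocityPoly, Derivation.map_smul, mul_smul_comm]
    rw [← Finset.smul_sum, ← hγ', universalNambu, pow_succ]
    module

end Density

/-! ### Expansions at a point -/

section Expansion

variable {n d k : ℕ}

theorem partialD_coord (i c : Fin d) (x : Fin d → ℝ) :
    partialD c (coord i) x = (Pi.single i 1 : Fin d → ℝ) c := by
  have h : fderiv ℝ (coord i) x = ContinuousLinearMap.proj (R := ℝ) (φ := fun _ : Fin d => ℝ) i :=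
    (ContinuousLinearMap.proj (R := ℝ) (φ := fun _ : Fin d => ℝ) i).fderiv
  rw [partialD, h, ContinuousLinearMap.proj_apply, Pi.single_comm]

theorem nambuJacobian_eq (a : Fin k → Fn (k + 2)) (f g : Fn (k + 2)) (x : Fin (k + 2) → ℝ) :
    nambuJacobian a f g x = pairDet (fun l c => partialD c (a l) x) (fun c => partialD c f x)
      (fun c => partialD c g x) := by
  rw [nambuJacobian, jacobianDet, pairDet]
  congr 2
  funext i
  refine Fin.cases ?_ (fun i => Fin.cases ?_ (fun i => ?_) i) i <;> rfl

theorem nambuField_apply (ϱ : SmoothFn (k + 2)) (a : Fin k → SmoothFn (k + 2)) (i j : Fin (k + 2))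
    (x : Fin (k + 2) → ℝ) :
    (nambuField ϱ a i j).1 x = ϱ.1 x *
      pairDet (fun l c => partialD c (a l).1 x) (Pi.single i 1) (Pi.single j 1) := by
  have hs : ∀ i : Fin (k + 2), evalAt x ∘ (Pi.single i 1) = (Pi.single i 1 : Fin (k + 2) → ℝ) := by
    intro i
    funext c
    by_cases h : c = i
    · subst h; simp
    · simp [h]
  have h1 := map_pairDet (evalAt x : SmoothFn (k + 2) →+* ℝ) (gradients a) (Pi.single i 1)
    (Pi.single j 1)
  rw [RingHom.coe_coe, hs, hs] at h1
  rw [← evalAt_apply, nambuField, map_mul, h1]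
  rfl

theorem nambuBivector_coe (ϱ : SmoothFn (k + 2)) (a : Fin k → SmoothFn (k + 2)) :
    nambuBivector ϱ.1 (fun l => (a l).1) = fun i j => (nambuField ϱ a i j).1 := by
  funext i j x
  rw [nambuField_apply, nambuBivector, nambuBracket, nambuJacobian_eq]
  simp_rw [partialD_coord]

theorem nambuBracket_eq_sum (ϱ : SmoothFn (k + 2)) (a : Fin k → SmoothFn (k + 2))
    (f g : Fn (k + 2)) (x : Fin (k + 2) → ℝ) :
    nambuBracket ϱ.1 (fun l => (a l).1) f g x =
      ∑ i, ∑ j, partialD i f x * partialD j g x * (nambuField ϱ a i j).1 x := by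
  rw [nambuBracket, nambuJacobian_eq, pairDet_eq_sum, Finset.mul_sum]
  refine Finset.sum_congr rfl fun i _ => ?_
  rw [Finset.mul_sum]
  refine Finset.sum_congr rfl fun j _ => ?_
  rw [nambuField_apply]
  ring

theorem casimirTerms_eq_sum (ϱ : SmoothFn (k + 2)) (a b : Fin k → SmoothFn (k + 2))
    (f g : Fn (k + 2)) (x : Fin (k + 2) → ℝ) :
    casimirTerms ϱ.1 (fun l => (a l).1) (fun l => (b l).1) f g x =
      ∑ i, ∑ j, partialD i f x * partialD j g x * (casimirField ϱ a b i j).1 x := by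
  have h : ∀ l, Function.update (fun l => (a l).1) l (b l).1 =
      fun m => (Function.update a l (b l) m).1 := fun l =>
    (Function.comp_update (fun f : SmoothFn (k + 2) => f.1) a l (b l)).symm
  rw [casimirTerms]
  simp_rw [h, nambuBracket_eq_sum]
  rw [Finset.sum_comm]
  refine Finset.sum_congr rfl fun i _ => ?_
  rw [Finset.sum_comm]
  refine Finset.sum_congr rfl fun j _ => ?_
  rw [← Finset.mul_sum, casimirField, ← evalAt_apply, map_sum]
  rfl

theorem constRow_eq_sum {Q : Type*} (ξ : Fin d → ℝ) :
    (constRow ξ : SymbRow n Q d) = ∑ i, ξ i • constRow (Pi.single i 1) := by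
  funext b c
  simp only [Finset.sum_apply, Pi.smul_apply, constRow, smul_eq_C_mul, ← C_mul, ← map_sum]
  congr 1
  simp [Pi.single_apply]

/-- The sinks `f` and `g` enter only through their gradients at `x`, as constant rows, and the
determinant is linear in each of these. -/
theorem graphFlow_eq_sum {P : Fin d → Fin d → SmoothFn d} (hP : ∀ i j, P j i = -P i j)
    {γ : GraphSum n} (hγ : ∀ t ∈ γ, t.2.length + 2 = n * 2) (f g : Fn d) (x : Fin d → ℝ) :
    graphFlow γ (fun i j => (P i j).1) f g x = ∑ i, ∑ j, partialD i f x * partialD j g x *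
      (((1 / 2 : ℝ) ^ n) • flowComponent P γ i j).1 x := by
  have hgraph : ∀ E : OrderedGraph n, E.length + 2 = n * 2 →
      orientGraph E (fun _ => Content.bivector fun i j => (P i j).1) ![f, g] x =
      ∑ i, ∑ j, partialD i f x * partialD j g x * ((1 / 2 : ℝ) ^ n * evalAt x
        (orientList P Empty.elim (constRow (Pi.single i 1) :: constRow (Pi.single j 1) ::
          graphRows Sum.inl E))) := by
    intro E hE
    have h1 := orientGraph_eq E (Equiv.sumEmpty (Fin n) Empty).symm P Empty.elim ![f, g] x hP
      (fun b b' h => h) (by omega)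
    have h2 : (sinkRows ![f, g] x : List (SymbRow n Empty d)) =
        [constRow fun i => partialD i f x, constRow fun i => partialD i g x] := by
      simp [sinkRows]
    have h3 : vertexContent (Equiv.sumEmpty (Fin n) Empty).symm P Empty.elim =
      fun _ => Content.bivector fun i j => (P i j).1 := rfl
    have h4 : ∀ ξ η : Fin d → ℝ, orientList P Empty.elim (constRow ξ :: constRow η ::
        graphRows Sum.inl E) = ∑ i, ∑ j, (ξ i * η j) • orientList P Empty.elim
          (constRow (Pi.single i 1) :: constRow (Pi.single j 1) :: graphRows Sum.inl E) := by
      intro ξ η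
      have hl0 : ([] : List (SymbRow n Empty d)).length < n * 2 := by simp; omega
      have hl1 : ∀ r : SymbRow n Empty d, [r].length < n * 2 := by intro r; simp; omega
      have h5 := orientListAt_apply P Empty.elim [] (constRow η :: graphRows Sum.inl E) hl0
      rw [← List.nil_append (constRow ξ :: _), ← h5, constRow_eq_sum ξ, map_sum]
      refine Finset.sum_congr rfl fun i _ => ?_
      have h6 := orientListAt_apply P Empty.elim [constRow (Pi.single i 1)] (graphRows Sum.inl E)
        (hl1 _)
      rw [map_smul, h5, List.nil_append, ← List.singleton_append, ← h6, constRow_eq_sum η, map_sum,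
        Finset.smul_sum]
      refine Finset.sum_congr rfl fun j _ => ?_
      rw [map_smul, smul_smul, h6]
      rfl
    have h7 : (2 : ℝ) ^ n * (1 / 2) ^ n = 1 := by rw [← mul_pow]; norm_num
    rw [h3, h2, List.cons_append, List.cons_append, List.nil_append] at h1
    have h8 := h1.trans (congrArg (fun r : SmoothFn d => r.1 x) (h4 _ _))
    change _ = evalAt x _ at h8
    have h9 : ∀ y : ℝ, y = (1 / 2) ^ n * ((2 : ℝ) ^ n * y) := fun y => by
      rw [← mul_assoc, mul_comm _ ((2 : ℝ) ^ n), h7, one_mul]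
    rw [h9 (orientGraph _ _ _ _), h8, map_sum, Finset.mul_sum]
    refine Finset.sum_congr rfl fun i _ => ?_
    rw [map_sum, Finset.mul_sum]
    refine Finset.sum_congr rfl fun j _ => ?_
    rw [map_smul, smul_eq_mul]
    ring
  rw [graphFlow, orient]
  simp_rw [flowComponent, ← evalAt_apply, map_smul, map_list_sum]
  induction γ with
  | nil => simp
  | cons t γ ih =>
    rw [List.map_cons, List.sum_cons, ih fun t ht => hγ t (List.mem_cons_of_mem _ ht),
      hgraph t.2 (hγ t List.mem_cons_self), Finset.mul_sum, ← Finset.sum_add_distrib]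
    refine Finset.sum_congr rfl fun i _ => ?_
    rw [Finset.mul_sum, ← Finset.sum_add_distrib]
    refine Finset.sum_congr rfl fun j _ => ?_
    rw [List.map_cons, List.map_cons, List.sum_cons, map_smul, smul_eq_mul, smul_eq_mul,
      smul_eq_mul]
    ring

theorem sum_orient_update {P : Fin d → Fin d → SmoothFn d} (hP : ∀ i j, P j i = -P i j)
    {γ : GraphSum (n + 1)} (hγ : ∀ t ∈ γ, t.2.length = n * 2) (a : SmoothFn d) (x : Fin d → ℝ) :
    ∑ v, orient γ (Function.update (fun _ => Content.bivector fun i j => (P i j).1) v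
      (Content.scalar a.1)) ![] x = (((1 / 2 : ℝ) ^ n) • velocityForm P a γ).1 x := by
  have hgraph : ∀ (v : Fin (n + 1)) (E : OrderedGraph (n + 1)), E.length = n * 2 →
      orientGraph E (Function.update (fun _ => Content.bivector fun i j => (P i j).1) v
        (Content.scalar a.1)) ![] x =
      (1 / 2 : ℝ) ^ n * evalAt x (orientList P (fun _ : Unit => a) (graphRows (roleEquiv v) E)) := by
    intro v E hE
    have h1 := orientGraph_eq E (roleEquiv v) P (fun _ => a) ![] x hP
      (fun b b' h => by
        have h2 : ∀ b, (roleEquiv v).symm (Sum.inl b) = v.succAbove b := fun b => by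
          rw [Equiv.symm_apply_eq, roleEquiv_succAbove]
        change (roleEquiv v).symm (Sum.inl b) < (roleEquiv v).symm (Sum.inl b')
        rw [h2, h2]
        exact Fin.strictMono_succAbove v h) (by omega)
    have h3 : vertexContent (roleEquiv v) P (fun _ => a) =
        Function.update (fun _ => Content.bivector fun i j => (P i j).1) v
        (Content.scalar a.1) := by
      funext w
      by_cases hw : w = v
      · subst hw
        rw [Function.update_self, vertexContent, roleEquiv_self]
        rfl
      · obtain ⟨b, rfl⟩ := Fin.exists_succAbove_eq hw
        rw [Function.update_of_ne hw, vertexContent, roleEquiv_succAbove]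
        rfl
    have h7 : (2 : ℝ) ^ n * (1 / 2) ^ n = 1 := by rw [← mul_pow]; norm_num
    have h8 : (sinkRows ![] x : List (SymbRow n Unit d)) = [] := rfl
    rw [h3, h8, List.nil_append, ← evalAt_apply] at h1
    rw [← h1, ← mul_assoc, mul_comm _ ((2 : ℝ) ^ n), h7, one_mul]
  rw [velocityForm, ← evalAt_apply, map_smul, map_list_sum]
  simp_rw [orient]
  induction γ with
  | nil => simp
  | cons t γ ih =>
    have ih := ih fun t ht => hγ t (List.mem_cons_of_mem _ ht)
    simp_rw [List.map_cons, List.sum_cons]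
    rw [Finset.sum_add_distrib, ih, Finset.sum_congr rfl fun v _ => by
      rw [hgraph v t.2 (hγ t List.mem_cons_self)]]
    rw [map_smul, map_sum, smul_eq_mul, smul_eq_mul, smul_eq_mul, mul_add, Finset.mul_sum,
      Finset.mul_sum]
    congr 1
    exact Finset.sum_congr rfl fun v _ => by ring

end Expansion

/-- The data of smooth functions, as indexed by the variables of differential polynomials. -/
def smoothData {k : ℕ} {ϱ : Fn (k + 2)} {a : Fin k → Fn (k + 2)} (hϱ : ContDiff ℝ ∞ ϱ)
    (ha : ∀ i, ContDiff ℝ ∞ (a i)) : Option (Fin k) → SmoothFn (k + 2)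
  | none => ⟨ϱ, mem_smoothFn.2 hϱ⟩
  | some l => ⟨a l, mem_smoothFn.2 (ha l)⟩

/-! ### Specialization of differential polynomials to given smooth data. -/

section Evaluation

variable {n k : ℕ} {ϱ : Fn (k + 2)} {a : Fin k → Fn (k + 2)} (hϱ : ContDiff ℝ ∞ ϱ)
  (ha : ∀ i, ContDiff ℝ ∞ (a i))

theorem jetHom_smoothData (p : DiffPoly k) : (jetHom (smoothData hϱ ha) p).1 = p.value ϱ a :=
  funext fun x => jetHom_apply _ p x

theorem jetHom_universalNambu (i j : Fin (k + 2)) :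
    jetHom (smoothData hϱ ha) (universalNambu k i j) =
      nambuField (smoothData hϱ ha none) (fun l => smoothData hϱ ha (some l)) i j := by
  rw [universalNambu, map_nambuField _ (jetHom_der _)]
  simp_rw [jetHom_jetVar]

theorem nambuBivector_smoothData : nambuBivector ϱ a = fun i j =>
    (nambuField (smoothData hϱ ha none) (fun l => smoothData hϱ ha (some l)) i j).1 :=
  nambuBivector_coe (smoothData hϱ ha none) fun l => smoothData hϱ ha (some l)

theorem casimirVelocity_eq (hϱ : ContDiff ℝ ∞ ϱ) (ha : ∀ i, ContDiff ℝ ∞ (a i)) {γ : GraphSum (n + 1)} (hγ : ∀ t ∈ γ, t.2.length + 2 = (n + 1) * 2)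
    (l : Fin k) : casimirVelocity γ ϱ a l = (velocityPoly γ l).value ϱ a := by
  funext x
  rw [casimirVelocity, nambuBivector_smoothData hϱ ha]
  refine (sum_orient_update (nambuField_swap _ _) (fun t ht => by have := hγ t ht; omega)
    (smoothData hϱ ha (some l)) x).trans ?_
  rw [← jetHom_smoothData hϱ ha, velocityPoly, map_smul, map_velocityForm _ (jetHom_der _),
    jetHom_jetVar]
  simp_rw [jetHom_universalNambu]

end Evaluation

/-! ### From graph cocycles to the Leibniz rule and the formula for the density. -/

theorem graphFormulasHold_of_isGraphCocycle {n k : ℕ} (hdiv : CasimirDivisible k)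
    (hJ : IsPoisson (universalNambu k)) {γ : List (ℤ × OrderedGraph (n + 1))}
    (hγ : IsGraphCocycle γ) (c : ℝ) :
    GraphFormulasHold k (γ.map fun t => (c * (t.1 : ℝ), t.2) : GraphSum (n + 1)) := by
  obtain ⟨r, hr⟩ := exists_densityPoly hdiv hJ hγ c
  have hlen : ∀ t ∈ (γ.map fun t => (c * (t.1 : ℝ), t.2) : GraphSum (n + 1)),
      t.2.length + 2 = (n + 1) * 2 := by
    intro t ht
    obtain ⟨s, hs, rfl⟩ := List.mem_map.1 ht
    exact (hγ.1 s hs).1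
  generalize (γ.map fun t => (c * (t.1 : ℝ), t.2) : GraphSum (n + 1)) = γ' at hr hlen ⊢
  have hL : LeibnizRule (graphFlow γ') r (velocityPoly γ') := by
    intro ϱ a f g hϱ ha _ _ x
    have hf : ∀ i j, ((1 / 2 : ℝ) ^ (n + 1)) • flowComponent (nambuField (smoothData hϱ ha none)
        fun l => smoothData hϱ ha (some l)) γ' i j =
        nambuField (jetHom (smoothData hϱ ha) r) (fun l => smoothData hϱ ha (some l)) i j +
        casimirField (smoothData hϱ ha none) (fun l => smoothData hϱ ha (some l))
          (fun l => jetHom (smoothData hϱ ha) (velocityPoly γ' l)) i j := by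
      intro i j
      -- Specialize the universal identity to the given smooth functions.
      have h := congrArg (jetHom (smoothData hϱ ha)) (hr i j)
      rw [map_smul, map_add, map_flowComponent (jetHom (smoothData hϱ ha)) (jetHom_der _),
        map_nambuField (jetHom (smoothData hϱ ha)) (jetHom_der _),
        map_casimirField (jetHom (smoothData hϱ ha)) (jetHom_der _)] at h
      simp_rw [jetHom_jetVar, jetHom_universalNambu] at h
      exact h
    have h2 := nambuBracket_eq_sum (jetHom (smoothData hϱ ha) r)
      (fun l => smoothData hϱ ha (some l)) f g x
    have h3 := casimirTerms_eq_sum (smoothData hϱ ha none) (fun l => smoothData hϱ ha (some l))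
      (fun l => jetHom (smoothData hϱ ha) (velocityPoly γ' l)) f g x
    simp only [jetHom_smoothData] at h2 h3
    rw [nambuBivector_smoothData hϱ ha, graphFlow_eq_sum (nambuField_swap _ _) hlen]
    refine Eq.trans ?_ (congrArg₂ (· + ·) h2.symm h3.symm)
    simp_rw [hf, ← Finset.sum_add_distrib, ← mul_add]
    rfl
  refine ⟨r, velocityPoly γ', fun ϱ a hϱ ha => ⟨fun l x => ?_, fun f g hf hg x hx => ?_⟩, hL⟩
  · rw [casimirVelocity_eq hϱ ha hlen]
  · rw [densityVelocityFraction, div_eq_iff hx, funext (casimirVelocity_eq hϱ ha hlen),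
      hL ϱ a f g hϱ ha hf hg x, add_sub_cancel_right, nambuBracket]

theorem GraphFormulasHold.preservesNambuClass {n k : ℕ} {γ : GraphSum n}
    (h : GraphFormulasHold k γ) : PreservesNambuClass k (graphFlow γ) := by
  obtain ⟨R, A, -, h⟩ := h
  exact ⟨R, A, h⟩

theorem map_tetrahedron : tetrahedron.map (fun t => ((1 : ℝ) * (t.1 : ℝ), t.2)) = gamma3 := by
  simp [tetrahedron, gamma3]

theorem map_pentagonWheel :
    pentagonWheel.map (fun t => ((1 / 2 : ℝ) * (t.1 : ℝ), t.2)) = gamma5 := by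
  norm_num [pentagonWheel, gamma5]

end NambuFlow

end

/-- The dimensions are `d = k + 2` with `k` Casimirs: `γ₃` over `d = 3` and `d = 4`, and `γ₅`
over `d = 3`. -/
theorem mainTheorem5 :
    (NambuFlow.GraphFormulasHold 1 NambuFlow.gamma3 ∧
      NambuFlow.PreservesNambuClass 1 (NambuFlow.graphFlow NambuFlow.gamma3)) ∧
    (NambuFlow.GraphFormulasHold 2 NambuFlow.gamma3 ∧
      NambuFlow.PreservesNambuClass 2 (NambuFlow.graphFlow NambuFlow.gamma3)) ∧
    (NambuFlow.GraphFormulasHold 1 NambuFlow.gamma5 ∧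
      NambuFlow.PreservesNambuClass 1 (NambuFlow.graphFlow NambuFlow.gamma5)) := by
  have h1 : NambuFlow.GraphFormulasHold 1 NambuFlow.gamma3 := by
    rw [← NambuFlow.map_tetrahedron]
    exact NambuFlow.graphFormulasHold_of_isGraphCocycle NambuFlow.casimirDivisible_one
      (NambuFlow.isPoisson_nambuField_three _ _) NambuFlow.isGraphCocycle_tetrahedron 1
  have h2 : NambuFlow.GraphFormulasHold 2 NambuFlow.gamma3 := by
    rw [← NambuFlow.map_tetrahedron]
    exact NambuFlow.graphFormulasHold_of_isGraphCocycle NambuFlow.casimirDivisible_two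
      (NambuFlow.isPoisson_nambuField_four _ _) NambuFlow.isGraphCocycle_tetrahedron 1
  have h3 : NambuFlow.GraphFormulasHold 1 NambuFlow.gamma5 := by
    -- The factor `1 / 2` undoes the doubling that made the coefficients integers.
    rw [← NambuFlow.map_pentagonWheel]
    exact NambuFlow.graphFormulasHold_of_isGraphCocycle NambuFlow.casimirDivisible_one
      (NambuFlow.isPoisson_nambuField_three _ _) NambuFlow.isGraphCocycle_pentagonWheel (1 / 2)
  exact ⟨⟨h1, h1.preservesNambuClass⟩, ⟨h2, h2.preservesNambuClass⟩, ⟨h3, h3.preservesNambuClass⟩⟩
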